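/- **Conventions.** A *unit interval order* (UIO) is a finite poset $U$ isomorphic to a finite set of real numbers ordered by $w\prec u \iff w+1\le u$. Write $u\sim w$ if neither $u\prec w$ nor $w\prec u$ (so $u\sim u$), and let $G=\mathrm{inc}(U)$ be the graph on $U$ joining distinct incomparable elements. Let $\Lambda$ be the ring of symmetric functions over $\mathbb Z$ in infinitely many variables, with elementary symmetric functions $e_k$ and monomial symmetric functions $m_\lambda$. Let $e_k^G\in\mathbb Z[U]$ (polynomials whose variables are the elements of $U$) be the sum of $\prod_{v\in S}v$ over all $k$-element stable sets $S$ of $G$, let $\phi_G:\Lambda\to\mathbb Z[U]$ be the ring homomorphism with $\phi_G(e_k)=e_k^G$ for $k\ge 1$, and put $m_\lambda^U=\phi_G(m_\lambda)$. Let $X_G=\sum_c\prod_{v}x_{c(v)}$ (sum over the proper colorings $c:U\to\mathbb N$) be the chromatic symmetric function, and for $n=|U|$ write $X_G=\sum_{\lambda\vdash n}c_\lambda(U)\,e_\lambda$ with $c_\lambda(U)\in\mathbb Z$; this expansion exists and is unique. A sequence $(w_1,\dots,w_k)$ in $U$ is *correct* if $w_i\not\succ w_{i+1}$ for $1\le i<k$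 and for every $2\le j\le k$ there is $i<j$ with $w_i\not\prec w_j$. For a correct $\vec w=(w_1,\dots,w_l)$ with $l\ge2$ let $\theta=\max\{i<l: w_i\sim w_{i+1}\}$ (this set contains $1$). Write $z\succ\vec w$ if $z\succ w_i$ for all $i$. Below $\vec w$ is a correct sequence of length $l$, $\vec q=(q_1,q_2)$ is a correct sequence of length $2$, and $z\in U$. Let $$M^U_{l,1}=\{(\vec w\,|\,z): z\succ\vec w \text{ or } z\prec w_l\},$$ (so that $(\vec q\,|\,z)\in M^U_{2,1}$ iff $z\succ\vec q$ or $z\prec q_2$), and $$M^U_{l,2}=\{(\vec w\,|\,\vec q): (w_i\prec q_1 \text{ for all } i<l,\ \text{and } w_l\prec q_2)\ \text{ or }\ (w_\theta\succ q_1 \text{ and } w_{\theta+1}\succ q_2)\}.$$ For $l\ge 2$ let $M^U_{l,2,1}$ be the set of all triples $(\vec w\,|\,\vec q\,|\,z)$ satisfying at least one of: 1. $(\vec w\,|\,\vec q)\in M^U_{l,2}$, $(\vec w\,|\,z)\in M^U_{l,1}$ and $(\vec q\,|\,z)\in M^U_{2,1}$; 2. $w_l\succ z\succ\vec q$, and there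 is $\gamma$ with $\theta<\gamma<l$, $w_\gamma\sim z$ and $w_\gamma\succ q_2$; 3. $w_l\succ z\succ q_2$, $z\sim q_1$, and there is $\gamma$ with $\theta<\gamma<l$, $w_\gamma\sim z$ and $w_\gamma\succ q_1$. **Theorem.** Let $U$ be a unit interval order. (a) For every $l\ge 3$, $$m^U_{l,2,1}=\sum_{(\vec w|\vec q|z)\in M^U_{l,2,1}} w_1\cdots w_l\cdot q_1\cdot q_2\cdot z .$$ (b) For $l=2$ the same sum equals $2\,m^U_{2,2,1}$. (c) Consequently, if $n=|U|\ge 5$, then $c_{n-3,2,1}(U)\ge 0$. -/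

import Mathlib

open MvPolynomial

/-! ### Symmetric functions in infinitely many variables -/

/-- The ring `Λ` of symmetric functions over `ℤ`: the power series of bounded degree in the
variables `x_0, x_1, x_2, …` that are invariant under all permutations of the variables. -/
noncomputable def SymFunc : Subalgebra ℤ (MvPowerSeries ℕ ℤ) where
  carrier := {f | (∀ σ : Equiv.Perm ℕ, MvPowerSeries.renameEquiv ℤ σ f = f) ∧
    ∃ N : ℕ, ∀ d : ℕ →₀ ℕ, N < d.degree → MvPowerSeries.coeff d f = 0}
  mul_mem' := by
    rintro f g ⟨hf, N, hN⟩ ⟨hg, M, hM⟩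
    refine ⟨fun σ => by rw [map_mul, hf, hg], N + M, fun d hd => ?_⟩
    classical
    rw [MvPowerSeries.coeff_mul]
    refine Finset.sum_eq_zero fun p hp => ?_
    have h : p.1.degree + p.2.degree = d.degree := by
      rw [← Finset.HasAntidiagonal.mem_antidiagonal.mp hp, map_add]
    rcases lt_or_ge N p.1.degree with h1 | h1
    · rw [hN _ h1, zero_mul]
    · rw [hM _ (by omega), mul_zero]
  add_mem' := by
    rintro f g ⟨hf, N, hN⟩ ⟨hg, M, hM⟩
    refine ⟨fun σ => by rw [map_add, hf, hg], N + M, fun d hd => ?_⟩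
    rw [map_add, hN _ (by omega), hM _ (by omega), add_zero]
  algebraMap_mem' := by
    intro r
    refine ⟨fun σ => AlgEquiv.commutes _ r, 0, fun d hd => ?_⟩
    classical
    rw [MvPowerSeries.algebraMap_apply, MvPowerSeries.coeff_C, if_neg]
    rintro rfl
    simp at hd

lemma coeff_renameEquiv_perm (σ : Equiv.Perm ℕ) (f : MvPowerSeries ℕ ℤ) (d : ℕ →₀ ℕ) :
    MvPowerSeries.coeff (d.embDomain σ.toEmbedding) (MvPowerSeries.renameEquiv ℤ σ f) =
      MvPowerSeries.coeff d f :=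
  MvPowerSeries.coeff_embDomain_rename σ.toEmbedding f d

lemma renameEquiv_eq_self_iff (f : MvPowerSeries ℕ ℤ) (σ : Equiv.Perm ℕ)
    (h : ∀ d : ℕ →₀ ℕ, MvPowerSeries.coeff (d.embDomain σ.toEmbedding) f =
      MvPowerSeries.coeff d f) :
    MvPowerSeries.renameEquiv ℤ σ f = f := by
  ext d
  obtain ⟨d', rfl⟩ : ∃ d' : ℕ →₀ ℕ, d'.embDomain σ.toEmbedding = d := by
    refine ⟨d.embDomain σ.symm.toEmbedding, ?_⟩
    rw [Finsupp.embDomain_eq_mapDomain, Finsupp.embDomain_eq_mapDomain, ← Finsupp.mapDomain_comp]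
    convert Finsupp.mapDomain_id
    ext x; simp
  rw [coeff_renameEquiv_perm, h]

/-- The underlying power series of the elementary symmetric function `e_k`: the sum of all
squarefree monomials of degree `k`. -/
noncomputable def elemSeries (k : ℕ) : MvPowerSeries ℕ ℤ := fun d =>
  open Classical in if (∀ i, d i ≤ 1) ∧ d.degree = k then 1 else 0

/-- The underlying power series of the monomial symmetric function `m_μ`: the sum of all
monomials whose multiset of nonzero exponents is the multiset `μ` of positive integers. -/
noncomputable def monoSeries (μ : Multiset ℕ) : MvPowerSeries ℕ ℤ := fun d =>
  if d.support.val.map d = μ then 1 else 0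

lemma coeff_elemSeries (k : ℕ) (d : ℕ →₀ ℕ) [Decidable ((∀ i, d i ≤ 1) ∧ d.degree = k)] :
    MvPowerSeries.coeff d (elemSeries k) = if (∀ i, d i ≤ 1) ∧ d.degree = k then 1 else 0 := by
  change elemSeries k d = _
  unfold elemSeries
  congr

lemma coeff_monoSeries (μ : Multiset ℕ) (d : ℕ →₀ ℕ) :
    MvPowerSeries.coeff d (monoSeries μ) = if d.support.val.map d = μ then 1 else 0 := rfl

lemma degree_embDomain_nat {α : Type*} (σ : α ↪ ℕ) (d : α →₀ ℕ) :
    (d.embDomain σ).degree = d.degree := by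
  rw [Finsupp.embDomain_eq_mapDomain, Finsupp.degree_mapDomain]

lemma embDomain_le_one_iff {α : Type*} (σ : α ↪ ℕ) (d : α →₀ ℕ) :
    (∀ i, d.embDomain σ i ≤ 1) ↔ ∀ i, d i ≤ 1 := by
  constructor
  · intro h i
    simpa using h (σ i)
  · intro h i
    by_cases hi : i ∈ Set.range σ
    · obtain ⟨j, rfl⟩ := hi
      simpa using h j
    · rw [Finsupp.embDomain_of_notMem_range _ _ _ hi]
      exact Nat.zero_le _

lemma elemSeries_mem (k : ℕ) : elemSeries k ∈ SymFunc := by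
  classical
  refine ⟨fun σ => renameEquiv_eq_self_iff _ _ fun d => ?_, k, fun d hd => ?_⟩
  · simp only [coeff_elemSeries, embDomain_le_one_iff, degree_embDomain_nat]
  · rw [coeff_elemSeries, if_neg]
    rintro ⟨-, h⟩
    omega

lemma monoSeries_mem (μ : Multiset ℕ) : monoSeries μ ∈ SymFunc := by
  refine ⟨fun σ => renameEquiv_eq_self_iff _ _ fun d => ?_, μ.sum, fun d hd => ?_⟩
  · have : (d.embDomain σ.toEmbedding).support.val.map (d.embDomain σ.toEmbedding) =
        d.support.val.map d := by
      rw [Finsupp.support_embDomain, Finset.map_val, Multiset.map_map]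
      refine Multiset.map_congr rfl fun x _ => ?_
      exact Finsupp.embDomain_apply_self _ _ _
    simp only [coeff_monoSeries, this]
  · rw [coeff_monoSeries, if_neg]
    rintro rfl
    have : d.degree = (d.support.val.map d).sum := rfl
    omega

/-- The elementary symmetric function `e_k ∈ Λ`. -/
noncomputable def elemSym (k : ℕ) : SymFunc := ⟨elemSeries k, elemSeries_mem k⟩

/-- The monomial symmetric function `m_μ ∈ Λ`. -/
noncomputable def monoSym (μ : Multiset ℕ) : SymFunc := ⟨monoSeries μ, monoSeries_mem μ⟩

/-- The ring homomorphism `ℤ[y_0, y_1, …] → Λ` with `y_i ↦ e_{i+1}`. -/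
noncomputable def elemHom : MvPolynomial ℕ ℤ →ₐ[ℤ] SymFunc :=
  aeval fun i => elemSym (i + 1)

/-! #### The fundamental theorem: `elemHom` is bijective -/

lemma elemHom_val (F : MvPolynomial ℕ ℤ) :
    (elemHom F : MvPowerSeries ℕ ℤ) = aeval (fun i => elemSeries (i + 1)) F :=
  (Subalgebra.mvPolynomial_aeval_coe SymFunc (fun i => elemSym (i + 1)) F).symm

lemma killCompl_elemSeries (N k : ℕ) :
    MvPowerSeries.killCompl (Fin.valEmbedding : Fin N ↪ ℕ) (elemSeries k) =
      (esymm (Fin N) ℤ k : MvPowerSeries (Fin N) ℤ) := by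
  classical
  ext d
  rw [MvPowerSeries.coeff_killCompl, coeff_elemSeries, embDomain_le_one_iff, degree_embDomain_nat,
    MvPolynomial.coeff_coe, esymm_eq_sum_monomial, coeff_sum]
  simp only [coeff_monomial]
  have key : ∀ t : Finset (Fin N), (∑ i ∈ t, Finsupp.single i 1 = d) ↔
      (∀ i, d i ≤ 1) ∧ t = d.support := by
    intro t
    have hval : ∀ j, (∑ i ∈ t, Finsupp.single i (1 : ℕ)) j = if j ∈ t then 1 else 0 := by
      intro j
      simp [Finsupp.finsetSum_apply, Finsupp.single_apply]
    constructor
    · rintro rfl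
      refine ⟨fun i => by rw [hval]; split_ifs <;> omega, ?_⟩
      ext j
      simp [Finsupp.mem_support_iff, hval]
    · rintro ⟨h, rfl⟩
      ext j
      rw [hval]
      have := h j
      split_ifs with hj
      · have := Finsupp.mem_support_iff.mp hj
        omega
      · have := Finsupp.notMem_support_iff.mp hj
        omega
  simp only [key]
  by_cases h1 : ∀ i, d i ≤ 1
  · have hdeg : d.degree = d.support.card := by
      rw [Finset.card_eq_sum_ones]
      refine Finset.sum_congr rfl fun i hi => ?_
      have := h1 i
      have := Finsupp.mem_support_iff.mp hi
      omega
    simp only [h1, true_and, implies_true, hdeg]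
    rw [Finset.sum_ite_eq']
    simp [Finset.mem_powersetCard]
  · simp [h1]

lemma killCompl_elemHom_rename (N : ℕ) (F : MvPolynomial (Fin N) ℤ) :
    MvPowerSeries.killCompl (Fin.valEmbedding : Fin N ↪ ℕ)
      (elemHom (rename Fin.val F) : MvPowerSeries ℕ ℤ) =
      ((esymmAlgHom (Fin N) ℤ N F).val : MvPowerSeries (Fin N) ℤ) := by
  rw [elemHom_val, esymmAlgHom_apply, aeval_rename, ← AlgHom.comp_apply]
  have : ((MvPolynomial.aeval (fun i : Fin N => esymm (Fin N) ℤ (i + 1)) F :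
      MvPolynomial (Fin N) ℤ) : MvPowerSeries (Fin N) ℤ) =
      ((coeToMvPowerSeries.algHom (σ := Fin N) (R := ℤ) ℤ).comp
        (aeval (fun i : Fin N => esymm (Fin N) ℤ (i + 1)))) F := by
    simp
  rw [this]
  congr 1
  apply MvPolynomial.algHom_ext
  intro i
  simp [killCompl_elemSeries]

lemma elemHom_injective : Function.Injective elemHom := by
  rw [injective_iff_map_eq_zero]
  intro F hF
  obtain ⟨N, hN⟩ : ∃ N, ∀ i ∈ F.vars, i < N := by
    refine ⟨F.vars.sup id + 1, fun i hi => Nat.lt_succ_of_le ?_⟩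
    exact Finset.le_sup (f := id) hi
  obtain ⟨G, rfl⟩ := exists_rename_eq_of_vars_subset_range F (Fin.val : Fin N → ℕ)
    Fin.val_injective (fun i hi => ⟨⟨i, hN i hi⟩, rfl⟩)
  have h := killCompl_elemHom_rename N G
  rw [hF, ZeroMemClass.coe_zero, map_zero] at h
  have h2 : esymmAlgHom (Fin N) ℤ N G = 0 := by
    apply Subtype.ext
    apply MvPolynomial.coe_injective
    rw [← h]
    simp
  rw [(injective_iff_map_eq_zero _).mp (esymmAlgHom_fin_injective (R := ℤ) le_rfl) G h2, map_zero]

/-- `f` is homogeneous of degree `n`. -/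
def HomogSeries (n : ℕ) (f : MvPowerSeries ℕ ℤ) : Prop :=
  ∀ d : ℕ →₀ ℕ, MvPowerSeries.coeff d f ≠ 0 → d.degree = n

lemma HomogSeries.mul {m n : ℕ} {f g : MvPowerSeries ℕ ℤ} (hf : HomogSeries m f)
    (hg : HomogSeries n g) : HomogSeries (m + n) (f * g) := by
  classical
  intro d hd
  rw [MvPowerSeries.coeff_mul] at hd
  obtain ⟨p, hp, hne⟩ := Finset.exists_ne_zero_of_sum_ne_zero hd
  rw [← Finset.HasAntidiagonal.mem_antidiagonal.mp hp, map_add, hf _ (left_ne_zero_of_mul hne),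
    hg _ (right_ne_zero_of_mul hne)]

lemma exists_homog_elemHom_monomial (s : ℕ →₀ ℕ) (a : ℤ) :
    ∃ n, HomogSeries n (elemHom (monomial s a) : MvPowerSeries ℕ ℤ) := by
  classical
  induction s using Finsupp.induction_linear generalizing a with
  | zero =>
    refine ⟨0, fun d hd => ?_⟩
    rw [elemHom_val, ← C_apply, MvPolynomial.algHom_C, MvPowerSeries.algebraMap_apply,
      MvPowerSeries.coeff_C] at hd
    have : d = 0 := by
      by_contra h
      simp [h] at hd
    simp [this]
  | add s t hs ht =>
    obtain ⟨m, hm⟩ := hs a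
    obtain ⟨n, hn⟩ := ht 1
    refine ⟨m + n, ?_⟩
    have : monomial (s + t) a = monomial s a * monomial t (1 : ℤ) := by
      rw [monomial_mul, mul_one]
    rw [this, map_mul, MulMemClass.coe_mul]
    exact hm.mul hn
  | single i k =>
    induction k with
    | zero =>
      refine ⟨0, fun d hd => ?_⟩
      rw [Finsupp.single_zero, elemHom_val, ← C_apply, MvPolynomial.algHom_C,
        MvPowerSeries.algebraMap_apply, MvPowerSeries.coeff_C] at hd
      have : d = 0 := by
        by_contra h
        simp [h] at hd
      simp [this]
    | succ k ih =>
      obtain ⟨m, hm⟩ := ih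
      refine ⟨m + (i + 1), ?_⟩
      have : monomial (Finsupp.single i (k + 1)) a = monomial (Finsupp.single i k) a * X i := by
        rw [X, monomial_mul, mul_one, ← Finsupp.single_add]
      rw [this, map_mul, MulMemClass.coe_mul]
      refine hm.mul fun d hd => ?_
      rw [elemHom_val, aeval_X, coeff_elemSeries] at hd
      by_contra h
      simp [h] at hd

/-- Truncation of a series at total degree `N`. -/
noncomputable def truncSeries (N : ℕ) : MvPowerSeries ℕ ℤ →+ MvPowerSeries ℕ ℤ where
  toFun f := fun d => if d.degree ≤ N then f d else 0
  map_zero' := by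
    funext d
    exact ite_self _
  map_add' f g := by
    funext d
    change (if d.degree ≤ N then f d + g d else 0) =
      (if d.degree ≤ N then f d else 0) + (if d.degree ≤ N then g d else 0)
    split_ifs <;> simp

lemma truncSeries_apply (N : ℕ) (f : MvPowerSeries ℕ ℤ) (d : ℕ →₀ ℕ) :
    MvPowerSeries.coeff d (truncSeries N f) =
      if d.degree ≤ N then MvPowerSeries.coeff d f else 0 := rfl

lemma exists_truncSeries_elemHom (N : ℕ) (F : MvPolynomial ℕ ℤ) :
    ∃ F', truncSeries N (elemHom F : MvPowerSeries ℕ ℤ) = elemHom F' := by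
  induction F using MvPolynomial.induction_on' with
  | monomial s a =>
    obtain ⟨n, hn⟩ := exists_homog_elemHom_monomial s a
    by_cases h : n ≤ N
    · refine ⟨monomial s a, ?_⟩
      ext d
      rw [truncSeries_apply]
      split_ifs with hd
      · rfl
      · by_contra h0
        exact hd (by rw [hn d (Ne.symm h0)]; exact h)
    · refine ⟨0, ?_⟩
      ext d
      rw [truncSeries_apply, map_zero, ZeroMemClass.coe_zero, map_zero]
      split_ifs with hd
      · by_contra h0
        exact h (by rw [← hn d h0]; exact hd)
      · rfl
  | add p q hp hq =>
    obtain ⟨p', hp⟩ := hp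
    obtain ⟨q', hq⟩ := hq
    refine ⟨p' + q', ?_⟩
    rw [map_add, map_add, AddMemClass.coe_add, AddMemClass.coe_add, map_add, hp, hq]

lemma exists_perm_support_lt {N : ℕ} (s : Finset ℕ) (hs : s.card ≤ N) :
    ∃ σ : Equiv.Perm ℕ, ∀ i ∈ s, σ i < N := by
  let x : Fin s.card ↪ ℕ := (s.equivFin.symm.toEmbedding).trans (Function.Embedding.subtype _)
  obtain ⟨σ, hσ⟩ := (Equiv.Perm.isMultiplyPretransitive ℕ s.card).exists_smul_eq x
    (Fin.valEmbedding)
  refine ⟨σ, fun i hi => ?_⟩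
  have h := DFunLike.congr_fun hσ (s.equivFin ⟨i, hi⟩)
  have hx : x (s.equivFin ⟨i, hi⟩) = i := by simp [x]
  rw [Function.Embedding.smul_apply, hx] at h
  have h' : σ i = (s.equivFin ⟨i, hi⟩ : ℕ) := h
  rw [h']
  exact lt_of_lt_of_le (Fin.is_lt _) hs

lemma truncSeries_eq_zero {N : ℕ} {g : MvPowerSeries ℕ ℤ} (hg : g ∈ SymFunc)
    (h : MvPowerSeries.killCompl (Fin.valEmbedding : Fin N ↪ ℕ) g = 0) : truncSeries N g = 0 := by
  ext d
  rw [truncSeries_apply, map_zero]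
  split_ifs with hd
  swap
  · rfl
  have hcard : d.support.card ≤ N := by
    refine le_trans ?_ hd
    rw [Finset.card_eq_sum_ones]
    refine Finset.sum_le_sum fun i hi => ?_
    exact Nat.one_le_iff_ne_zero.mpr (Finsupp.mem_support_iff.mp hi)
  obtain ⟨σ, hσ⟩ := exists_perm_support_lt d.support hcard
  rw [← coeff_renameEquiv_perm σ, hg.1 σ]
  obtain ⟨d', hd'⟩ : ∃ d' : Fin N →₀ ℕ,
      d'.embDomain Fin.valEmbedding = d.embDomain σ.toEmbedding := by
    refine ⟨(d.embDomain σ.toEmbedding).comapDomain Fin.val Fin.val_injective.injOn, ?_⟩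
    rw [Finsupp.embDomain_eq_mapDomain]
    refine Finsupp.mapDomain_comapDomain _ Fin.val_injective _ ?_
    intro i hi
    rw [Finset.mem_coe, Finsupp.support_embDomain, Finset.mem_map] at hi
    obtain ⟨j, hj, rfl⟩ := hi
    exact ⟨⟨σ j, hσ j hj⟩, rfl⟩
  rw [← hd', ← MvPowerSeries.coeff_killCompl, h, map_zero]

lemma exists_symmetric_killCompl {N : ℕ} {f : MvPowerSeries ℕ ℤ} (hf : f ∈ SymFunc) :
    ∃ p : MvPolynomial (Fin N) ℤ, p.IsSymmetric ∧
      (p : MvPowerSeries (Fin N) ℤ) = MvPowerSeries.killCompl Fin.valEmbedding f := by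
  classical
  obtain ⟨hs, M, hM⟩ := hf
  let r := MvPowerSeries.killCompl (Fin.valEmbedding : Fin N ↪ ℕ) f
  let S : Finset (Fin N →₀ ℕ) := (Finsupp.finite_of_degree_le (σ := Fin N) M).toFinset
  let p := MvPowerSeries.truncFinset ℤ S r
  have hp : (p : MvPowerSeries (Fin N) ℤ) = r := by
    ext d
    rw [MvPolynomial.coeff_coe]
    by_cases hd : d ∈ S
    · exact MvPowerSeries.coeff_truncFinset_of_mem r hd
    · rw [MvPowerSeries.coeff_truncFinset_eq_zero r hd]
      rw [MvPowerSeries.coeff_killCompl, hM]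
      rw [degree_embDomain_nat]
      simpa [S] using hd
  refine ⟨p, fun σ => ?_, hp⟩
  ext d
  obtain ⟨d', rfl⟩ : ∃ d', Finsupp.mapDomain σ d' = d := by
    refine ⟨Finsupp.mapDomain σ.symm d, ?_⟩
    rw [← Finsupp.mapDomain_comp]
    convert Finsupp.mapDomain_id
    ext x; simp
  rw [coeff_rename_mapDomain _ σ.injective, ← MvPolynomial.coeff_coe, ← MvPolynomial.coeff_coe, hp,
    MvPowerSeries.coeff_killCompl, MvPowerSeries.coeff_killCompl]
  let τ : Equiv.Perm ℕ := σ.viaFintypeEmbedding Fin.valEmbedding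
  rw [← coeff_renameEquiv_perm τ, hs τ]
  congr 1
  simp only [Finsupp.embDomain_eq_mapDomain, ← Finsupp.mapDomain_comp]
  congr 2
  ext i
  exact Equiv.Perm.viaFintypeEmbedding_apply_image σ Fin.valEmbedding i

lemma elemHom_surjective : Function.Surjective elemHom := by
  intro f
  obtain ⟨N, hN⟩ := f.2.2
  obtain ⟨p, hp, hpf⟩ := exists_symmetric_killCompl (N := N) f.2
  obtain ⟨F, hF⟩ := esymmAlgHom_fin_surjective (n := N) ℤ le_rfl ⟨p, hp⟩
  have h0 : MvPowerSeries.killCompl (Fin.valEmbedding : Fin N ↪ ℕ)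
      (f - elemHom (rename Fin.val F) : SymFunc).val = 0 := by
    rw [AddSubgroupClass.coe_sub, map_sub, killCompl_elemHom_rename, hF, ← hpf, sub_self]
  have h1 := truncSeries_eq_zero (f - elemHom (rename Fin.val F)).2 h0
  rw [AddSubgroupClass.coe_sub, map_sub, sub_eq_zero] at h1
  obtain ⟨F', hF'⟩ := exists_truncSeries_elemHom N (rename Fin.val F)
  refine ⟨F', Subtype.ext ?_⟩
  rw [← hF', ← h1]
  ext d
  rw [truncSeries_apply]
  split_ifs with hd
  · rfl
  · exact (hN d (not_le.mp hd)).symm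

/-- The isomorphism `ℤ[y_0, y_1, …] ≃ Λ` with `y_i ↦ e_{i+1}`. -/
noncomputable def elemEquiv : MvPolynomial ℕ ℤ ≃ₐ[ℤ] SymFunc :=
  AlgEquiv.ofBijective elemHom ⟨elemHom_injective, elemHom_surjective⟩

/-! ### Graphs: chromatic symmetric function and the `G`-homomorphism -/

/-- The chromatic symmetric function `X_G`: the sum of the monomials `∏ v, x_{c v}` over all proper
colorings `c : V → ℕ`; its coefficient at `x^d` is the number of proper colorings which use
every color `i` exactly `d i` times. -/
noncomputable def chromSeries {V : Type*} [Fintype V] (G : SimpleGraph V) : MvPowerSeries ℕ ℤ :=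
  fun d => (Nat.card {c : G.Coloring ℕ // ∀ i, Nat.card {v : V // c v = i} = d i} : ℤ)

/-- The elementary `G`-symmetric polynomial `e_k^G`: the sum over the stable `k`-subsets of the
vertex set of the products of their elements. -/
noncomputable def elemG {V : Type*} [Fintype V] (G : SimpleGraph V) (k : ℕ) : MvPolynomial V ℤ :=
  open Classical in
  ∑ S ∈ Finset.univ.filter (fun S : Finset V => S.card = k ∧ G.IsIndepSet (S : Set V)),
    ∏ v ∈ S, X v

/-- The `G`-homomorphism `Λ → ℤ[V]`: the ring homomorphism with `e_k ↦ e_k^G` for `k ≥ 1`. -/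
noncomputable def gHom {V : Type*} [Fintype V] (G : SimpleGraph V) :
    SymFunc →ₐ[ℤ] MvPolynomial V ℤ :=
  (aeval fun i => elemG G (i + 1)).comp elemEquiv.symm.toAlgHom

lemma gHom_elemSym {V : Type*} [Fintype V] (G : SimpleGraph V) (k : ℕ) (hk : 1 ≤ k) :
    gHom G (elemSym k) = elemG G k := by
  obtain ⟨i, rfl⟩ : ∃ i, k = i + 1 := ⟨k - 1, by omega⟩
  have h : elemEquiv (X i) = elemSym (i + 1) := by
    change elemHom (X i) = _
    exact aeval_X _ _
  have h' : elemEquiv.symm (elemSym (i + 1)) = X i := by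
    rw [← h, AlgEquiv.symm_apply_apply]
  change aeval _ (elemEquiv.symm (elemSym (i + 1))) = _
  rw [h', aeval_X]

/-! ### Unit interval orders and correct sequences -/

/-- A (finite) poset is a unit interval order if it is isomorphic to a set of real numbers ordered
by `w ≺ u` iff `w + 1 ≤ u`. -/
def IsUnitIntervalOrder (U : Type*) [PartialOrder U] : Prop :=
  Finite U ∧ ∃ f : U → ℝ, Function.Injective f ∧ ∀ u w : U, w < u ↔ f w + 1 ≤ f u

/-- The incomparability graph of a poset. -/
def incGraph (U : Type*) [PartialOrder U] : SimpleGraph U where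
  Adj u w := u ≠ w ∧ IncompRel (· ≤ ·) u w
  symm := ⟨fun _ _ h => ⟨h.1.symm, h.2.symm⟩⟩
  loopless := ⟨fun _ h => h.1 rfl⟩

section Corrects

variable {U : Type*} [PartialOrder U]

/-- The relation `u ∼ w`: neither `u ≺ w` nor `w ≺ u` (in particular `u ∼ u`). -/
def Sim (u w : U) : Prop := ¬ u < w ∧ ¬ w < u

/-- Correct sequences `w_1, …, w_k` (with `w_{i+1}` written `w ⟨i, _⟩`). -/
def IsCorrect {k : ℕ} (w : Fin k → U) : Prop :=
  (∀ i : ℕ, ∀ h : i + 1 < k, ¬ w ⟨i + 1, h⟩ < w ⟨i, by omega⟩) ∧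
  (∀ j : Fin k, 0 < (j : ℕ) → ∃ i : Fin k, i < j ∧ ¬ w i < w j)

/-- `z ≻ w_i` for all `i`. -/
def AboveAll {k : ℕ} (z : U) (w : Fin k → U) : Prop := ∀ i, w i < z

/-- `IsTheta w θ` says that `θ = max {i < l | w_i ∼ w_{i+1}}`, with `i` counted from `1`. -/
def IsTheta {l : ℕ} (w : Fin l → U) (θ : ℕ) : Prop :=
  IsGreatest {i : ℕ | 1 ≤ i ∧ ∃ h : i < l, Sim (w ⟨i - 1, by omega⟩) (w ⟨i, h⟩)} θ

/-- The set `M^U_{l,1}` of pairs `(w | z)`. -/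
def MSet1 (U : Type*) [PartialOrder U] (l : ℕ) : Set ((Fin l → U) × U) :=
  {p | IsCorrect p.1 ∧ (AboveAll p.2 p.1 ∨ ∃ h : 0 < l, p.2 < p.1 ⟨l - 1, by omega⟩)}

/-- The set `M^U_{l,2}` of pairs `(w | q)`, where `q = (q_1, q_2)` is `(q 0, q 1)`: either
`w_i ≺ q_1` for all `i < l` and `w_l ≺ q_2`, or `w_θ ≻ q_1` and `w_{θ+1} ≻ q_2`. -/
def MSet2 (U : Type*) [PartialOrder U] (l : ℕ) : Set ((Fin l → U) × (Fin 2 → U)) :=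
  {p | IsCorrect p.1 ∧ IsCorrect p.2 ∧
    (((∀ i : Fin l, (i : ℕ) < l - 1 → p.1 i < p.2 0) ∧
        ∃ h : 0 < l, p.1 ⟨l - 1, by omega⟩ < p.2 1) ∨
      ∃ θ : ℕ, IsTheta p.1 θ ∧
        ∃ h : θ < l, p.2 0 < p.1 ⟨θ - 1, by omega⟩ ∧ p.2 1 < p.1 ⟨θ, h⟩)}

/-- The first exceptional family: `w_l ≻ z ≻ q_1, q_2` and there is `γ` with `θ < γ < l`,
`w_γ ∼ z` and `w_γ ≻ q_2`. -/
def Exceptional1 {l : ℕ} (w : Fin l → U) (q : Fin 2 → U) (z : U) : Prop :=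
  ∃ h : 0 < l, z < w ⟨l - 1, by omega⟩ ∧ AboveAll z q ∧
    ∃ θ : ℕ, IsTheta w θ ∧ ∃ γ : ℕ, θ < γ ∧ ∃ hγ : γ < l,
      Sim (w ⟨γ - 1, by omega⟩) z ∧ q 1 < w ⟨γ - 1, by omega⟩

/-- The second exceptional family: `w_l ≻ z ≻ q_2`, `z ∼ q_1`, and there is `γ` with `θ < γ < l`,
`w_γ ∼ z` and `w_γ ≻ q_1`. -/
def Exceptional2 {l : ℕ} (w : Fin l → U) (q : Fin 2 → U) (z : U) : Prop :=
  ∃ h : 0 < l, z < w ⟨l - 1, by omega⟩ ∧ q 1 < z ∧ Sim z (q 0) ∧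
    ∃ θ : ℕ, IsTheta w θ ∧ ∃ γ : ℕ, θ < γ ∧ ∃ hγ : γ < l,
      Sim (w ⟨γ - 1, by omega⟩) z ∧ q 0 < w ⟨γ - 1, by omega⟩

/-- The set `M^U_{l,2,1}` of triples `(w | q | z)`. -/
def MSet21 (U : Type*) [PartialOrder U] (l : ℕ) : Set ((Fin l → U) × (Fin 2 → U) × U) :=
  {p | IsCorrect p.1 ∧ IsCorrect p.2.1 ∧
    (((p.1, p.2.1) ∈ MSet2 U l ∧ (p.1, p.2.2) ∈ MSet1 U l ∧ (p.2.1, p.2.2) ∈ MSet1 U 2) ∨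
      Exceptional1 p.1 p.2.1 p.2.2 ∨ Exceptional2 p.1 p.2.1 p.2.2)}

/-- The sum of the monomials `w_1 ⋯ w_l · q_1 · q_2 · z` over all `(w | q | z) ∈ M^U_{l,2,1}`. -/
noncomputable def sumMSet21 (U : Type*) [PartialOrder U] [Fintype U] (l : ℕ) : MvPolynomial U ℤ :=
  open Classical in
  ∑ p : (Fin l → U) × (Fin 2 → U) × U with p ∈ MSet21 U l,
    (∏ i, X (p.1 i)) * (∏ i, X (p.2.1 i)) * X p.2.2

end Corrects

/-! Write `P_k` for the image of the power sum `p_k` under the `G`-homomorphism. Stable sets of the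
incomparability graph are chains, and moving elements one at a time from a chain to the end of a
correct sequence yields Newton's identities with correct sequences in the role of power sums
(`sum_chainSum_mul_corSum`). Hence `P_k` is the sum of the monomials of the correct sequences of
length `k` (`gHom_powerSum`).

Inclusion-exclusion over coinciding variables shows that `p_l p_2 p_1 - p_{l+2} p_1 - p_{l+1} p_2 -
p_l p_3 + 2 p_{l+3}` is `m_{l,2,1}` for `l ≥ 3` and `2 m_{2,2,1}` for `l = 2`. Parts (a) and (b) are
therefore one identity: the same combination of the `P_k` is the sum over `M_{l,2,1}`
(`tripleSum_ind21`).

To prove it, each product is written as a weighted sum over triples `(w | p, q | z)` with `w`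
correct of length `l` and `p ∼ q`. For `P_{l+1}` the last element is split off. For `P_{l+2}` the
pair `w_θ, w_{θ+1}` is deleted: beyond `θ` a correct sequence increases, `w_{θ+1} ≺ ... ≺ w_l`, and
the deletion leaves a correct sequence except in one configuration, which an exchange repairs
(`seqSum_insertPairAll`). Deleting `w_{θ+1}` alone needs no repair (`seqSum_insertOneAll`). The two
copies of `P_{l+3}` are expanded differently: in one, the pair belongs to `w` with `z` appended; in
the other, the pair is inserted and then `z`.

The variables commute, so the weights need only agree after summation over the six permutations of
`p, q, z` (`symSum_ind21`). Induction along the final increasing run reduces this to comparisons of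
three reals with at most two others, which are checked by cases.

For (c), a coefficient of `X_G` counts families of stable sets covering every vertex once, that is,
the coefficient of the product of all vertices in the image of a product of the `e_k`. The
transition matrix from such products to the `m_μ` is symmetric, so `c_λ` is the coefficient of that
product in `m_λ^U` (`chromSeries_eq_sum`). By (a), or by (b) when `n = 5`, it is nonnegative. -/

/-! ### Symmetrized identities between comparison indicators of a few real numbers. -/

/-- The indicator of `a + 1 ≤ b`. -/
noncomputable def ab (a b : ℝ) : ℤ := if a + 1 ≤ b then 1 else 0

/-- The indicator of `|a - b| < 1`. -/
noncomputable def sm (a b : ℝ) : ℤ := (1 - ab a b) * (1 - ab b a)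

lemma ab_cases (a b : ℝ) : (ab a b = 0 ∧ b < a + 1) ∨ (ab a b = 1 ∧ a + 1 ≤ b) := by
  unfold ab
  rcases lt_or_ge b (a + 1) with h | h
  · left; exact ⟨if_neg (not_le.mpr h), h⟩
  · right; exact ⟨if_pos h, h⟩

lemma ab_one {a b : ℝ} (h : a + 1 ≤ b) : ab a b = 1 := if_pos h

lemma ab_zero {a b : ℝ} (h : b < a + 1) : ab a b = 0 := if_neg (not_le.mpr h)

/-- The sum of `g` over the six orderings of its arguments. -/
def symSum (g : ℝ → ℝ → ℝ → ℤ) (a b c : ℝ) : ℤ :=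
  g a b c + g a c b + g b a c + g b c a + g c a b + g c b a

lemma symSum_add (g h : ℝ → ℝ → ℝ → ℤ) (a b c : ℝ) :
    symSum (fun p q z => g p q z + h p q z) a b c = symSum g a b c + symSum h a b c := by
  unfold symSum
  ring

/-- The symmetrization does not depend on the order of its arguments. Sorting them first keeps the
case checks below small. -/
lemma symSum_eq_zero_of_sorted {g : ℝ → ℝ → ℝ → ℤ}
    (h : ∀ a b c, a ≤ b → b ≤ c → symSum g a b c = 0) (a b c : ℝ) : symSum g a b c = 0 := by
  have hs1 : ∀ a b c, symSum g a b c = symSum g b a c := fun a b c => by unfold symSum; ring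
  have hs2 : ∀ a b c, symSum g a b c = symSum g a c b := fun a b c => by unfold symSum; ring
  rcases le_total a b with h1 | h1 <;> rcases le_total b c with h2 | h2 <;>
    rcases le_total a c with h3 | h3
  · exact h _ _ _ h1 h2
  · exact h _ _ _ h1 h2
  · rw [hs2]; exact h _ _ _ h3 h2
  · rw [hs2, hs1]; exact h _ _ _ h3 h1
  · rw [hs1]; exact h _ _ _ h1 h3
  · rw [hs1, hs2]; exact h _ _ _ h2 h3
  · rw [hs1, hs2, hs1]; exact h _ _ _ h2 h1
  · rw [hs1, hs2, hs1]; exact h _ _ _ h2 h1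

/-- The six orderings fall into three pairs that differ by exchanging the first two entries. -/
lemma symSum_eq_zero_of_swap {g : ℝ → ℝ → ℝ → ℤ} (h : ∀ p q z, g p q z + g q p z = 0)
    (a b c : ℝ) : symSum g a b c = 0 := by
  unfold symSum
  linarith [h a b c, h a c b, h b c a]

/-- The indicator of `(p, q, z)` being correct, for a correct pair `(p, q)`. -/
noncomputable def tripleC (p q z : ℝ) : ℤ := (1 - ab z q) * (1 - ab p z * ab q z)

/-- A rearrangement of `tripleC`. -/
noncomputable def tripleC' (p q z : ℝ) : ℤ := sm q z + sm p z * ab z q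

/-- Both expressions count correct sequences of length three: `tripleC` appends `z` to the correct
pair, while `tripleC'` inserts `z` as the element at position `θ + 1`, either after `q` or between
`p` and `q`. They list the same sequences with the letters named differently. -/
lemma symSum_tripleC (a b c : ℝ) :
    symSum (fun p q z => sm p q * (tripleC p q z - tripleC' p q z)) a b c = 0 := by
  refine symSum_eq_zero_of_sorted (fun a b c h1 h2 => ?_) a b c
  -- Each value of `ab` comes with its inequality, so `linarith` discards patterns that no reals
  -- realize; what survives is arithmetic with zeros and ones.
  obtain ⟨_, _⟩ | ⟨_, _⟩ := ab_cases b a <;> first | (exfalso; linarith) | skip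
  all_goals obtain ⟨_, _⟩ | ⟨_, _⟩ := ab_cases c b <;> first | (exfalso; linarith) | skip
  all_goals obtain ⟨_, _⟩ | ⟨_, _⟩ := ab_cases c a <;> first | (exfalso; linarith) | skip
  all_goals obtain ⟨_, _⟩ | ⟨_, _⟩ := ab_cases a b
  all_goals obtain ⟨_, _⟩ | ⟨_, _⟩ := ab_cases b c
  all_goals obtain ⟨_, _⟩ | ⟨_, _⟩ := ab_cases a c <;> first | (exfalso; linarith) | skip
  all_goals simp only [symSum, tripleC, tripleC', sm, *]
  all_goals norm_num

/-- The contribution of one further chain element `y` after `x`. -/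
noncomputable def chainStep (x y p q z : ℝ) : ℤ :=
  sm p q * ((1 - ab p x) * ab q y * (sm q z * ab z y + sm p z * ab z q) + sm x z * ab z y * ab p x
   + ab p x * tripleC' p q z - sm x z * ab p x * (1 - ab q z)
   - (ab p y * tripleC' p q z - sm y z * ab p y * (1 - ab q z)
     + sm x z * ab z y * (ab p z * ab q z * ab q x + ab q z * sm z p * ab p x)))

-- The inductive step of `tripleDefect_symm` when the run continues from `x` to `y`. There
-- `pairCount` is traded for `ab p x` through `pairCount_symm`, and the terms in `θ` and `γ` are
-- removed by `thetaPart_step`, so nothing of the sequence below `x` remains.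
set_option maxHeartbeats 4000000 in
lemma symSum_chainStep {x y : ℝ} (hxy : x + 1 ≤ y) (a b c : ℝ) :
    symSum (chainStep x y) a b c = 0 := by
  refine symSum_eq_zero_of_sorted (fun a b c h1 h2 => ?_) a b c
  obtain ⟨_, _⟩ | ⟨_, _⟩ := ab_cases b a <;> first | (exfalso; linarith) | skip
  all_goals obtain ⟨_, _⟩ | ⟨_, _⟩ := ab_cases c b <;> first | (exfalso; linarith) | skip
  all_goals obtain ⟨_, _⟩ | ⟨_, _⟩ := ab_cases c a <;> first | (exfalso; linarith) | skip
  all_goals obtain ⟨_, _⟩ | ⟨_, _⟩ := ab_cases a b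
  all_goals obtain ⟨_, _⟩ | ⟨_, _⟩ := ab_cases b c
  all_goals obtain ⟨_, _⟩ | ⟨_, _⟩ := ab_cases a c <;> first | (exfalso; linarith) | skip
  all_goals obtain ⟨_, _⟩ | ⟨_, _⟩ := ab_cases b x
  all_goals obtain ⟨_, _⟩ | ⟨_, _⟩ := ab_cases a x <;> first | (exfalso; linarith) | skip
  all_goals obtain ⟨_, _⟩ | ⟨_, _⟩ := ab_cases c x <;> first | (exfalso; linarith) | skip
  all_goals obtain ⟨_, _⟩ | ⟨_, _⟩ := ab_cases b y <;> first | (exfalso; linarith) | skip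
  all_goals obtain ⟨_, _⟩ | ⟨_, _⟩ := ab_cases a y <;> first | (exfalso; linarith) | skip
  all_goals obtain ⟨_, _⟩ | ⟨_, _⟩ := ab_cases c y <;> first | (exfalso; linarith) | skip
  all_goals obtain ⟨_, _⟩ | ⟨_, _⟩ := ab_cases y b <;> first | (exfalso; linarith) | skip
  all_goals obtain ⟨_, _⟩ | ⟨_, _⟩ := ab_cases y a <;> first | (exfalso; linarith) | skip
  all_goals obtain ⟨_, _⟩ | ⟨_, _⟩ := ab_cases y c <;> first | (exfalso; linarith) | skip
  all_goals obtain ⟨_, _⟩ | ⟨_, _⟩ := ab_cases x b <;> first | (exfalso; linarith) | skip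
  all_goals obtain ⟨_, _⟩ | ⟨_, _⟩ := ab_cases x a <;> first | (exfalso; linarith) | skip
  all_goals obtain ⟨_, _⟩ | ⟨_, _⟩ := ab_cases x c <;> first | (exfalso; linarith) | skip
  all_goals simp only [symSum, chainStep, tripleC', sm, *]
  all_goals norm_num

/-- The contribution of the first chain element `y`, following `x`. -/
noncomputable def chainBase (x y p q z : ℝ) : ℤ :=
  sm p q * ((1 - ab p x) * ab q y * (sm q z * ab z y + sm p z * ab z q)
   - (ab p y * tripleC' p q z - sm y z * ab p y * (1 - ab q z)
     + ab z y * (- (ab p x * ab q y) * tripleC p q z)))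

-- The base case of `tripleDefect_symm`: as `x ∼ y`, the run starts at `y`, no `γ` before the last
-- index exists, and the condition at `θ` is `ab p x * ab q y`.
set_option maxHeartbeats 4000000 in
lemma symSum_chainBase {x y : ℝ} (hxy : x < y + 1) (hyx : y < x + 1) (a b c : ℝ) :
    symSum (chainBase x y) a b c = 0 := by
  refine symSum_eq_zero_of_sorted (fun a b c h1 h2 => ?_) a b c
  obtain ⟨_, _⟩ | ⟨_, _⟩ := ab_cases b a <;> first | (exfalso; linarith) | skip
  all_goals obtain ⟨_, _⟩ | ⟨_, _⟩ := ab_cases c b <;> first | (exfalso; linarith) | skip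
  all_goals obtain ⟨_, _⟩ | ⟨_, _⟩ := ab_cases c a <;> first | (exfalso; linarith) | skip
  all_goals obtain ⟨_, _⟩ | ⟨_, _⟩ := ab_cases a b
  all_goals obtain ⟨_, _⟩ | ⟨_, _⟩ := ab_cases b c
  all_goals obtain ⟨_, _⟩ | ⟨_, _⟩ := ab_cases a c <;> first | (exfalso; linarith) | skip
  all_goals obtain ⟨_, _⟩ | ⟨_, _⟩ := ab_cases b x
  all_goals obtain ⟨_, _⟩ | ⟨_, _⟩ := ab_cases a x <;> first | (exfalso; linarith) | skip
  all_goals obtain ⟨_, _⟩ | ⟨_, _⟩ := ab_cases c x <;> first | (exfalso; linarith) | skip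
  all_goals obtain ⟨_, _⟩ | ⟨_, _⟩ := ab_cases b y <;> first | (exfalso; linarith) | skip
  all_goals obtain ⟨_, _⟩ | ⟨_, _⟩ := ab_cases a y <;> first | (exfalso; linarith) | skip
  all_goals obtain ⟨_, _⟩ | ⟨_, _⟩ := ab_cases c y <;> first | (exfalso; linarith) | skip
  all_goals obtain ⟨_, _⟩ | ⟨_, _⟩ := ab_cases y b <;> first | (exfalso; linarith) | skip
  all_goals obtain ⟨_, _⟩ | ⟨_, _⟩ := ab_cases y a <;> first | (exfalso; linarith) | skip
  all_goals obtain ⟨_, _⟩ | ⟨_, _⟩ := ab_cases y c <;> first | (exfalso; linarith) | skip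
  all_goals obtain ⟨_, _⟩ | ⟨_, _⟩ := ab_cases x b <;> first | (exfalso; linarith) | skip
  all_goals obtain ⟨_, _⟩ | ⟨_, _⟩ := ab_cases x a <;> first | (exfalso; linarith) | skip
  all_goals obtain ⟨_, _⟩ | ⟨_, _⟩ := ab_cases x c <;> first | (exfalso; linarith) | skip
  all_goals simp only [symSum, chainBase, tripleC, tripleC', sm, *]
  all_goals norm_num

/-- The contribution of elements which exceed the maximum of the sequence; here `y` is the last
element and `m` is the maximum of the others. -/
noncomputable def maxPart (y m p q z : ℝ) : ℤ :=
  sm p q * (ab (max y m) p * tripleC' p q z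
    + (1 - ab z y) * (1 - ab (max y m) z) * (ab (max y m) p * ab z q)
    - ab (max y m) p * sm q y * (1 - ab m q) * (sm p z + sm y z * ab z p + sm q z * ab z y)
    - ab m p * ab y q * ((1 - ab z y) * (1 - ab (max y m) z) + tripleC p q z
      - (1 - ab z y) * (1 - ab (max y m) z) * tripleC p q z))

-- The hypothesis is the clause of correctness saying that the last element is not above all the
-- others. The two branches decide whether `y` or `m` is the overall maximum.
set_option maxHeartbeats 4000000 in
lemma symSum_maxPart {y m : ℝ} (hy : y < m + 1) (a b c : ℝ) :
    symSum (maxPart y m) a b c = 0 := by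
  refine symSum_eq_zero_of_sorted (fun a b c h1 h2 => ?_) a b c
  rcases le_total y m with hm | hm
  · simp only [symSum, maxPart, max_eq_right hm]
    all_goals obtain ⟨_, _⟩ | ⟨_, _⟩ := ab_cases b a <;> first | (exfalso; linarith) | skip
    all_goals obtain ⟨_, _⟩ | ⟨_, _⟩ := ab_cases c b <;> first | (exfalso; linarith) | skip
    all_goals obtain ⟨_, _⟩ | ⟨_, _⟩ := ab_cases c a <;> first | (exfalso; linarith) | skip
    all_goals obtain ⟨_, _⟩ | ⟨_, _⟩ := ab_cases a b
    all_goals obtain ⟨_, _⟩ | ⟨_, _⟩ := ab_cases b c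
    all_goals obtain ⟨_, _⟩ | ⟨_, _⟩ := ab_cases a c <;> first | (exfalso; linarith) | skip
    all_goals obtain ⟨_, _⟩ | ⟨_, _⟩ := ab_cases m c
    all_goals obtain ⟨_, _⟩ | ⟨_, _⟩ := ab_cases m b <;> first | (exfalso; linarith) | skip
    all_goals obtain ⟨_, _⟩ | ⟨_, _⟩ := ab_cases m a <;> first | (exfalso; linarith) | skip
    all_goals obtain ⟨_, _⟩ | ⟨_, _⟩ := ab_cases y b <;> first | (exfalso; linarith) | skip
    all_goals obtain ⟨_, _⟩ | ⟨_, _⟩ := ab_cases y a <;> first | (exfalso; linarith) | skip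
    all_goals obtain ⟨_, _⟩ | ⟨_, _⟩ := ab_cases y c <;> first | (exfalso; linarith) | skip
    all_goals obtain ⟨_, _⟩ | ⟨_, _⟩ := ab_cases b y <;> first | (exfalso; linarith) | skip
    all_goals obtain ⟨_, _⟩ | ⟨_, _⟩ := ab_cases a y <;> first | (exfalso; linarith) | skip
    all_goals obtain ⟨_, _⟩ | ⟨_, _⟩ := ab_cases c y <;> first | (exfalso; linarith) | skip
    all_goals simp only [tripleC, tripleC', sm, *]
    all_goals norm_num
  · simp only [symSum, maxPart, max_eq_left hm]
    all_goals obtain ⟨_, _⟩ | ⟨_, _⟩ := ab_cases b a <;> first | (exfalso; linarith) | skip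
    all_goals obtain ⟨_, _⟩ | ⟨_, _⟩ := ab_cases c b <;> first | (exfalso; linarith) | skip
    all_goals obtain ⟨_, _⟩ | ⟨_, _⟩ := ab_cases c a <;> first | (exfalso; linarith) | skip
    all_goals obtain ⟨_, _⟩ | ⟨_, _⟩ := ab_cases a b
    all_goals obtain ⟨_, _⟩ | ⟨_, _⟩ := ab_cases b c
    all_goals obtain ⟨_, _⟩ | ⟨_, _⟩ := ab_cases a c <;> first | (exfalso; linarith) | skip
    all_goals obtain ⟨_, _⟩ | ⟨_, _⟩ := ab_cases y c
    all_goals obtain ⟨_, _⟩ | ⟨_, _⟩ := ab_cases y b <;> first | (exfalso; linarith) | skip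
    all_goals obtain ⟨_, _⟩ | ⟨_, _⟩ := ab_cases y a <;> first | (exfalso; linarith) | skip
    all_goals obtain ⟨_, _⟩ | ⟨_, _⟩ := ab_cases m b <;> first | (exfalso; linarith) | skip
    all_goals obtain ⟨_, _⟩ | ⟨_, _⟩ := ab_cases m a <;> first | (exfalso; linarith) | skip
    all_goals obtain ⟨_, _⟩ | ⟨_, _⟩ := ab_cases m c <;> first | (exfalso; linarith) | skip
    all_goals obtain ⟨_, _⟩ | ⟨_, _⟩ := ab_cases b y <;> first | (exfalso; linarith) | skip
    all_goals obtain ⟨_, _⟩ | ⟨_, _⟩ := ab_cases a y <;> first | (exfalso; linarith) | skip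
    all_goals obtain ⟨_, _⟩ | ⟨_, _⟩ := ab_cases c y <;> first | (exfalso; linarith) | skip
    all_goals simp only [tripleC, tripleC', sm, *]
    all_goals norm_num

/-! ### Reversed sequences of real numbers

A list is read backwards: its head is the last element of the sequence. -/

/-- The maximum of a nonempty list. -/
noncomputable def listMax : List ℝ → ℝ
  | [] => 0
  | [x] => x
  | y :: x :: r => max y (listMax (x :: r))

/-- Correctness of a (reversed) sequence of real numbers. -/
def Cor : List ℝ → Prop
  | [] => True
  | [_] => True
  | y :: x :: r => Cor (x :: r) ∧ x < y + 1 ∧ y < listMax (x :: r) + 1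

/-- The indicator of `w_θ ≻ p` and `w_{θ+1} ≻ q`. -/
noncomputable def thetaInd (p q : ℝ) : List ℝ → ℤ
  | [] => 0
  | [_] => 0
  | y :: x :: r => ab x y * thetaInd p q (x :: r) + (1 - ab x y) * (ab p x * ab q y)

/-- The indicator of the existence of `γ > θ` with `w_γ ∼ z` and `w_γ ≻ q`. -/
noncomputable def gammaInd (z q : ℝ) : List ℝ → ℤ
  | [] => 0
  | [_] => 0
  | y :: x :: r => sm y z * ab q y + (1 - sm y z * ab q y) * (ab x y * gammaInd z q (x :: r))

/-- The same as `gammaInd`, with `γ` not the last index. -/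
noncomputable def gammaInd' (z q : ℝ) : List ℝ → ℤ
  | [] => 0
  | [_] => 0
  | y :: x :: r => ab x y * gammaInd z q (x :: r)

/-- The number of positions before the last element at which the pair `p, q` can be inserted. -/
noncomputable def pairCount (p q : ℝ) : List ℝ → ℤ
  | [] => 0
  | [_] => 0
  | y :: x :: r => (1 - ab p x) * ab q y + ab x y * pairCount p q (x :: r)

/-- The number of ways to insert first `p, q`, then `z` before the last element. -/
noncomputable def tripleCount (p q z : ℝ) : List ℝ → ℤ
  | [] => 0
  | [_] => 0
  | y :: x :: r => (1 - ab p x) * ab q y * (sm q z * ab z y + sm p z * ab z q) +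
      ab x y * (sm x z * ab z y * pairCount p q (x :: r) + tripleCount p q z (x :: r))

lemma thetaInd_cons (p q y x : ℝ) (r : List ℝ) : thetaInd p q (y :: x :: r) =
    ab x y * thetaInd p q (x :: r) + (1 - ab x y) * (ab p x * ab q y) := rfl

lemma gammaInd_cons (z q y x : ℝ) (r : List ℝ) : gammaInd z q (y :: x :: r) =
    sm y z * ab q y + (1 - sm y z * ab q y) * (ab x y * gammaInd z q (x :: r)) := rfl

lemma gammaInd'_cons (z q y x : ℝ) (r : List ℝ) : gammaInd' z q (y :: x :: r) =
    ab x y * gammaInd z q (x :: r) := rfl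

lemma pairCount_cons (p q y x : ℝ) (r : List ℝ) : pairCount p q (y :: x :: r) =
    (1 - ab p x) * ab q y + ab x y * pairCount p q (x :: r) := rfl

lemma tripleCount_cons (p q z y x : ℝ) (r : List ℝ) : tripleCount p q z (y :: x :: r) =
    (1 - ab p x) * ab q y * (sm q z * ab z y + sm p z * ab z q) +
      ab x y * (sm x z * ab z y * pairCount p q (x :: r) + tripleCount p q z (x :: r)) := rfl

/-! ### Counting insertions along the final increasing run. -/

/-- Induction on the increasing run at the end of a correct sequence. -/
lemma chain_induction {P : ℝ → ℝ → List ℝ → Prop}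
    (base : ∀ y x r, x < y + 1 → y < x + 1 → P y x r)
    (step : ∀ y x x' r, Cor (x :: x' :: r) → x + 1 ≤ y → P x x' r → P y x (x' :: r))
    {y x : ℝ} {r : List ℝ} (h : Cor (y :: x :: r)) : P y x r := by
  induction r generalizing x y with
  -- Here `listMax [x]` is `x`, so correctness itself makes the first two elements incomparable.
  | nil => exact base _ _ _ h.2.1 h.2.2
  | cons x' r ih =>
    rcases lt_or_ge y (x + 1) with h1 | h1
    · exact base _ _ _ h.2.1 h1
    · exact step _ _ _ _ h.1 h1 (ih h.1)

/-- The bounds hold at position `θ + 1` and persist as the run increases. Only `p < y` is available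
for `p`, because `p` is compared with `w_θ`, which is merely incomparable to `w_{θ+1}`. -/
lemma thetaInd_cases (p q : ℝ) {y x : ℝ} {r : List ℝ} (h : Cor (y :: x :: r)) :
    thetaInd p q (y :: x :: r) = 0 ∨
      (thetaInd p q (y :: x :: r) = 1 ∧ p < y ∧ q + 1 ≤ y) := by
  refine chain_induction (P := fun y x r => thetaInd p q (y :: x :: r) = 0 ∨
      (thetaInd p q (y :: x :: r) = 1 ∧ p < y ∧ q + 1 ≤ y)) (fun y x r h1 h2 => ?_)
    (fun y x x' r h1 h2 ih => ?_) h
  · rw [thetaInd_cons, ab_zero h2]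
    obtain ⟨h3, h4⟩ | ⟨h3, h4⟩ := ab_cases p x
    · left; rw [h3]; ring
    obtain ⟨h5, h6⟩ | ⟨h5, h6⟩ := ab_cases q y
    · left; rw [h5]; ring
    · right; rw [h3, h5]
      exact ⟨by ring, by linarith, h6⟩
  · rw [thetaInd_cons, ab_one h2]
    obtain h3 | ⟨h3, h4, h5⟩ := ih
    · left; rw [h3]; ring
    · right; rw [h3]
      exact ⟨by ring, by linarith, by linarith⟩

/-- A witness `w_γ` lies on the run, hence is at most `y`, and its bounds pass to `y`. -/
lemma gammaInd_cases (z q y : ℝ) (r : List ℝ) :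
    gammaInd z q (y :: r) = 0 ∨
      (gammaInd z q (y :: r) = 1 ∧ q + 1 ≤ y ∧ z < y + 1) := by
  induction r generalizing y with
  | nil => exact Or.inl rfl
  | cons x r ih =>
    rw [gammaInd_cons, sm]
    rcases ab_cases y z with ⟨h1, h2⟩ | ⟨h1, h2⟩ <;> rcases ab_cases z y with ⟨h3, h4⟩ | ⟨h3, h4⟩ <;>
      rcases ab_cases q y with ⟨h5, h6⟩ | ⟨h5, h6⟩ <;> rcases ab_cases x y with ⟨h7, h8⟩ | ⟨h7, h8⟩ <;>
      rcases ih x with h9 | ⟨h9, h10, h11⟩ <;> rw [h1, h3, h5, h7, h9] <;> simp <;>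
      exact ⟨by linarith, by linarith⟩

lemma sm_comm (a b : ℝ) : sm a b = sm b a := mul_comm _ _

lemma sm_cases (a b : ℝ) : sm a b = 0 ∨ (sm a b = 1 ∧ a < b + 1 ∧ b < a + 1) := by
  unfold sm
  rcases ab_cases a b with ⟨h1, h2⟩ | ⟨h1, h2⟩ <;> rcases ab_cases b a with ⟨h3, h4⟩ | ⟨h3, h4⟩ <;>
    rw [h1, h3] <;> simp
  exact ⟨h4, h2⟩

/-- If `p ∼ q` and `x ≺ y`, then `p ≺ x` forces `q ≺ y`, so `(1 - ab p x) * ab q y` is the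
difference `ab q y - ab p x`. Adding the two orders of the pair makes these differences telescope
along the run, and the start of the run leaves the `θ` terms. -/
lemma pairCount_symm {p q : ℝ} (hp : p < q + 1) (hq : q < p + 1) {y x : ℝ} {r : List ℝ}
    (h : Cor (y :: x :: r)) :
    pairCount p q (y :: x :: r) + pairCount q p (y :: x :: r) =
      ab p y + ab q y - thetaInd p q (y :: x :: r) - thetaInd q p (y :: x :: r) := by
  have key : ∀ p q y x : ℝ, x + 1 ≤ y → q < p + 1 → (1 - ab p x) * ab q y = ab q y - ab p x := by
    intro p q y x h1 h2
    rcases ab_cases p x with ⟨h3, h4⟩ | ⟨h3, h4⟩ <;> rw [h3]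
    · ring
    · rw [ab_one (show q + 1 ≤ y by linarith)]
      ring
  refine chain_induction (P := fun y x r =>
    pairCount p q (y :: x :: r) + pairCount q p (y :: x :: r) =
      ab p y + ab q y - thetaInd p q (y :: x :: r) - thetaInd q p (y :: x :: r))
    (fun y x r h1 h2 => ?_) (fun y x x' r h1 h2 ih => ?_) h
  · simp only [pairCount_cons p q y, pairCount_cons q p y, thetaInd_cons p q y, thetaInd_cons q p y,
      ab_zero h2]
    ring
  · rw [pairCount_cons p q y, pairCount_cons q p y, thetaInd_cons p q y, thetaInd_cons q p y,
      key p q y x h2 hq, key q p y x h2 hp, ab_one h2]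
    linarith

/-- The part of `tripleCount_symm` which involves `θ` and `γ`. -/
noncomputable def thetaPart (p q z : ℝ) (y : ℝ) (w : List ℝ) : ℤ :=
  ab z y * (- thetaInd p q w * tripleC p q z
    + ab p z * ab q z * gammaInd' z q w * (1 - thetaInd p q w)
    + ab q z * sm z p * gammaInd' z p w)

noncomputable def tripleDefect (y : ℝ) (w : List ℝ) (p q z : ℝ) : ℤ :=
  sm p q * (tripleCount p q z w - (ab p y * tripleC' p q z - sm y z * ab p y * (1 - ab q z)
    + thetaPart p q z y w))

/-- Extending the run by `y` makes the index of `x` an admissible `γ`. If `z ≺ x` this index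
contributes nothing; if `z ∼ x` it is a witness whenever any index is; if `x ≺ z` the whole run lies
below `z` and there is no witness. -/
lemma thetaPart_step {p q : ℝ} (hq : q < p + 1) (z : ℝ) {y x x' : ℝ} {r : List ℝ}
    (h : Cor (x :: x' :: r)) (hxy : x + 1 ≤ y) :
    - (sm x z * ab z y * thetaInd p q (x :: x' :: r)) + thetaPart p q z x (x :: x' :: r)
      - thetaPart p q z y (y :: x :: x' :: r)
      + sm x z * ab z y * (ab p z * ab q z * ab q x + ab q z * sm z p * ab p x) = 0 := by
  have hG : ∀ t, gammaInd' z t (y :: x :: x' :: r) = gammaInd z t (x :: x' :: r) := by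
    intro t
    rw [gammaInd'_cons, ab_one hxy, one_mul]
  have hT : thetaInd p q (y :: x :: x' :: r) = thetaInd p q (x :: x' :: r) := by
    rw [thetaInd_cons, ab_one hxy]
    ring
  rw [thetaPart, thetaPart, hG, hG, hT]
  obtain ⟨h1, h2⟩ | ⟨h1, h2⟩ := ab_cases z x
  swap
  · have hs : sm x z = 0 := by
      rw [sm, h1]
      ring
    have hG' : ∀ t, gammaInd z t (x :: x' :: r) = gammaInd' z t (x :: x' :: r) := by
      intro t
      rw [gammaInd_cons, gammaInd'_cons, hs]
      ring
    rw [hs, hG', hG', h1, ab_one (show z + 1 ≤ y by linarith)]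
    ring
  obtain ⟨h3, h4⟩ | ⟨h3, h4⟩ := ab_cases x z
  · have hs : sm x z = 1 := by
      rw [sm, h1, h3]
      ring
    have hG' : ∀ t, gammaInd z t (x :: x' :: r) = ab t x := by
      intro t
      obtain ⟨h5, h6⟩ | ⟨h5, h6⟩ := ab_cases t x
      · obtain h7 | ⟨h7, h8, h9⟩ := gammaInd_cases z t x (x' :: r)
        · rw [h7, h5]
        · exact absurd h6 (not_lt.mpr h8)
      · rw [gammaInd_cons, hs, h5]
        ring
    rw [hs, hG', hG', h1]
    obtain h5 | ⟨h5, h6, h7⟩ := thetaInd_cases p q h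
    · rw [h5]
      ring
    · rw [h5, tripleC, ab_one h7, ab_zero (show q < z + 1 by linarith)]
      ring
  · have hs : sm x z = 0 := by
      rw [sm, h3]
      ring
    have hG' : ∀ t, gammaInd z t (x :: x' :: r) = 0 := by
      intro t
      obtain h7 | ⟨h7, h8, h9⟩ := gammaInd_cases z t x (x' :: r)
      · exact h7
      · linarith
    rw [hs, hG', hG', h1]
    obtain h5 | ⟨h5, h6, h7⟩ := thetaInd_cases p q h
    · rw [h5]
      ring
    · rw [h5, tripleC, ab_one (show p + 1 ≤ z by linarith), ab_one (show q + 1 ≤ z by linarith)]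
      ring

/-- A closed form, up to permuting `p, q, z`, for the number of double insertions before the last
element. The existential conditions on `γ` in the two exceptional families originate here. -/
lemma tripleDefect_symm {y x : ℝ} {r : List ℝ} (h : Cor (y :: x :: r)) (a b c : ℝ) :
    symSum (tripleDefect y (y :: x :: r)) a b c = 0 := by
  refine chain_induction (P := fun y x r => symSum (tripleDefect y (y :: x :: r)) a b c = 0)
    (fun y x r h1 h2 => ?_) (fun y x x' r h1 h2 ih => ?_) h
  · rw [← symSum_chainBase h1 h2 a b c]
    congr 1
    funext p q z
    rw [tripleDefect, chainBase, thetaPart, tripleCount_cons, gammaInd'_cons, gammaInd'_cons,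
      thetaInd_cons, ab_zero h2]
    ring
  · have hN : symSum (fun p q z => sm p q * (sm x z * ab z y *
        (pairCount p q (x :: x' :: r) - ab p x + thetaInd p q (x :: x' :: r)))) a b c = 0 := by
      refine symSum_eq_zero_of_swap (fun p q z => ?_) a b c
      rw [sm_comm q p, ← mul_add, ← mul_add]
      obtain h3 | ⟨h3, h4, h5⟩ := sm_cases p q
      · rw [h3, zero_mul]
      · have := pairCount_symm h4 h5 h1
        rw [show pairCount p q (x :: x' :: r) - ab p x + thetaInd p q (x :: x' :: r) +
          (pairCount q p (x :: x' :: r) - ab q x + thetaInd q p (x :: x' :: r)) = 0 by linarith]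
        ring
    have hC := symSum_chainStep h2 a b c
    have h0 := symSum_add (tripleDefect x (x :: x' :: r)) (chainStep x y) a b c
    have h00 := symSum_add (fun p q z => tripleDefect x (x :: x' :: r) p q z + chainStep x y p q z)
      (fun p q z => sm p q * (sm x z * ab z y *
        (pairCount p q (x :: x' :: r) - ab p x + thetaInd p q (x :: x' :: r)))) a b c
    rw [h0, ih, hC, hN] at h00
    rw [add_zero, add_zero] at h00
    rw [← h00]
    congr 1
    funext p q z
    obtain h3 | ⟨h3, h4, h5⟩ := sm_cases p q
    · simp only [tripleDefect, chainStep, h3, zero_mul, add_zero]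
    · have hT := thetaPart_step h5 z h1 h2
      rw [tripleDefect, tripleDefect, chainStep, tripleCount_cons, ab_one h2, h3]
      linear_combination hT

/-! ### The indicator of `M_{l,2,1}` and its symmetrized expansion. -/

/-- The indicator of `Cor`. -/
noncomputable def corInd : List ℝ → ℤ
  | [] => 1
  | [_] => 1
  | y :: x :: r => corInd (x :: r) * ((1 - ab y x) * (1 - ab (listMax (x :: r)) y))

lemma corInd_cons (y x : ℝ) (r : List ℝ) : corInd (y :: x :: r) =
    corInd (x :: r) * ((1 - ab y x) * (1 - ab (listMax (x :: r)) y)) := rfl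

lemma listMax_cons (y x : ℝ) (r : List ℝ) : listMax (y :: x :: r) = max y (listMax (x :: r)) := rfl

lemma head_le_listMax (x : ℝ) (r : List ℝ) : x ≤ listMax (x :: r) := by
  cases r with
  | nil => exact le_rfl
  | cons => exact le_max_left _ _

lemma corInd_cases : ∀ w : List ℝ, corInd w = 0 ∨ (corInd w = 1 ∧ Cor w)
  | [] => Or.inr ⟨rfl, trivial⟩
  | [_] => Or.inr ⟨rfl, trivial⟩
  | y :: x :: r => by
    rw [corInd_cons]
    obtain h | ⟨h, h'⟩ := corInd_cases (x :: r)
    · left; rw [h, zero_mul]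
    obtain ⟨h1, h2⟩ | ⟨h1, h2⟩ := ab_cases y x
    swap
    · left; rw [h1]; ring
    obtain ⟨h3, h4⟩ | ⟨h3, h4⟩ := ab_cases (listMax (x :: r)) y
    swap
    · left; rw [h3]; ring
    right
    exact ⟨by rw [h, h1, h3]; ring, h', h2, h4⟩

/-- The indicator of `(w | p, q)` not lying in `M_{l,2}`. -/
noncomputable def pairOK (p q : ℝ) : List ℝ → ℤ
  | [] => 0
  | [_] => 0
  | y :: x :: r => 1 - ab (listMax (x :: r)) p * ab y q - thetaInd p q (y :: x :: r)

/-- The indicator of `(w | z)` not lying in `M_{l,1}`. -/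
noncomputable def snocOK (z : ℝ) : List ℝ → ℤ
  | [] => 0
  | y :: r => (1 - ab z y) * (1 - ab (listMax (y :: r)) z)

/-- The indicator of the first exceptional family. -/
noncomputable def exc1 (p q z : ℝ) : List ℝ → ℤ
  | [] => 0
  | y :: r => ab z y * (ab p z * ab q z) * gammaInd' z q (y :: r)

/-- The indicator of the second exceptional family. -/
noncomputable def exc2 (p q z : ℝ) : List ℝ → ℤ
  | [] => 0
  | y :: r => ab z y * (ab q z * sm z p) * gammaInd' z p (y :: r)

/-- The indicator of `(w | p, q | z)` lying in `M_{l,2,1}`. -/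
noncomputable def ind21 (p q z : ℝ) (w : List ℝ) : ℤ :=
  (1 - pairOK p q w) * (1 - snocOK z w) * (1 - tripleC p q z) + pairOK p q w * exc1 p q z w
    + exc2 p q z w

/-- The indicator of `q` not exceeding all elements of a nonempty list. -/
noncomputable def notAbove (q : ℝ) : List ℝ → ℤ
  | [] => 1
  | x :: r => 1 - ab (listMax (x :: r)) q

/-- The number of ways to insert `p, q`, and then `z`. -/
noncomputable def insertCount (p q z : ℝ) : List ℝ → ℤ
  | [] => 0
  | y :: r => sm y z * pairCount p q (y :: r) + tripleCount p q z (y :: r)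
    + (1 - ab p y) * (1 - ab (listMax (y :: r)) p) * tripleC' p q z
    + ab (listMax (y :: r)) p * sm q y * notAbove q r *
      (sm p z + sm y z * ab z p + sm q z * ab z y)

/-- The combinatorial core, for one fixed correct sequence. The terms correspond to `P_l P_2 P_1`,
`P_{l+2} P_1`, `P_{l+1} P_2`, `P_l P_3` and to the two different expansions of `P_{l+3}`. -/
lemma symSum_ind21 {y x : ℝ} {r : List ℝ} (h : Cor (y :: x :: r)) (a b c : ℝ) :
    symSum (fun p q z => sm p q * (ind21 p q z (y :: x :: r) - 1 + pairOK p q (y :: x :: r)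
      + snocOK z (y :: x :: r) + tripleC p q z
      - snocOK z (y :: x :: r) * pairOK p q (z :: y :: x :: r)
      - insertCount p q z (y :: x :: r))) a b c = 0 := by
  have hN : symSum (fun p q z => sm p q * (sm y z *
      (pairCount p q (y :: x :: r) - ab p y + thetaInd p q (y :: x :: r)))) a b c = 0 := by
    refine symSum_eq_zero_of_swap (fun p q z => ?_) a b c
    rw [sm_comm q p, ← mul_add, ← mul_add]
    obtain h3 | ⟨h3, h4, h5⟩ := sm_cases p q
    · rw [h3, zero_mul]
    · have := pairCount_symm h4 h5 h
      rw [show pairCount p q (y :: x :: r) - ab p y + thetaInd p q (y :: x :: r) +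
        (pairCount q p (y :: x :: r) - ab q y + thetaInd q p (y :: x :: r)) = 0 by linarith]
      ring
  have hD := tripleDefect_symm h a b c
  have hC := symSum_tripleC a b c
  have hM := symSum_maxPart h.2.2 a b c
  -- Before symmetrization the weight splits into four pieces, each of which symmetrizes to zero for
  -- its own reason.
  have e : ∀ p q z, sm p q * (ind21 p q z (y :: x :: r) - 1 + pairOK p q (y :: x :: r)
      + snocOK z (y :: x :: r) + tripleC p q z
      - snocOK z (y :: x :: r) * pairOK p q (z :: y :: x :: r)
      - insertCount p q z (y :: x :: r)) =
      sm p q * (tripleC p q z - tripleC' p q z) + maxPart y (listMax (x :: r)) p q z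
      - tripleDefect y (y :: x :: r) p q z
      - sm p q * (sm y z *
      (pairCount p q (y :: x :: r) - ab p y + thetaInd p q (y :: x :: r))) := by
    intro p q z
    obtain h3 | ⟨h3, h4, h5⟩ := sm_cases p q
    · simp only [h3, maxPart, tripleDefect, zero_mul, add_zero, sub_zero]
    rw [tripleDefect, maxPart, h3, ind21, insertCount, pairOK, pairOK, thetaInd_cons p q z,
      snocOK, exc1, exc2, notAbove, thetaPart, listMax_cons]
    have hyM : y ≤ max y (listMax (x :: r)) := le_max_left _ _
    set M := max y (listMax (x :: r))
    set m := listMax (x :: r)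
    set T := thetaInd p q (y :: x :: r) with hT
    have hTc := thetaInd_cases p q h
    rw [← hT] at hTc
    set G1 := gammaInd' z q (y :: x :: r)
    set G2 := gammaInd' z p (y :: x :: r)
    have hc : ab p y = 0 ∨ (ab p y = 1 ∧ ab M p = 0) := by
      obtain ⟨h6, h7⟩ | ⟨h6, h7⟩ := ab_cases p y
      · exact Or.inl h6
      · exact Or.inr ⟨h6, ab_zero (by linarith)⟩
    have hG : ab z y * ab q z * ab y q = 0 := by
      obtain ⟨h6, h7⟩ | ⟨h6, h7⟩ := ab_cases z y
      · rw [h6]; ring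
      obtain ⟨h8, h9⟩ | ⟨h8, h9⟩ := ab_cases q z
      · rw [h8]; ring
      rw [ab_zero (show q < y + 1 by linarith)]
      ring
    -- The possible positions of `z` relative to the last element and the maximum. If `z` is above
    -- everything, the condition at `θ` puts `p` and `q` below `z`, so `(p, q, z)` is not correct.
    have hz : (ab z y = 1 ∧ ab y z = 0 ∧ ab M z = 0) ∨ (ab z y = 0 ∧ ab y z = 0 ∧ ab M z = 0) ∨
        (ab z y = 0 ∧ ab y z = 1 ∧ ab M z = 0) ∨
        (ab z y = 0 ∧ ab y z = 1 ∧ ab M z = 1 ∧ T * tripleC p q z = 0) := by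
      obtain ⟨h6, h7⟩ | ⟨h6, h7⟩ := ab_cases z y
      · obtain ⟨h8, h9⟩ | ⟨h8, h9⟩ := ab_cases y z
        · exact Or.inr (Or.inl ⟨h6, h8, ab_zero (by linarith)⟩)
        obtain ⟨h10, h11⟩ | ⟨h10, h11⟩ := ab_cases M z
        · exact Or.inr (Or.inr (Or.inl ⟨h6, h8, h10⟩))
        · refine Or.inr (Or.inr (Or.inr ⟨h6, h8, h10, ?_⟩))
          obtain h12 | ⟨h12, h13, h14⟩ := hTc
          · rw [h12, zero_mul]
          · rw [tripleC, ab_one (show p + 1 ≤ z by linarith),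
              ab_one (show q + 1 ≤ z by linarith)]
            ring
      · exact Or.inl ⟨h6, ab_zero (by linarith), ab_zero (by linarith)⟩
    obtain ⟨h6, h7, h8⟩ | ⟨h6, h7, h8⟩ | ⟨h6, h7, h8⟩ | ⟨h6, h7, h8, h9⟩ := hz <;>
    obtain h10 | ⟨h10, h11⟩ := hc <;> simp only [sm, h6, h7, h8, h10] at hG ⊢
    · linear_combination (- ab m p * ab p z * G1) * hG
    · rw [h11]
      linear_combination (- ab m p * ab p z * G1) * hG
    · ring
    · rw [h11]; ring
    · ring
    · rw [h11]; ring
    · linear_combination (-1 : ℤ) * h9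
    · rw [h11]
      linear_combination (-1 : ℤ) * h9
  simp only [symSum] at hN hD hC hM ⊢
  rw [e, e, e, e, e, e]
  linarith

/-! ### Sums over sequences -/

section SeqSum

variable {U : Type*} [Fintype U] {A : Type*} [CommRing A] (f : U → ℝ) (m : U → A)

/-- The sum of `F (w) · m (w_1) ⋯ m (w_n)` over all sequences of length `n`. -/
noncomputable def seqSum : ℕ → (List ℝ → ℤ) → A
  | 0, F => (F [] : A)
  | n + 1, F => ∑ u, m u * seqSum n (fun r => F (f u :: r))

lemma seqSum_zero (F : List ℝ → ℤ) : seqSum f m 0 F = (F [] : A) := rfl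

lemma seqSum_succ (n : ℕ) (F : List ℝ → ℤ) :
    seqSum f m (n + 1) F = ∑ u, m u * seqSum f m n (fun r => F (f u :: r)) := rfl

lemma seqSum_congr {n : ℕ} {F G : List ℝ → ℤ} (h : ∀ r : List ℝ, r.length = n → F r = G r) :
    seqSum f m n F = seqSum f m n G := by
  induction n generalizing F G with
  | zero => rw [seqSum_zero, seqSum_zero, h [] rfl]
  | succ n ih =>
    rw [seqSum_succ, seqSum_succ]
    refine Finset.sum_congr rfl fun u _ => ?_
    rw [ih fun r hr => h (f u :: r) (by rw [List.length_cons, hr])]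

lemma seqSum_add (n : ℕ) (F G : List ℝ → ℤ) :
    seqSum f m n (fun r => F r + G r) = seqSum f m n F + seqSum f m n G := by
  induction n generalizing F G with
  | zero => simp [seqSum_zero]
  | succ n ih => simp only [seqSum_succ, ih, mul_add, Finset.sum_add_distrib]

lemma seqSum_const_mul (n : ℕ) (c : ℤ) (F : List ℝ → ℤ) :
    seqSum f m n (fun r => c * F r) = c * seqSum f m n F := by
  induction n generalizing F with
  | zero => simp [seqSum_zero]
  | succ n ih =>
    simp only [seqSum_succ, ih, Finset.mul_sum]
    exact Finset.sum_congr rfl fun u _ => by ring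

lemma seqSum_sum (n : ℕ) {ι : Type*} (s : Finset ι) (F : ι → List ℝ → ℤ) :
    seqSum f m n (fun r => ∑ i ∈ s, F i r) = ∑ i ∈ s, seqSum f m n (F i) := by
  classical
  induction s using Finset.induction_on with
  | empty =>
    have := seqSum_const_mul f m n 0 (fun _ => 0)
    simpa using this
  | insert i s hi ih => simp only [Finset.sum_insert hi, seqSum_add, ih]

lemma seqSum_neg (n : ℕ) (F : List ℝ → ℤ) :
    seqSum f m n (fun r => - F r) = - seqSum f m n F := by
  have := seqSum_const_mul f m n (-1) F
  simpa using this

lemma seqSum_sub (n : ℕ) (F G : List ℝ → ℤ) :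
    seqSum f m n (fun r => F r - G r) = seqSum f m n F - seqSum f m n G := by
  simp only [sub_eq_add_neg, seqSum_add, seqSum_neg]

end SeqSum

/-! ### Insertions -/

/-- The sum of `F` over all insertions of `z` before the last element. -/
noncomputable def insertOne (z : ℝ) : List ℝ → (List ℝ → ℤ) → ℤ
  | [], _ => 0
  | [_], _ => 0
  | y :: x :: r, F => sm x z * ab z y * F (y :: z :: x :: r) +
      ab x y * insertOne z (x :: r) (fun s => F (y :: s))

/-- The sum of `F` over all insertions of `p, q` before the last element. -/
noncomputable def insertPair (p q : ℝ) : List ℝ → (List ℝ → ℤ) → ℤ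
  | [], _ => 0
  | [_], _ => 0
  | y :: x :: r, F => (1 - ab p x) * ab q y * F (y :: q :: p :: x :: r) +
      ab x y * insertPair p q (x :: r) (fun s => F (y :: s))

lemma insertOne_cons (z y x : ℝ) (r : List ℝ) (F : List ℝ → ℤ) : insertOne z (y :: x :: r) F =
    sm x z * ab z y * F (y :: z :: x :: r) +
      ab x y * insertOne z (x :: r) (fun s => F (y :: s)) := rfl

lemma insertPair_cons (p q y x : ℝ) (r : List ℝ) (F : List ℝ → ℤ) :
    insertPair p q (y :: x :: r) F = (1 - ab p x) * ab q y * F (y :: q :: p :: x :: r) +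
      ab x y * insertPair p q (x :: r) (fun s => F (y :: s)) := rfl

/-- An element inserted below a later one changes neither the last element nor the maximum. A factor
depending on these two only, such as the one in `riseExt`, can be pulled out of the insertion. -/
lemma insertOne_congr (z c : ℝ) (x : ℝ) (r : List ℝ) (k : ℤ) (F G : List ℝ → ℤ)
    (hc : c = listMax (x :: r))
    (h : ∀ s, listMax (x :: s) = c → F (x :: s) = k * G (x :: s)) :
    insertOne z (x :: r) F = k * insertOne z (x :: r) G := by
  induction r generalizing x F G c with
  | nil => exact (mul_zero k).symm
  | cons x' r ih =>
    rw [insertOne_cons, insertOne_cons]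
    have h1 : ab z x * F (x :: z :: x' :: r) = ab z x * (k * G (x :: z :: x' :: r)) := by
      obtain ⟨h1, h2⟩ | ⟨h1, h2⟩ := ab_cases z x
      · rw [h1, zero_mul, zero_mul]
      · rw [h]
        rw [hc, listMax_cons, listMax_cons, listMax_cons, ← max_assoc,
          max_eq_left (show z ≤ x by linarith)]
    have h2 := ih (listMax (x' :: r)) x' (fun s => F (x :: s)) (fun s => G (x :: s)) rfl
      (fun s hs => h _ (by rw [hc, listMax_cons, listMax_cons, hs]))
    rw [h2, mul_assoc, h1]
    ring

/-- As for one element: `q ≺ x` and `p < q + 1` give `p ≤ x`, so the maximum is again unchanged. -/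
lemma insertPair_congr {p q : ℝ} (hpq : p < q + 1) (c : ℝ) (x : ℝ) (r : List ℝ) (k : ℤ)
    (F G : List ℝ → ℤ) (hc : c = listMax (x :: r))
    (h : ∀ s, listMax (x :: s) = c → F (x :: s) = k * G (x :: s)) :
    insertPair p q (x :: r) F = k * insertPair p q (x :: r) G := by
  induction r generalizing x F G c with
  | nil => exact (mul_zero k).symm
  | cons x' r ih =>
    rw [insertPair_cons, insertPair_cons]
    have h1 : ab q x * F (x :: q :: p :: x' :: r) = ab q x * (k * G (x :: q :: p :: x' :: r)) := by
      obtain ⟨h1, h2⟩ | ⟨h1, h2⟩ := ab_cases q x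
      · rw [h1, zero_mul, zero_mul]
      · rw [h]
        rw [hc, listMax_cons, listMax_cons, listMax_cons, listMax_cons, ← max_assoc, ← max_assoc,
          max_eq_left (show q ≤ x by linarith), max_eq_left (show p ≤ x by linarith)]
    have h2 := ih (listMax (x' :: r)) x' (fun s => F (x :: s)) (fun s => G (x :: s)) rfl
      (fun s hs => h _ (by rw [hc, listMax_cons, listMax_cons, hs]))
    rw [h2, mul_assoc, h1]
    ring

lemma insertPair_one (p q : ℝ) (w : List ℝ) :
    insertPair p q w (fun _ => 1) = pairCount p q w := by
  induction w with
  | nil => rfl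
  | cons y w ih =>
    cases w with
    | nil => rfl
    | cons x r => rw [insertPair_cons, pairCount_cons, ih, mul_one]

lemma insertPair_add (p q : ℝ) (w : List ℝ) (F G : List ℝ → ℤ) :
    insertPair p q w (fun s => F s + G s) = insertPair p q w F + insertPair p q w G := by
  induction w generalizing F G with
  | nil => rfl
  | cons y w ih =>
    cases w with
    | nil => rfl
    | cons x r =>
      rw [insertPair_cons, insertPair_cons, insertPair_cons, ih]
      ring

/-- The sum of `F` over all insertions of `z`. -/
noncomputable def insertOneAll (z : ℝ) (F : List ℝ → ℤ) : List ℝ → ℤ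
  | [] => 0
  | y :: r => sm y z * F (z :: y :: r) + insertOne z (y :: r) F

/-- The sum of `F` over all insertions of `p, q`. -/
noncomputable def insertPairAll (p q : ℝ) (F : List ℝ → ℤ) : List ℝ → ℤ
  | [] => 0
  | y :: r => insertPair p q (y :: r) F
      + (1 - ab p y) * (1 - ab (listMax (y :: r)) p) * F (q :: p :: y :: r)
      + ab (listMax (y :: r)) p * sm q y * notAbove q r * F (p :: y :: q :: r)

/-- Since `p ∼ q`, the inserted pair starts the new run, so `z` cannot enter before `p`. This is why
the recursion for `tripleCount` has just two terms at the place of the pair. -/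
lemma insertPair_insertOne {p q z : ℝ} (hp : p < q + 1) (hq : q < p + 1) (w : List ℝ) :
    insertPair p q w (fun v => insertOne z v (fun _ => 1)) = tripleCount p q z w := by
  induction w with
  | nil => rfl
  | cons y w ih =>
    cases w with
    | nil => rfl
    | cons x r =>
      have h1 : insertPair p q (x :: r) (fun s => insertOne z (y :: s) (fun _ => 1)) =
          sm x z * ab z y * pairCount p q (x :: r) + ab x y * tripleCount p q z (x :: r) := by
        rw [insertPair_congr hp _ x r 1 _ (fun s => sm x z * ab z y + ab x y *
          insertOne z s (fun _ => 1)) rfl, one_mul, insertPair_add]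
        · rw [← ih, ← insertPair_one]
          congr 1
          · exact insertPair_congr hp _ x r _ _ _ rfl fun s _ => (mul_one _).symm
          · exact insertPair_congr hp _ x r _ _ _ rfl fun s _ => rfl
        · intro s _
          rw [insertOne_cons]
          ring
      rw [insertPair_cons, tripleCount_cons, h1, insertOne_cons, insertOne_cons, ab_zero hq]
      obtain ⟨h2, h3⟩ | ⟨h2, h3⟩ := ab_cases q y <;>
      obtain ⟨h4, h5⟩ | ⟨h4, h5⟩ := ab_cases x y <;> rw [h2, h4] <;> ring

lemma insertPairAll_insertOneAll {p q z : ℝ} (hp : p < q + 1) (hq : q < p + 1) (y x : ℝ)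
    (r : List ℝ) : insertPairAll p q (insertOneAll z (fun _ => 1)) (y :: x :: r) =
      insertCount p q z (y :: x :: r) := by
  have h1 : insertPair p q (y :: x :: r) (insertOneAll z (fun _ => 1)) =
      sm y z * pairCount p q (y :: x :: r) + tripleCount p q z (y :: x :: r) := by
    rw [insertPair_congr hp _ y (x :: r) 1 _ (fun s => sm y z +
          insertOne z s (fun _ => 1)) rfl, one_mul, insertPair_add, insertPair_insertOne hp hq,
          ← insertPair_one]
    · congr 1
      exact insertPair_congr hp _ y (x :: r) _ _ _ rfl fun s _ => (mul_one _).symm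
    · intro s _
      rw [insertOneAll]
      ring
  have h2 : (1 - ab p y) * (insertOneAll z (fun _ => 1) (q :: p :: y :: x :: r)) =
      (1 - ab p y) * tripleC' p q z := by
    rw [insertOneAll, insertOne_cons, ab_zero hq, tripleC']
    ring
  -- In the exceptional configuration the end of the sequence is `q ∼ y ≺ p`, which offers three
  -- places for `z`.
  have h3 : ab (listMax (y :: x :: r)) p * sm q y *
      (insertOneAll z (fun _ => 1) (p :: y :: q :: x :: r)) =
      ab (listMax (y :: x :: r)) p * sm q y * (sm p z + sm y z * ab z p + sm q z * ab z y) := by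
    obtain ⟨h4, h5⟩ | ⟨h4, h5⟩ := ab_cases (listMax (y :: x :: r)) p
    · rw [h4]; ring
    obtain h6 | ⟨h6, h7, h8⟩ := sm_cases q y
    · rw [h6]; ring
    have := head_le_listMax y (x :: r)
    rw [insertOneAll, insertOne_cons, insertOne_cons, ab_zero h8,
      ab_one (show y + 1 ≤ p by linarith)]
    ring
  rw [insertPairAll, h1, insertCount]
  linear_combination (1 - ab (listMax (y :: x :: r)) p) * h2 + notAbove q (x :: r) * h3

/-! ### Recursions for sums over correct sequences by deletion of one or two elements. -/

section SeqSum

/-- `F` after appending `y` to a sequence whose last element is incomparable to `y`. -/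
noncomputable def simExt (y : ℝ) (F : List ℝ → ℤ) : List ℝ → ℤ
  | [] => 0
  | x :: r => sm x y * F (y :: x :: r)

/-- `F` after correctly appending `y` to a sequence whose last element is smaller than `y`. -/
noncomputable def riseExt (y : ℝ) (F : List ℝ → ℤ) : List ℝ → ℤ
  | [] => 0
  | x :: r => ab x y * (1 - ab (listMax (x :: r)) y) * F (y :: x :: r)

lemma simExt_cons (y x : ℝ) (r : List ℝ) (F : List ℝ → ℤ) :
    simExt y F (x :: r) = sm x y * F (y :: x :: r) := rfl

lemma riseExt_cons (y x : ℝ) (r : List ℝ) (F : List ℝ → ℤ) :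
    riseExt y F (x :: r) = ab x y * (1 - ab (listMax (x :: r)) y) * F (y :: x :: r) := rfl

lemma insertOneAll_cons (z y : ℝ) (r : List ℝ) (F : List ℝ → ℤ) :
    insertOneAll z F (y :: r) = sm y z * F (z :: y :: r) + insertOne z (y :: r) F := rfl

lemma insertPairAll_cons (p q y : ℝ) (r : List ℝ) (F : List ℝ → ℤ) :
    insertPairAll p q F (y :: r) = insertPair p q (y :: r) F
      + (1 - ab p y) * (1 - ab (listMax (y :: r)) p) * F (q :: p :: y :: r)
      + ab (listMax (y :: r)) p * sm q y * notAbove q r * F (p :: y :: q :: r) := rfl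

/-- The last step of a correct sequence is a tie or a rise. After a tie, `y < x + 1` already keeps
`y` from being above all predecessors, so only a rise carries that condition. -/
lemma corInd_cons_eq (y x : ℝ) (r : List ℝ) : corInd (y :: x :: r) =
    corInd (x :: r) * sm x y + corInd (x :: r) * (ab x y * (1 - ab (listMax (x :: r)) y)) := by
  have := head_le_listMax x r
  rw [corInd_cons, sm]
  obtain ⟨h1, h2⟩ | ⟨h1, h2⟩ := ab_cases x y
  · rw [h1, ab_zero (show y < listMax (x :: r) + 1 by linarith)]
    ring
  · rw [h1, ab_zero (show x < y + 1 by linarith)]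
    ring

variable {U : Type*} [Fintype U] {A : Type*} [CommRing A] (f : U → ℝ) (m : U → A)

lemma seqSum_corInd_succ (n : ℕ) (F : List ℝ → ℤ) :
    seqSum f m (n + 2) (fun w => corInd w * F w) =
      ∑ y, m y * seqSum f m (n + 1) (fun w => corInd w * simExt (f y) F w) +
      ∑ y, m y * seqSum f m (n + 1) (fun w => corInd w * riseExt (f y) F w) := by
  rw [seqSum_succ, ← Finset.sum_add_distrib]
  refine Finset.sum_congr rfl fun y _ => ?_
  rw [← mul_add, ← seqSum_add]
  congr 1
  refine seqSum_congr f m fun w hw => ?_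
  match w, hw with
  | x :: r, _ =>
    rw [corInd_cons_eq, simExt_cons, riseExt_cons]
    ring

lemma ab_max_left_of_ab {a b y : ℝ} (h : a + 1 ≤ y) : ab (max a b) y = ab b y := by
  obtain ⟨h1, h2⟩ | ⟨h1, h2⟩ := ab_cases b y
  · rw [h1, ab_zero (by linarith [le_max_right a b])]
  · rw [h1, ab_one (by rcases max_choice a b with h3 | h3 <;> rw [h3] <;> linarith)]

/-- Removal of the element `w_{θ+1}`. -/
theorem seqSum_insertOneAll (n : ℕ) (F : List ℝ → ℤ) :
    seqSum f m (n + 2) (fun w => corInd w * F w) =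
      ∑ z, m z * seqSum f m (n + 1) (fun w => corInd w * insertOneAll (f z) F w) := by
  have comb : ∀ n (F : List ℝ → ℤ),
      ∑ z, m z * seqSum f m (n + 1) (fun w => corInd w * insertOneAll (f z) F w) =
      ∑ y, m y * seqSum f m (n + 1) (fun w => corInd w * simExt (f y) F w) +
      ∑ z, m z * seqSum f m (n + 1) (fun w => corInd w * insertOne (f z) w F) := by
    intro n F
    rw [← Finset.sum_add_distrib]
    refine Finset.sum_congr rfl fun y _ => ?_
    rw [← mul_add, ← seqSum_add]
    congr 1
    refine seqSum_congr f m fun w hw => ?_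
    match w, hw with
    | x :: r, _ =>
      rw [insertOneAll_cons, simExt_cons]
      ring
  induction n generalizing F with
  | zero =>
    rw [seqSum_corInd_succ, comb]
    congr 1
    refine Finset.sum_congr rfl fun y _ => ?_
    congr 1
    refine seqSum_congr f m fun w hw => ?_
    match w, hw with
    | [x], _ =>
      -- A single predecessor below `y` would put `y` above everything, so no correct pair ends in a
      -- rise.
      rw [riseExt_cons, insertOne, listMax]
      obtain ⟨h1, h2⟩ | ⟨h1, h2⟩ := ab_cases x (f y) <;> rw [h1] <;> ring
  | succ n ih =>
    rw [seqSum_corInd_succ, comb]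
    congr 1
    -- On one side `y` is split off as a final rise and the induction hypothesis inserts `z` into
    -- the rest; on the other `z` is inserted first and then the last element `y` is split off. The
    -- double sums are compared term by term.
    have e1 : ∀ y, m y * seqSum f m (n + 2) (fun w => corInd w * riseExt (f y) F w) = _ :=
      fun y => by rw [ih, Finset.mul_sum]
    have e2 : ∀ z, m z * seqSum f m (n + 2) (fun w => corInd w * insertOne (f z) w F) = _ :=
      fun z => by rw [seqSum_succ, Finset.mul_sum]
    rw [Finset.sum_congr rfl fun y _ => e1 y, Finset.sum_congr rfl fun y _ => e2 y,
      Finset.sum_comm]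
    refine Finset.sum_congr rfl fun z _ => Finset.sum_congr rfl fun y _ => ?_
    rw [mul_left_comm]
    congr 2
    refine seqSum_congr f m fun w hw => ?_
    match w, hw with
    | x :: r, _ =>
      have h2 := insertOne_congr (f z) _ x r (ab x (f y) * (1 - ab (listMax (x :: r)) (f y)))
        (riseExt (f y) F) (fun s => F (f y :: s)) rfl
        (fun s hs => by rw [riseExt_cons, hs])
      rw [insertOneAll_cons, h2, insertOne_cons, corInd_cons, riseExt_cons, listMax_cons]
      have hx := head_le_listMax x r
      obtain ⟨h7, h8⟩ | ⟨h7, h8⟩ := ab_cases (f z) (f y)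
      · rw [h7]
        obtain ⟨h5, h6⟩ | ⟨h5, h6⟩ := ab_cases x (f y)
        · rw [h5]; ring
        · rw [h5, ab_zero (show x < f y + 1 by linarith)]; ring
      rw [ab_max_left_of_ab h8, h7]
      obtain ⟨h5, h6⟩ | ⟨h5, h6⟩ := ab_cases x (f y)
      · rw [h5]
        obtain h9 | ⟨h9, h10, h11⟩ := sm_cases x (f z)
        · rw [h9]; ring
        rw [ab_zero (show x < f y + 1 by linarith)]
        ring
      · rw [h5, ab_zero (show x < f y + 1 by linarith)]
        ring

/-- Consider a sequence ending in `x, p, q, y`, where `M` is the maximum up to `x`. If `y` is not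
above `M`, deleting `p, q` leaves a correct sequence: the first summand. If `y` is above `M`, that
would fail; instead `p` and `y` are deleted, keeping `q`: the second summand. -/
lemma exceptional_coeff {p q x y M : ℝ} (hp : p < q + 1) (hq : q < p + 1) (hx : x ≤ M) :
    (1 - ab p x) * (1 - ab M p) * (ab q y * (1 - ab (max q (max p M)) y)) =
      (1 - ab y x) * (1 - ab M y) * ((1 - ab p x) * ab q y) +
      (1 - ab q x) * (1 - ab M q) * (sm y p * (ab (max q M) y * sm p q * (1 - ab M p))) := by
  have hs : sm p q = 1 := by
    rw [sm, ab_zero hq, ab_zero hp]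
    ring
  rw [hs]
  obtain ⟨h1, h2⟩ | ⟨h1, h2⟩ := ab_cases q y
  · rw [h1, ab_zero (show y < max q M + 1 by linarith [le_max_left q M])]
    ring
  rw [ab_max_left_of_ab h2, ab_max_left_of_ab h2, h1]
  obtain ⟨h3, h4⟩ | ⟨h3, h4⟩ := ab_cases M y
  · rw [h3, ab_zero (show y < max p M + 1 by linarith [le_max_right p M])]
    obtain ⟨h5, h6⟩ | ⟨h5, h6⟩ := ab_cases y x
    · rw [h5]
      obtain ⟨h7, h8⟩ | ⟨h7, h8⟩ := ab_cases M p
      · rw [h7]; ring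
      · linarith
    · rw [ab_one (show p + 1 ≤ x by linarith)]
      ring
  · rw [h3]
    obtain ⟨h7, h8⟩ | ⟨h7, h8⟩ := ab_cases M p
    · rw [h7]
      obtain ⟨h9, h10⟩ | ⟨h9, h10⟩ := ab_cases p y
      · rw [sm, h9, ab_zero (show p < y + 1 by linarith), ab_zero (show x < p + 1 by linarith),
          ab_zero (show x < q + 1 by linarith), ab_zero (show q < M + 1 by linarith),
          ab_zero (show y < max p M + 1 by linarith [le_max_left p M])]
        ring
      · rw [ab_max_left_of_ab h10, h3, sm, h9]
        ring
    · rw [h7]; ring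

/-- The exceptional summand of `insertPairAll`. -/
noncomputable def insertPairExc (p q : ℝ) (F : List ℝ → ℤ) : List ℝ → ℤ
  | [] => 0
  | y :: r => ab (listMax (y :: r)) p * sm q y * notAbove q r * F (p :: y :: q :: r)

lemma insertPairExc_cons (p q y : ℝ) (r : List ℝ) (F : List ℝ → ℤ) :
    insertPairExc p q F (y :: r) =
      ab (listMax (y :: r)) p * sm q y * notAbove q r * F (p :: y :: q :: r) := rfl

/-- The exceptional configuration ends in its maximum `p`, so an element `y ≻ p` would be above
everything and cannot follow. -/
lemma insertPairExc_riseExt {p q y : ℝ} {x : ℝ} {r : List ℝ} (hp : p < q + 1) (F : List ℝ → ℤ) :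
    insertPairExc p q (riseExt y F) (x :: r) = 0 := by
  rw [insertPairExc_cons, riseExt_cons]
  obtain ⟨h1, h2⟩ | ⟨h1, h2⟩ := ab_cases (listMax (x :: r)) p
  · rw [h1]; ring
  obtain h3 | ⟨h3, h4, h5⟩ := sm_cases q x
  · rw [h3]; ring
  obtain ⟨h6, h7⟩ | ⟨h6, h7⟩ := ab_cases p y
  · rw [h6]; ring
  have hx := head_le_listMax x r
  have hm : listMax (p :: x :: q :: r) + 1 ≤ y := by
    rw [listMax_cons, listMax_cons]
    have h8 : listMax (q :: r) ≤ max q (listMax (x :: r)) := by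
      cases r with
      | nil => exact le_max_left _ _
      | cons x' r => exact max_le_max le_rfl (le_max_right _ _)
    have h9 : max q (listMax (x :: r)) ≤ p := max_le (by linarith) (by linarith)
    have h10 : max p (max x (listMax (q :: r))) ≤ p :=
      max_le le_rfl (max_le (by linarith) (h8.trans h9))
    linarith
  rw [ab_one hm]
  ring

/-- The last summand uses the letters cyclically: the pair is `(y, p)` and `q` ends the shorter
sequence. Summation over all three letters makes it the exceptional part of the longer insertion. -/
lemma insertPair_step {p q x y : ℝ} {r : List ℝ} (hp : p < q + 1) (hq : q < p + 1)
    (F : List ℝ → ℤ) :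
    corInd (x :: r) * (sm p q * insertPairAll p q (riseExt y F) (x :: r)) =
      corInd (y :: x :: r) * (sm p q * insertPair p q (y :: x :: r) F) +
      corInd (q :: x :: r) * (sm y p * insertPairExc y p F (q :: x :: r)) := by
  have h1 := insertPairExc_riseExt (y := y) (x := x) (r := r) hp F
  have h2 := insertPair_congr hp _ x r (ab x y * (1 - ab (listMax (x :: r)) y))
    (riseExt y F) (fun s => F (y :: s)) rfl (fun s hs => by rw [riseExt_cons, hs])
  have h3 := exceptional_coeff (y := y) hp hq (head_le_listMax x r)
  have h4 : insertPairAll p q (riseExt y F) (x :: r) = insertPair p q (x :: r) (riseExt y F) +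
      (1 - ab p x) * (1 - ab (listMax (x :: r)) p) * riseExt y F (q :: p :: x :: r) +
      insertPairExc p q (riseExt y F) (x :: r) := rfl
  have h5 : ab x y * (1 - ab y x) = ab x y := by
    obtain ⟨h5, h6⟩ | ⟨h5, h6⟩ := ab_cases x y
    · rw [h5]; ring
    · rw [ab_zero (show x < y + 1 by linarith)]; ring
  have hs : sm p q = 1 := by
    rw [sm, ab_zero hq, ab_zero hp]
    ring
  rw [h4, h1, h2, riseExt_cons, insertPair_cons, insertPairExc_cons, corInd_cons, corInd_cons,
    notAbove, listMax_cons, listMax_cons, listMax_cons]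
  rw [hs] at h3 ⊢
  linear_combination corInd (x :: r) * F (y :: q :: p :: x :: r) * h3 -
    corInd (x :: r) * (1 - ab (listMax (x :: r)) y) *
      insertPair p q (x :: r) (fun s => F (y :: s)) * h5

/-- Removal of the pair `w_θ, w_{θ+1}`. -/
theorem seqSum_insertPairAll (n : ℕ) (F : List ℝ → ℤ) :
    seqSum f m (n + 3) (fun w => corInd w * F w) =
      ∑ p, ∑ q, m p * m q * seqSum f m (n + 1)
        (fun w => corInd w * (sm (f p) (f q) * insertPairAll (f p) (f q) F w)) := by
  have comb : ∀ n (F : List ℝ → ℤ), ∑ p, ∑ q, m p * m q * seqSum f m (n + 1)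
        (fun w => corInd w * (sm (f p) (f q) * insertPairAll (f p) (f q) F w)) =
      ∑ y, m y * seqSum f m (n + 2) (fun w => corInd w * simExt (f y) F w) +
      (∑ p, ∑ q, m p * m q * seqSum f m (n + 1)
        (fun w => corInd w * (sm (f p) (f q) * insertPair (f p) (f q) w F)) +
      ∑ p, ∑ q, m p * m q * seqSum f m (n + 1)
        (fun w => corInd w * (sm (f p) (f q) * insertPairExc (f p) (f q) F w))) := by
    intro n F
    have e1 : ∀ y, m y * seqSum f m (n + 2) (fun w => corInd w * simExt (f y) F w) = _ :=
      fun y => by rw [seqSum_succ, Finset.mul_sum]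
    rw [(Finset.sum_congr rfl fun y _ => e1 y).trans Finset.sum_comm, ← Finset.sum_add_distrib,
      ← Finset.sum_add_distrib]
    refine Finset.sum_congr rfl fun p _ => ?_
    rw [← Finset.sum_add_distrib, ← Finset.sum_add_distrib]
    refine Finset.sum_congr rfl fun q _ => ?_
    rw [← mul_add, ← seqSum_add, ← mul_assoc, mul_comm (m q), ← mul_add, ← seqSum_add]
    congr 1
    refine seqSum_congr f m fun w hw => ?_
    match w, hw with
    | y :: r, _ =>
      rw [insertPairAll_cons, simExt_cons, insertPairExc_cons, corInd_cons]
      ring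
  induction n generalizing F with
  | zero =>
    rw [seqSum_corInd_succ, comb]
    congr 1
    simp only [seqSum_succ, seqSum_zero, insertPair, Finset.mul_sum, mul_zero, Int.cast_zero,
      Finset.sum_const_zero, zero_add]
    refine Finset.sum_congr rfl fun y _ => ?_
    rw [Finset.sum_comm]
    refine Finset.sum_congr rfl fun q _ => Finset.sum_congr rfl fun x _ => ?_
    -- A correct sequence of length three with a final rise is `q ∼ x ≺ y` with `y ∼ q`: exactly the
    -- exceptional insertion of the pair `(y, q)` into `(x)`.
    have key : corInd [f x, f q] * riseExt (f y) F [f x, f q] =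
        corInd [f x] * (sm (f y) (f q) * insertPairExc (f y) (f q) F [f x]) := by
      rw [corInd_cons, riseExt_cons, insertPairExc_cons, listMax_cons]
      simp only [listMax, notAbove, corInd]
      obtain ⟨h1, h2⟩ | ⟨h1, h2⟩ := ab_cases (f x) (f y)
      · rw [h1]; ring
      rw [ab_max_left_of_ab h2, h1, sm, sm]
      obtain ⟨h3, h4⟩ | ⟨h3, h4⟩ := ab_cases (f y) (f q)
      · rw [h3]; ring
      · rw [h3, ab_one (show f x + 1 ≤ f q by linarith)]
        ring
    rw [key]
    ring
  | succ n ih =>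
    rw [seqSum_corInd_succ, comb]
    congr 1
    have e1 : ∀ y, m y * seqSum f m (n + 3) (fun w => corInd w * riseExt (f y) F w) =
        ∑ p, ∑ q, m y * (m p * m q * seqSum f m (n + 1) (fun w => corInd w *
          (sm (f p) (f q) * insertPairAll (f p) (f q) (riseExt (f y) F) w))) := fun y => by
      rw [ih, Finset.mul_sum]
      exact Finset.sum_congr rfl fun p _ => Finset.mul_sum _ _ _
    have e2 : ∑ p, ∑ q, m p * m q * seqSum f m (n + 2)
        (fun w => corInd w * (sm (f p) (f q) * insertPair (f p) (f q) w F)) =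
        ∑ y, ∑ p, ∑ q, m p * m q * (m y * seqSum f m (n + 1) (fun w => corInd (f y :: w) *
          (sm (f p) (f q) * insertPair (f p) (f q) (f y :: w) F))) := by
      simp only [seqSum_succ f m (n + 1), Finset.mul_sum]
      rw [Finset.sum_comm]
      rw [Finset.sum_congr rfl fun q _ => Finset.sum_comm, Finset.sum_comm]
      exact Finset.sum_congr rfl fun y _ => Finset.sum_comm
    have e3 : ∀ y p, m y * m p * seqSum f m (n + 2)
        (fun w => corInd w * (sm (f y) (f p) * insertPairExc (f y) (f p) F w)) =
        ∑ q, m y * m p * (m q * seqSum f m (n + 1) (fun w => corInd (f q :: w) *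
          (sm (f y) (f p) * insertPairExc (f y) (f p) F (f q :: w)))) := fun y p => by
      rw [seqSum_succ, Finset.mul_sum]
    rw [Finset.sum_congr rfl fun y _ => e1 y, e2,
      Finset.sum_congr rfl fun y _ => Finset.sum_congr rfl fun p _ => e3 y p,
      ← Finset.sum_add_distrib]
    refine Finset.sum_congr rfl fun y _ => ?_
    rw [← Finset.sum_add_distrib]
    refine Finset.sum_congr rfl fun p _ => ?_
    rw [← Finset.sum_add_distrib]
    refine Finset.sum_congr rfl fun q _ => ?_
    have e4 : m p * m q * (m y * seqSum f m (n + 1) (fun w => corInd (f y :: w) *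
          (sm (f p) (f q) * insertPair (f p) (f q) (f y :: w) F))) =
        m y * (m p * m q * seqSum f m (n + 1) (fun w => corInd (f y :: w) *
          (sm (f p) (f q) * insertPair (f p) (f q) (f y :: w) F))) := by ring
    have e5 : m y * m p * (m q * seqSum f m (n + 1) (fun w => corInd (f q :: w) *
          (sm (f y) (f p) * insertPairExc (f y) (f p) F (f q :: w)))) =
        m y * (m p * m q * seqSum f m (n + 1) (fun w => corInd (f q :: w) *
          (sm (f y) (f p) * insertPairExc (f y) (f p) F (f q :: w)))) := by ring
    rw [e4, e5, ← mul_add, ← mul_add, ← seqSum_add]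
    congr 2
    refine seqSum_congr f m fun w hw => ?_
    match w, hw with
    | x :: r, _ =>
      obtain h1 | ⟨h1, h2, h3⟩ := sm_cases (f p) (f q)
      · rw [insertPairExc_cons, h1]
        ring
      · exact insertPair_step h2 h3 F

end SeqSum

/-! ### Products of power sums as sums over triples. -/

section Corrects

/-- The part of `pairOK_symm` not covered by `pairCount_symm`: elements of the pair above the last
element `y` or above the maximum `m` of the others. -/
lemma pairOK_symm_aux {y m p q : ℝ} (hp : p < q + 1) (hq : q < p + 1) (hy : y < m + 1) :
    (ab (max y m) p * sm q y * (1 - ab m q) - ab (max y m) p + ab m p * ab y q) +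
    (ab (max y m) q * sm p y * (1 - ab m p) - ab (max y m) q + ab m q * ab y p) = 0 := by
  rcases le_total y m with h | h
  · rw [max_eq_right h]
    obtain ⟨_, _⟩ | ⟨_, _⟩ := ab_cases m p <;> obtain ⟨_, _⟩ | ⟨_, _⟩ := ab_cases m q <;>
    obtain ⟨_, _⟩ | ⟨_, _⟩ := ab_cases y p <;> obtain ⟨_, _⟩ | ⟨_, _⟩ := ab_cases y q <;>
    first | (exfalso; linarith) | skip
    all_goals obtain ⟨_, _⟩ | ⟨_, _⟩ := ab_cases p y <;> obtain ⟨_, _⟩ | ⟨_, _⟩ := ab_cases q y <;>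
      first | (exfalso; linarith) | simp [sm, *]
  · rw [max_eq_left h]
    obtain ⟨_, _⟩ | ⟨_, _⟩ := ab_cases m p <;> obtain ⟨_, _⟩ | ⟨_, _⟩ := ab_cases m q <;>
    obtain ⟨_, _⟩ | ⟨_, _⟩ := ab_cases y p <;> obtain ⟨_, _⟩ | ⟨_, _⟩ := ab_cases y q <;>
    first | (exfalso; linarith) | skip
    all_goals obtain ⟨_, _⟩ | ⟨_, _⟩ := ab_cases p y <;> obtain ⟨_, _⟩ | ⟨_, _⟩ := ab_cases q y <;>
      first | (exfalso; linarith) | simp [sm, *]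

/-- The number of insertions of a pair and the indicator of the complement of `M_{l,2}` differ only
by a term antisymmetric in `p, q`, which is invisible in commuting variables. -/
lemma pairOK_symm {p q : ℝ} {y x : ℝ} {r : List ℝ} (h : Cor (y :: x :: r)) :
    sm p q * (insertPairAll p q (fun _ => 1) (y :: x :: r) - pairOK p q (y :: x :: r)) +
      sm q p * (insertPairAll q p (fun _ => 1) (y :: x :: r) - pairOK q p (y :: x :: r)) = 0 := by
  rw [sm_comm q p, ← mul_add]
  obtain h3 | ⟨h3, h4, h5⟩ := sm_cases p q
  · rw [h3, zero_mul]
  have h1 := pairCount_symm h4 h5 h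
  have h2 := pairOK_symm_aux h4 h5 h.2.2
  have hM : ∀ t, ab t y * ab (max y (listMax (x :: r))) t = 0 := by
    intro t
    obtain ⟨h6, h7⟩ | ⟨h6, h7⟩ := ab_cases t y
    · rw [h6, zero_mul]
    · rw [ab_zero (a := max y (listMax (x :: r))) (b := t)
        (by linarith [le_max_left y (listMax (x :: r))]), mul_zero]
  rw [insertPairAll_cons, insertPairAll_cons, insertPair_one, insertPair_one, pairOK, pairOK,
    notAbove, notAbove, listMax_cons]
  linear_combination sm p q * (h1 + h2 + hM p + hM q)

variable {U : Type*} [Fintype U] {A : Type*} [CommRing A] (f : U → ℝ) (m : U → A)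

/-- The sum of the monomials of all correct sequences of length `n`. -/
noncomputable def corSum (n : ℕ) : A := seqSum f m n corInd

lemma corSum_eq (n : ℕ) : corSum f m n = seqSum f m n (fun w => corInd w * 1) := by
  simp only [mul_one]
  rfl

lemma seqSum_corInd_snoc (n : ℕ) (F : List ℝ → ℤ) :
    seqSum f m (n + 2) (fun w => corInd w * F w) =
      ∑ z, m z * seqSum f m (n + 1) (fun w => corInd w * (snocOK (f z) w * F (f z :: w))) := by
  rw [seqSum_succ]
  refine Finset.sum_congr rfl fun z _ => ?_
  congr 1
  refine seqSum_congr f m fun w hw => ?_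
  match w, hw with
  | x :: r, _ =>
    rw [corInd_cons, snocOK]
    ring

lemma corSum_one : corSum f m 1 = ∑ u, m u := by
  simp [corSum, seqSum_succ, seqSum_zero, corInd]

lemma corSum_two : corSum f m 2 = ∑ p, ∑ q, m p * m q * (sm (f p) (f q) : A) := by
  simp only [corSum, seqSum_succ, seqSum_zero, Finset.mul_sum]
  rw [Finset.sum_comm]
  refine Finset.sum_congr rfl fun p _ => Finset.sum_congr rfl fun q _ => ?_
  have : corInd [f q, f p] = sm (f p) (f q) := by
    rw [corInd_cons, corInd, listMax, sm]
    ring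
  rw [this]
  ring

lemma corSum_three : corSum f m 3 = ∑ p, ∑ q, ∑ z, m p * m q * m z *
    ((sm (f p) (f q) * tripleC (f p) (f q) (f z) : ℤ) : A) := by
  simp only [corSum, seqSum_succ, seqSum_zero, Finset.mul_sum]
  rw [Finset.sum_comm, Finset.sum_congr rfl fun q _ => Finset.sum_comm, Finset.sum_comm]
  refine Finset.sum_congr rfl fun p _ => Finset.sum_congr rfl fun q _ =>
    Finset.sum_congr rfl fun z _ => ?_
  have : corInd [f z, f q, f p] = sm (f p) (f q) * tripleC (f p) (f q) (f z) := by
    rw [corInd_cons, corInd_cons, corInd, listMax_cons, listMax, sm, tripleC]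
    obtain ⟨h1, h2⟩ | ⟨h1, h2⟩ := ab_cases (f p) (f z)
    · rw [h1, ab_zero (show f z < max (f q) (f p) + 1 by linarith [le_max_right (f q) (f p)])]
      ring
    · rw [max_comm, ab_max_left_of_ab h2, h1]
      ring
  rw [this]
  ring

/-- The sum over triples `(w | p, q | z)` of `G p q z w`, with `w` correct of length `n`. -/
noncomputable def tripleSum (n : ℕ) (G : ℝ → ℝ → ℝ → List ℝ → ℤ) : A :=
  ∑ p, ∑ q, ∑ z, m p * m q * m z *
    seqSum f m n (fun w => corInd w * G (f p) (f q) (f z) w)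

lemma tripleSum_add (n : ℕ) (G H : ℝ → ℝ → ℝ → List ℝ → ℤ) :
    tripleSum f m n (fun p q z w => G p q z w + H p q z w) =
      tripleSum f m n G + tripleSum f m n H := by
  simp only [tripleSum, mul_add, seqSum_add, Finset.sum_add_distrib]

lemma tripleSum_sub (n : ℕ) (G H : ℝ → ℝ → ℝ → List ℝ → ℤ) :
    tripleSum f m n (fun p q z w => G p q z w - H p q z w) =
      tripleSum f m n G - tripleSum f m n H := by
  simp only [tripleSum, mul_sub, seqSum_sub, Finset.sum_sub_distrib]

lemma seqSum_corInd_eq_zero {n : ℕ} {F : List ℝ → ℤ}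
    (h : ∀ w : List ℝ, w.length = n → Cor w → F w = 0) :
    seqSum f m n (fun w => corInd w * F w) = 0 := by
  rw [seqSum_congr f m (G := fun _ => 0 * 0), seqSum_const_mul, Int.cast_zero, zero_mul]
  intro w hw
  obtain h1 | ⟨h1, h2⟩ := corInd_cases w
  · rw [h1]; ring
  · rw [h w hw h2]; ring

/-- The monomial in `p, q, z` is symmetric, so six times the sum is the sum of the symmetrized
weights; the factor six is then cancelled. -/
lemma tripleSum_eq_zero [IsDomain A] [CharZero A] {n : ℕ} {G : ℝ → ℝ → ℝ → List ℝ → ℤ}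
    (h : ∀ w : List ℝ, w.length = n → Cor w → ∀ a b c, symSum (fun p q z => G p q z w) a b c = 0) :
    tripleSum f m n G = 0 := by
  have e : ∀ K : U → U → U → A, 6 * ∑ p, ∑ q, ∑ z, K p q z =
      ∑ p, ∑ q, ∑ z, (K p q z + K p z q + K q p z + K q z p + K z p q + K z q p) := by
    intro K
    have s1 : ∀ K : U → U → U → A, ∑ p, ∑ q, ∑ z, K p z q = ∑ p, ∑ q, ∑ z, K p q z :=
      fun K => Finset.sum_congr rfl fun p _ => Finset.sum_comm
    have s2 : ∀ K : U → U → U → A, ∑ p, ∑ q, ∑ z, K q p z = ∑ p, ∑ q, ∑ z, K p q z :=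
      fun K => Finset.sum_comm
    simp only [Finset.sum_add_distrib]
    rw [s1 K, s2 K, s1 (fun p q z => K q p z), s2 K, s2 (fun p q z => K p z q), s1 K,
      s1 (fun p q z => K q z p), s2 (fun p q z => K p z q), s1 K]
    ring
  have h6 : (6 : A) * tripleSum f m n G = 0 := by
    rw [tripleSum, e]
    refine Finset.sum_eq_zero fun p _ => Finset.sum_eq_zero fun q _ => Finset.sum_eq_zero fun z _ => ?_
    have h0 := seqSum_corInd_eq_zero f m (fun w hw hc => h w hw hc (f p) (f q) (f z))
    simp only [symSum, mul_add, seqSum_add] at h0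
    linear_combination m p * m q * m z * h0
  exact (mul_eq_zero.mp h6).resolve_left (by norm_num)

/-- `P_l P_2 - P_{l+2}` is the sum over `M_{l,2}`. -/
lemma corSum_pair [IsDomain A] [CharZero A] (n : ℕ) :
    corSum f m (n + 4) = ∑ p, ∑ q, m p * m q * seqSum f m (n + 2)
        (fun w => corInd w * (sm (f p) (f q) * pairOK (f p) (f q) w)) := by
  rw [corSum_eq, seqSum_insertPairAll f m (n + 1), ← sub_eq_zero]
  simp only [← Finset.sum_sub_distrib, ← mul_sub, ← seqSum_sub]
  have e : ∀ K : U → U → A, 2 * ∑ p, ∑ q, K p q = ∑ p, ∑ q, (K p q + K q p) := by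
    intro K
    simp only [Finset.sum_add_distrib]
    rw [Finset.sum_comm (f := fun p q => K q p)]
    ring
  refine (mul_eq_zero.mp ((e _).trans ?_)).resolve_left (two_ne_zero (α := A))
  refine Finset.sum_eq_zero fun p _ => Finset.sum_eq_zero fun q _ => ?_
  have h0 := seqSum_corInd_eq_zero f m (n := n + 2) (F := fun w =>
    sm (f p) (f q) * (insertPairAll (f p) (f q) (fun _ => 1) w - pairOK (f p) (f q) w) +
      sm (f q) (f p) * (insertPairAll (f q) (f p) (fun _ => 1) w - pairOK (f q) (f p) w))
    (fun w hw hc => by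
      match w, hw, hc with
      | y :: x :: r, _, hc => exact pairOK_symm hc)
  simp only [mul_add, seqSum_add] at h0
  linear_combination m p * m q * h0

theorem tripleSum_ind21 [IsDomain A] [CharZero A] (n : ℕ) :
    tripleSum f m (n + 2) (fun p q z w => sm p q * ind21 p q z w) =
      corSum f m (n + 2) * corSum f m 2 * corSum f m 1 - corSum f m (n + 4) * corSum f m 1
      - corSum f m (n + 3) * corSum f m 2 - corSum f m (n + 2) * corSum f m 3
      + 2 * corSum f m (n + 5) := by
  have h1 : corSum f m (n + 2) * corSum f m 2 * corSum f m 1 =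
      tripleSum f m (n + 2) (fun p q _ _ => sm p q) := by
    rw [corSum_one, corSum_two, mul_assoc, Finset.sum_mul, Finset.mul_sum, tripleSum]
    refine Finset.sum_congr rfl fun p _ => ?_
    rw [Finset.sum_mul, Finset.mul_sum]
    refine Finset.sum_congr rfl fun q _ => ?_
    rw [Finset.mul_sum, Finset.mul_sum]
    refine Finset.sum_congr rfl fun z _ => ?_
    rw [seqSum_congr f m (fun w _ => mul_comm _ _), seqSum_const_mul, corSum]
    ring
  have h2 : corSum f m (n + 4) * corSum f m 1 =
      tripleSum f m (n + 2) (fun p q _ w => sm p q * pairOK p q w) := by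
    rw [corSum_one, corSum_pair, Finset.sum_mul, tripleSum]
    refine Finset.sum_congr rfl fun p _ => ?_
    rw [Finset.sum_mul]
    refine Finset.sum_congr rfl fun q _ => ?_
    rw [Finset.mul_sum]
    refine Finset.sum_congr rfl fun z _ => ?_
    ring
  have h3 : corSum f m (n + 3) * corSum f m 2 =
      tripleSum f m (n + 2) (fun p q z w => sm p q * snocOK z w) := by
    rw [corSum_two, corSum_eq, seqSum_corInd_snoc f m (n + 1), Finset.mul_sum, tripleSum]
    refine Finset.sum_congr rfl fun p _ => ?_
    rw [Finset.mul_sum]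
    refine Finset.sum_congr rfl fun q _ => ?_
    rw [Finset.sum_mul]
    refine Finset.sum_congr rfl fun z _ => ?_
    rw [seqSum_congr f m (n := n + 2) (F := fun w => corInd w * (sm (f p) (f q) * snocOK (f z) w))
      (fun w _ => mul_left_comm _ _ _), seqSum_const_mul]
    simp only [mul_one]
    ring
  have h4 : corSum f m (n + 2) * corSum f m 3 =
      tripleSum f m (n + 2) (fun p q z _ => sm p q * tripleC p q z) := by
    rw [corSum_three, Finset.mul_sum, tripleSum]
    refine Finset.sum_congr rfl fun p _ => ?_
    rw [Finset.mul_sum]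
    refine Finset.sum_congr rfl fun q _ => ?_
    rw [Finset.mul_sum]
    refine Finset.sum_congr rfl fun z _ => ?_
    rw [seqSum_congr f m (fun w _ => mul_comm _ _), seqSum_const_mul, corSum]
    ring
  -- First expansion: the pair relative to a correct sequence of length `n + 3`, whose last element
  -- is `z`.
  have h5 : corSum f m (n + 5) =
      tripleSum f m (n + 2) (fun p q z w => sm p q * (snocOK z w * pairOK p q (z :: w))) := by
    rw [corSum_pair f m (n + 1), tripleSum]
    refine Finset.sum_congr rfl fun p _ => Finset.sum_congr rfl fun q _ => ?_
    rw [seqSum_corInd_snoc f m (n + 1), Finset.mul_sum]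
    refine Finset.sum_congr rfl fun z _ => ?_
    rw [← mul_assoc]
    congr 1
    refine seqSum_congr f m fun w _ => ?_
    ring
  -- Second expansion: delete the element at `θ + 1`, then the pair at the new `θ`.
  have h6 : corSum f m (n + 5) =
      tripleSum f m (n + 2) (fun p q z w => sm p q * insertCount p q z w) := by
    rw [corSum_eq, seqSum_insertOneAll f m (n + 3)]
    simp only [seqSum_insertPairAll f m (n + 1), Finset.mul_sum]
    rw [tripleSum, Finset.sum_comm, Finset.sum_congr rfl fun p _ => Finset.sum_comm]
    refine Finset.sum_congr rfl fun p _ => Finset.sum_congr rfl fun q _ =>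
      Finset.sum_congr rfl fun z _ => ?_
    rw [← mul_assoc, mul_comm (m z)]
    congr 1
    refine seqSum_congr f m fun w hw => ?_
    match w, hw with
    | y :: x :: r, _ =>
      obtain h3 | ⟨h3, h4, h5⟩ := sm_cases (f p) (f q)
      · rw [h3]; ring
      · rw [insertPairAll_insertOneAll h4 h5]
  have h0 : tripleSum f m (n + 2) (fun p q z w => sm p q * (ind21 p q z w - 1 + pairOK p q w
      + snocOK z w + tripleC p q z - snocOK z w * pairOK p q (z :: w)
      - insertCount p q z w)) = 0 := by
    refine tripleSum_eq_zero f m fun w hw hc a b c => ?_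
    match w, hw, hc with
    | y :: x :: r, _, hc => exact symSum_ind21 hc a b c
  simp only [mul_add, mul_sub, tripleSum_add, tripleSum_sub, mul_one] at h0
  rw [h1, h2, h3, h4, two_mul]
  -- The two equal copies are deliberately expanded in different ways.
  nth_rw 1 [h5]
  rw [h6]
  linear_combination h0

end Corrects

/-! ### Newton's identities for chains and correct sequences. -/

section Newton

open Finset

variable {U : Type*} (f : U → ℝ)

/-- `S` is a chain for the order `u ≺ v ↔ f u + 1 ≤ f v`. -/
def IsUnitChain (S : Finset U) : Prop :=
  ∀ u ∈ S, ∀ v ∈ S, u ≠ v → f u + 1 ≤ f v ∨ f v + 1 ≤ f u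

/-- Every element of `S` is either below the last entry of `w` or above all the entries of `w`. -/
def Splits (S : Finset U) (w : List ℝ) : Prop :=
  ∀ z ∈ S, f z + 1 ≤ w.headI ∨ listMax w + 1 ≤ f z

lemma snocOK_cases (z y : ℝ) (r : List ℝ) :
    (snocOK z (y :: r) = 0 ∧ (z + 1 ≤ y ∨ listMax (y :: r) + 1 ≤ z)) ∨
      (snocOK z (y :: r) = 1 ∧ y < z + 1 ∧ z < listMax (y :: r) + 1) := by
  rw [snocOK]
  obtain ⟨h1, h2⟩ | ⟨h1, h2⟩ := ab_cases z y <;>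
  obtain ⟨h3, h4⟩ | ⟨h3, h4⟩ := ab_cases (listMax (y :: r)) z <;>
  simp [h1, h3, h2, h4]

-- If a chain `S` does not split `w`, call an element bad when it is neither below the last entry
-- nor above all entries. The largest bad element is the unique one that can be moved to the end of
-- `w` so that the rest of `S` splits the result: everything below it is fine, and everything above
-- it exceeds all entries. Conversely, if the rest splits the extended sequence, the moved element
-- is comparable to all of the rest, so `S` was a chain.
open Classical in
lemma chain_indicator {y : ℝ} {r : List ℝ} (S : Finset U) :
    (if IsUnitChain f S then 1 else 0 : ℤ) =
      (if IsUnitChain f S ∧ Splits f S (y :: r) then 1 else 0) +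
      ∑ z ∈ S, snocOK (f z) (y :: r) *
        if IsUnitChain f (S.erase z) ∧ Splits f (S.erase z) (f z :: y :: r) then 1 else 0 := by
  by_cases hS : IsUnitChain f S
  swap
  · rw [if_neg hS, if_neg (fun h => hS h.1), zero_add, eq_comm]
    refine sum_eq_zero fun z hz => ?_
    rw [if_neg, mul_zero]
    rintro ⟨h1, h2⟩
    have h3 : ∀ v ∈ S, z ≠ v → f z + 1 ≤ f v ∨ f v + 1 ≤ f z := by
      intro v hv hne
      rcases h2 v (mem_erase.mpr ⟨hne.symm, hv⟩) with h | h
      · exact Or.inr h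
      · rw [listMax_cons] at h
        exact Or.inl (by linarith [le_max_left (f z) (listMax (y :: r))])
    refine hS fun u hu v hv hne => ?_
    by_cases huz : u = z
    · exact huz ▸ h3 v hv (huz ▸ hne)
    by_cases hvz : v = z
    · exact hvz ▸ (h3 u hu (hvz ▸ hne.symm)).symm
    exact h1 u (mem_erase.mpr ⟨huz, hu⟩) v (mem_erase.mpr ⟨hvz, hv⟩) hne
  rw [if_pos hS]
  by_cases hw : Splits f S (y :: r)
  · rw [if_pos ⟨hS, hw⟩, sum_eq_zero, add_zero]
    intro z hz
    obtain ⟨h1, -⟩ | ⟨-, h1, h2⟩ := snocOK_cases (f z) y r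
    · rw [h1, zero_mul]
    · rcases hw z hz with h | h
      · exact absurd h (not_le.mpr h1)
      · exact absurd h (not_le.mpr h2)
  rw [if_neg (fun h => hw h.2), zero_add]
  obtain ⟨z, hz, hmax⟩ := exists_max_image
    (S.filter fun z => ¬ (f z + 1 ≤ y ∨ listMax (y :: r) + 1 ≤ f z)) f (by
      by_contra h
      rw [not_nonempty_iff_eq_empty, filter_eq_empty_iff] at h
      exact hw fun z hz => not_not.mp (h hz))
  rw [mem_filter] at hz
  obtain ⟨hz, hbad⟩ := hz
  have hbad' := hbad
  rw [not_or, not_le, not_le] at hbad'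
  rw [sum_eq_single_of_mem z hz, if_pos, mul_one]
  · obtain ⟨-, h⟩ | ⟨h, -⟩ := snocOK_cases (f z) y r
    · exact absurd h hbad
    · exact h.symm
  · refine ⟨fun u hu v hv => hS u (mem_of_mem_erase hu) v (mem_of_mem_erase hv), fun v hv => ?_⟩
    rw [listMax_cons, List.headI]
    rcases hS v (mem_of_mem_erase hv) z hz (ne_of_mem_erase hv) with h | h
    · exact Or.inl h
    · by_cases hb : f v + 1 ≤ y ∨ listMax (y :: r) + 1 ≤ f v
      · rcases hb with hb | hb
        · linarith
        · exact Or.inr (by rw [← max_add_add_right]; exact max_le h hb)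
      · have := hmax v (mem_filter.mpr ⟨mem_of_mem_erase hv, hb⟩)
        linarith
  · intro v hv hne
    by_cases hb : f v + 1 ≤ y ∨ listMax (y :: r) + 1 ≤ f v
    · obtain ⟨h, -⟩ | ⟨-, h1, h2⟩ := snocOK_cases (f v) y r
      · rw [h, zero_mul]
      · rcases hb with h | h <;> linarith
    · rw [if_neg, mul_zero]
      rintro ⟨-, h⟩
      have h1 := hmax v (mem_filter.mpr ⟨hv, hb⟩)
      rcases h z (mem_erase.mpr ⟨hne.symm, hz⟩) with h | h
      · rw [List.headI] at h
        linarith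
      · rw [listMax_cons] at h
        linarith [le_max_right (f v) (listMax (y :: r))]

variable [Fintype U] {A : Type*} [CommRing A] (m : U → A)

open Classical in
/-- The sum of the monomials of the `k`-element chains. -/
noncomputable def chainSum (k : ℕ) : A :=
  ∑ S ∈ powersetCard k (univ : Finset U), if IsUnitChain f S then ∏ v ∈ S, m v else 0

open Classical in
/-- The sum over the pairs of a `j`-element chain and a correct sequence of length `i` that
splits the chain. -/
noncomputable def splitSum (j i : ℕ) : A :=
  ∑ S ∈ powersetCard j (univ : Finset U), (∏ v ∈ S, m v) *
    seqSum f m i (fun w => corInd w * if IsUnitChain f S ∧ Splits f S w then 1 else 0)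

open Classical in
lemma sum_powersetCard_erase (j : ℕ) (g : U → Finset U → A) :
    ∑ S ∈ powersetCard (j + 1) (univ : Finset U), ∑ z ∈ S, g z (S.erase z) =
      ∑ S ∈ powersetCard j (univ : Finset U), ∑ z ∈ Sᶜ, g z S := by
  rw [sum_sigma', sum_sigma']
  refine sum_bij' (fun x _ => ⟨x.1.erase x.2, x.2⟩) (fun x _ => ⟨insert x.2 x.1, x.2⟩) ?_ ?_ ?_ ?_ ?_
  · rintro ⟨S, z⟩ h
    simp only [mem_sigma, mem_powersetCard_univ, mem_compl] at h ⊢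
    exact ⟨by rw [card_erase_of_mem h.2, h.1]; rfl, notMem_erase z S⟩
  · rintro ⟨S, z⟩ h
    simp only [mem_sigma, mem_powersetCard_univ, mem_compl] at h ⊢
    exact ⟨by rw [card_insert_of_notMem h.2, h.1], mem_insert_self z S⟩
  · rintro ⟨S, z⟩ h
    simp only [mem_sigma] at h
    simp [insert_erase h.2]
  · rintro ⟨S, z⟩ h
    simp only [mem_sigma, mem_compl] at h
    simp [erase_insert h.2]
  · rintro ⟨S, z⟩ h
    rfl

/-- Summing `chain_indicator` over all pairs: the chain either splits the sequence or gives up one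
element to it. -/
lemma chainSum_mul_corSum (j i : ℕ) : chainSum f m (j + 1) * corSum f m (i + 1) =
    splitSum f m (j + 1) (i + 1) + splitSum f m j (i + 2) := by
  classical
  have h1 : splitSum f m j (i + 2) = ∑ S ∈ powersetCard j (univ : Finset U), ∑ z ∈ Sᶜ,
      (∏ v ∈ S, m v) * m z * seqSum f m (i + 1) (fun w => corInd w * (snocOK (f z) w *
        if IsUnitChain f S ∧ Splits f S (f z :: w) then 1 else 0)) := by
    rw [splitSum]
    refine sum_congr rfl fun S _ => ?_
    -- A last entry `z` taken from `S` contributes nothing, as `z` is neither below itself nor above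
    -- an entry equal to it.
    rw [seqSum_corInd_snoc, mul_sum, ← sum_subset (subset_univ Sᶜ)]
    · exact sum_congr rfl fun z _ => (mul_assoc _ _ _).symm
    · intro z _ hz
      rw [mem_compl, not_not] at hz
      rw [seqSum_corInd_eq_zero, mul_zero, mul_zero]
      intro w hw hc
      rw [if_neg, mul_zero]
      rintro ⟨-, h⟩
      match w, hw with
      | y :: r, _ =>
        rcases h z hz with h | h
        · rw [List.headI] at h
          linarith
        · rw [listMax_cons] at h
          linarith [le_max_left (f z) (listMax (y :: r))]
  rw [h1, ← sum_powersetCard_erase j (fun z S => (∏ v ∈ S, m v) * m z *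
    seqSum f m (i + 1) (fun w => corInd w * (snocOK (f z) w *
        if IsUnitChain f S ∧ Splits f S (f z :: w) then 1 else 0))), chainSum, splitSum,
    ← sum_add_distrib, sum_mul]
  refine sum_congr rfl fun S _ => ?_
  have h2 : (if IsUnitChain f S then ∏ v ∈ S, m v else 0) * corSum f m (i + 1) =
      (∏ v ∈ S, m v) * seqSum f m (i + 1)
        (fun w => (if IsUnitChain f S then 1 else 0) * corInd w) := by
    rw [seqSum_const_mul, corSum]
    split_ifs <;> simp
  rw [h2, sum_congr rfl fun z hz => by rw [prod_erase_mul S m hz], ← mul_sum, ← mul_add, ← seqSum_sum,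
    ← seqSum_add]
  congr 1
  refine seqSum_congr f m fun w hw => ?_
  match w, hw with
  | y :: r, _ =>
    rw [chain_indicator f (y := y) (r := r) S, ← mul_sum, ← mul_add, mul_comm]

lemma chainSum_zero : chainSum f m 0 = 1 := by
  classical
  simp [chainSum, IsUnitChain]

lemma splitSum_zero (i : ℕ) : splitSum f m 0 i = corSum f m i := by
  classical
  simp [splitSum, IsUnitChain, Splits, corSum]

/-- A single entry is split by `S` precisely when it extends `S` to a larger chain, and each chain
with `j + 1` elements arises once for each of its elements. -/
lemma splitSum_one (j : ℕ) : splitSum f m j 1 = (j + 1 : ℕ) * chainSum f m (j + 1) := by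
  classical
  have h1 : splitSum f m j 1 = ∑ S ∈ powersetCard j (univ : Finset U), ∑ z ∈ Sᶜ,
      if IsUnitChain f (insert z S) then (∏ v ∈ S, m v) * m z else 0 := by
    rw [splitSum]
    refine sum_congr rfl fun S _ => ?_
    simp only [seqSum_succ, seqSum_zero, mul_sum]
    rw [← sum_subset (subset_univ Sᶜ)]
    · refine sum_congr rfl fun z hz => ?_
      rw [mem_compl] at hz
      have : (IsUnitChain f S ∧ Splits f S [f z]) ↔ IsUnitChain f (insert z S) := by
        constructor
        · rintro ⟨h1, h2⟩ u hu v hv hne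
          rw [mem_insert] at hu hv
          rcases hu with rfl | hu <;> rcases hv with rfl | hv
          · exact absurd rfl hne
          · exact (h2 v hv).symm
          · exact h2 u hu
          · exact h1 u hu v hv hne
        · intro h
          exact ⟨fun u hu v hv => h u (mem_insert_of_mem hu) v (mem_insert_of_mem hv),
            fun v hv => h v (mem_insert_of_mem hv) z (mem_insert_self z S)
              (fun h => hz (h ▸ hv))⟩
      simp only [this, corInd]
      split_ifs <;> simp [mul_comm]
    · intro z _ hz
      rw [mem_compl, not_not] at hz
      rw [if_neg]
      · simp
      rintro ⟨-, h⟩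
      rcases h z hz with h | h
      · rw [List.headI] at h
        linarith
      · rw [listMax] at h
        linarith
  rw [h1, ← sum_powersetCard_erase j (fun z S =>
    if IsUnitChain f (insert z S) then (∏ v ∈ S, m v) * m z else 0), chainSum, mul_sum]
  refine sum_congr rfl fun S hS => ?_
  rw [sum_congr rfl fun z hz => by rw [prod_erase_mul S m hz, insert_erase hz], sum_const,
    (mem_powersetCard.mp hS).2, nsmul_eq_mul]

/-- The Newton identities for chains and correct sequences. -/
lemma sum_chainSum_mul_corSum (n : ℕ) :
    ∑ t ∈ range (n + 1), (-1) ^ t * (chainSum f m (n - t) * corSum f m (t + 1)) =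
      (n + 1 : ℕ) * chainSum f m (n + 1) := by
  -- Consecutive products share a `splitSum` term, so the alternating sum telescopes; the starting
  -- length `i` must vary in the induction.
  have key : ∀ n i, ∑ t ∈ range (n + 1), (-1) ^ t *
      (chainSum f m (n - t) * corSum f m (i + t + 1)) = splitSum f m n (i + 1) := by
    intro n
    induction n with
    | zero => intro i; simp [chainSum_zero, splitSum_zero]
    | succ n ih =>
      intro i
      rw [sum_range_succ', Nat.sub_zero, add_zero, chainSum_mul_corSum, ← ih (i + 1), pow_zero,
        one_mul, add_comm, add_assoc, ← sum_add_distrib, sum_eq_zero, add_zero]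
      intro t _
      rw [show n + 1 - (t + 1) = n - t by omega, show i + (t + 1) + 1 = i + 1 + t + 1 by ring]
      ring
  rw [← splitSum_one, ← key n 0]
  simp only [zero_add]

end Newton

/-! ### Power sums and the functions `m_{l,2,1}` in finitely many variables. -/

section SymmetricFunctions

/-- A monomial of degree `N` involves at most `N` variables, which symmetry moves into the first
`N`. -/
lemma symFunc_eq_zero {g : MvPowerSeries ℕ ℤ} (hg : g ∈ SymFunc)
    (h : ∀ N, MvPowerSeries.killCompl (Fin.valEmbedding : Fin N ↪ ℕ) g = 0) : g = 0 := by
  ext d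
  have := truncSeries_eq_zero hg (h d.degree)
  have h1 := truncSeries_apply d.degree g d
  rw [this, if_pos le_rfl] at h1
  exact h1.symm

/-- Restriction of a symmetric function to finitely many variables. -/
noncomputable def restrictVars (N : ℕ) : SymFunc →ₐ[ℤ] MvPowerSeries (Fin N) ℤ :=
  (MvPowerSeries.killCompl (Fin.valEmbedding : Fin N ↪ ℕ)).comp SymFunc.val

lemma symFunc_ext {g g' : SymFunc} (h : ∀ N, restrictVars N g = restrictVars N g') : g = g' := by
  rw [← sub_eq_zero]
  refine Subtype.ext (symFunc_eq_zero (g - g').2 fun N => ?_)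
  change restrictVars N (g - g') = 0
  rw [map_sub, h, sub_self]

lemma support_map_embDomain {α : Type*} (e : α ↪ ℕ) (d : α →₀ ℕ) :
    (d.embDomain e).support.val.map (d.embDomain e) = d.support.val.map d := by
  rw [Finsupp.support_embDomain, Finset.map_val, Multiset.map_map]
  exact Multiset.map_congr rfl fun x _ => Finsupp.embDomain_apply_self _ _ _

lemma restrictVars_elemSym (N k : ℕ) :
    restrictVars N (elemSym k) = coeToMvPowerSeries.ringHom (esymm (Fin N) ℤ k) :=
  killCompl_elemSeries N k

lemma coeff_restrictVars_monoSym (N : ℕ) (μ : Multiset ℕ) (d : Fin N →₀ ℕ) :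
    MvPowerSeries.coeff d (restrictVars N (monoSym μ)) =
      if d.support.val.map d = μ then 1 else 0 := by
  change MvPowerSeries.coeff d
    (MvPowerSeries.killCompl (Fin.valEmbedding : Fin N ↪ ℕ) (monoSeries μ)) = _
  rw [MvPowerSeries.coeff_killCompl, coeff_monoSeries, support_map_embDomain]

lemma restrictVars_powerSum (N k : ℕ) (hk : k ≠ 0) :
    restrictVars N (monoSym {k}) = coeToMvPowerSeries.ringHom (psum (Fin N) ℤ k) := by
  classical
  ext d
  rw [coeff_restrictVars_monoSym, coeToMvPowerSeries.ringHom_apply, MvPolynomial.coeff_coe, psum, coeff_sum]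
  simp only [coeff_X_pow]
  split_ifs with h
  · obtain ⟨i, hi⟩ : ∃ i, d.support = {i} := by
      rw [← Finset.card_eq_one, ← Multiset.card_singleton k, ← h, Multiset.card_map]
      rfl
    rw [hi] at h
    have h' : d i = k := by simpa using h
    have hd : d = Finsupp.single i k := by
      rw [← h']
      exact (Finsupp.support_subset_singleton.mp hi.le)
    rw [Finset.sum_eq_single i]
    · rw [hd, if_pos rfl]
    · intro j _ hj
      rw [if_neg]
      rw [hd]
      intro he
      exact hj (Finsupp.single_left_injective hk he)
    · simp
  · refine (Finset.sum_eq_zero fun i _ => if_neg ?_).symm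
    rintro rfl
    rw [Finsupp.support_single i hk] at h
    simp at h

lemma elemSym_zero : elemSym 0 = 1 := by
  refine symFunc_ext fun N => ?_
  rw [restrictVars_elemSym, esymm_zero, map_one, map_one]

/-- Newton's identities. -/
lemma sum_elemSym_mul_powerSum (n : ℕ) :
    ∑ t ∈ Finset.range (n + 1), (-1) ^ t * (elemSym (n - t) * monoSym {t + 1}) =
      (n + 1 : ℕ) * elemSym (n + 1) := by
  refine symFunc_ext fun N => ?_
  have h1 : ((n + 1 : ℕ) * esymm (Fin N) ℤ (n + 1)) =
      ∑ t ∈ Finset.range (n + 1), (-1) ^ t * (esymm (Fin N) ℤ (n - t) * psum (Fin N) ℤ (t + 1)) := by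
    rw [mul_esymm_eq_sum, Finset.sum_filter, Finset.Nat.sum_antidiagonal_eq_sum_range_succ_mk,
      Finset.sum_range_succ, if_neg (lt_irrefl _), add_zero, ← Finset.sum_range_reflect,
      Finset.mul_sum]
    refine Finset.sum_congr rfl fun t ht => ?_
    rw [Finset.mem_range] at ht
    dsimp only
    rw [if_pos (by omega), show n + 1 - 1 - t = n - t by omega, show n + 1 - (n - t) = t + 1 by omega,
      ← mul_assoc, ← mul_assoc, ← mul_assoc, ← pow_add]
    congr 2
    rw [show n + 1 + 1 + (n - t) = t + 2 * (n + 1 - t) by omega, pow_add, pow_mul]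
    simp
  have h2 := congrArg (coeToMvPowerSeries.ringHom (σ := Fin N) (R := ℤ)) h1
  simp only [map_sum, map_mul, map_pow, map_neg, map_one, map_natCast] at h2
  simp only [map_sum, map_mul, map_pow, map_neg, map_one, map_natCast, restrictVars_elemSym, h2]
  exact Finset.sum_congr rfl fun t _ => by rw [restrictVars_powerSum N _ t.succ_ne_zero]

/-- The augmented monomial symmetric polynomial with exponents `l, 2, 1`. -/
noncomputable def augMono (N l : ℕ) : MvPolynomial (Fin N) ℤ :=
  ∑ i, ∑ j ∈ Finset.univ.erase i, ∑ k ∈ (Finset.univ.erase i).erase j,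
    X i ^ l * (X j ^ 2 * X k)

/-- Inclusion-exclusion over coincidences among the three indices; the coefficient `2` belongs to
all three being equal. -/
lemma augMono_eq (N l : ℕ) : augMono N l =
    psum (Fin N) ℤ l * psum (Fin N) ℤ 2 * psum (Fin N) ℤ 1 - psum (Fin N) ℤ (l + 2) * psum (Fin N) ℤ 1
      - psum (Fin N) ℤ (l + 1) * psum (Fin N) ℤ 2 - psum (Fin N) ℤ l * psum (Fin N) ℤ 3
      + 2 * psum (Fin N) ℤ (l + 3) := by
  have h1 : ∀ i : Fin N, ∀ j ∈ Finset.univ.erase i, ∑ k ∈ (Finset.univ.erase i).erase j,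
      (X i ^ l * (X j ^ 2 * X k) : MvPolynomial (Fin N) ℤ) =
      X i ^ l * (X j ^ 2 * (psum (Fin N) ℤ 1 - X i) - X j ^ 3) := by
    intro i j hj
    rw [← Finset.mul_sum, ← Finset.mul_sum, Finset.sum_erase_eq_sub hj,
      Finset.sum_erase_eq_sub (Finset.mem_univ i), psum_one]
    ring
  have h2 : ∀ i : Fin N, ∑ j ∈ Finset.univ.erase i, ∑ k ∈ (Finset.univ.erase i).erase j,
      (X i ^ l * (X j ^ 2 * X k) : MvPolynomial (Fin N) ℤ) =
      X i ^ l * (psum (Fin N) ℤ 2 * psum (Fin N) ℤ 1 - psum (Fin N) ℤ 3)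
        - X i ^ (l + 1) * psum (Fin N) ℤ 2 - X i ^ (l + 2) * psum (Fin N) ℤ 1 +
        2 * X i ^ (l + 3) := by
    intro i
    rw [Finset.sum_congr rfl (h1 i), Finset.sum_erase_eq_sub (Finset.mem_univ i), ← Finset.mul_sum,
      Finset.sum_sub_distrib, ← Finset.sum_mul, psum, psum, psum]
    ring
  rw [augMono, Finset.sum_congr rfl fun i _ => h2 i, Finset.sum_add_distrib, Finset.sum_sub_distrib,
    Finset.sum_sub_distrib, ← Finset.sum_mul, ← Finset.sum_mul, ← Finset.sum_mul, ← Finset.mul_sum]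
  change psum (Fin N) ℤ l * _ - psum (Fin N) ℤ (l + 1) * _ - psum (Fin N) ℤ (l + 2) * _ +
    2 * psum (Fin N) ℤ (l + 3) = _
  ring

/-- The exponent of `X i ^ l * X j ^ 2 * X k`. -/
noncomputable def tripleExp {α : Type*} (l : ℕ) (i j k : α) : α →₀ ℕ :=
  Finsupp.single i l + (Finsupp.single j 2 + Finsupp.single k 1)

lemma exists_tripleExp_iff {α : Type*} {l : ℕ} (hl : l ≠ 0) (d : α →₀ ℕ) :
    d.support.val.map d = {l, 2, 1} ↔
      ∃ i j k, j ≠ i ∧ k ≠ i ∧ k ≠ j ∧ tripleExp l i j k = d := by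
  classical
  constructor
  · intro h
    obtain ⟨i, hi, hil, h⟩ := (Multiset.map_eq_cons _ _ _ _).mpr h
    obtain ⟨j, hj, hj2, h⟩ := (Multiset.map_eq_cons _ _ _ _).mpr h
    obtain ⟨k, hk, hk1⟩ := Multiset.map_eq_singleton.mp h
    have hv : d.support.val = i ::ₘ j ::ₘ {k} := by
      rw [← hk, Multiset.cons_erase hj, Multiset.cons_erase hi]
    have hn := d.support.nodup
    rw [hv] at hn
    simp only [Multiset.nodup_cons, Multiset.mem_cons, Multiset.mem_singleton, not_or] at hn
    refine ⟨i, j, k, Ne.symm hn.1.1, Ne.symm hn.1.2, Ne.symm hn.2.1, ?_⟩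
    ext x
    have hx : d x ≠ 0 ↔ x = i ∨ x = j ∨ x = k := by
      rw [← Finsupp.mem_support_iff, ← Finset.mem_val, hv]
      simp
    simp only [tripleExp, Finsupp.add_apply, Finsupp.single_apply]
    grind
  · rintro ⟨i, j, k, h1, h2, h3, rfl⟩
    have hs : (tripleExp l i j k).support = {i, j, k} := by
      ext x
      simp only [tripleExp, Finsupp.mem_support_iff, Finsupp.add_apply, Finsupp.single_apply,
        Finset.mem_insert, Finset.mem_singleton]
      grind
    rw [hs, Finset.insert_val_of_notMem (by grind), Finset.insert_val_of_notMem (by grind)]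
    simp [tripleExp, Finsupp.single_apply, h3, h1.symm, h2.symm, h3.symm]

lemma coeff_augMono (N l : ℕ) (d : Fin N →₀ ℕ) : coeff d (augMono N l) =
    ∑ i, ∑ j ∈ Finset.univ.erase i, ∑ k ∈ (Finset.univ.erase i).erase j,
      if tripleExp l i j k = d then 1 else 0 := by
  classical
  simp only [augMono, coeff_sum]
  refine Finset.sum_congr rfl fun i _ => Finset.sum_congr rfl fun j _ =>
    Finset.sum_congr rfl fun k _ => ?_
  rw [X_pow_eq_monomial, X_pow_eq_monomial, X, monomial_mul, monomial_mul, coeff_monomial, one_mul,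
    one_mul, tripleExp]

/-- The exponents `l, 2, 1` are distinct, so a monomial determines its ordered triple of indices. -/
lemma restrictVars_monoSym (N l : ℕ) (hl : 3 ≤ l) :
    restrictVars N (monoSym {l, 2, 1}) = coeToMvPowerSeries.ringHom (augMono N l) := by
  ext d
  rw [coeff_restrictVars_monoSym, coeToMvPowerSeries.ringHom_apply, MvPolynomial.coeff_coe,
    coeff_augMono]
  simp only [exists_tripleExp_iff (show l ≠ 0 by omega)]
  split_ifs with h
  · obtain ⟨i, j, k, h1, h2, h3, rfl⟩ := h
    have key : ∀ i' j' k', tripleExp l i' j' k' = tripleExp l i j k →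
        j' ≠ i' → k' ≠ i' → k' ≠ j' → i' = i ∧ j' = j ∧ k' = k := by
      intro i' j' k' h h1' h2' h3'
      have e1 := DFunLike.congr_fun h i
      have e2 := DFunLike.congr_fun h j
      have e3 := DFunLike.congr_fun h k
      simp only [tripleExp, Finsupp.add_apply, Finsupp.single_apply] at e1 e2 e3
      grind
    rw [Finset.sum_eq_single_of_mem i (Finset.mem_univ i), Finset.sum_eq_single_of_mem j (by simpa),
      Finset.sum_eq_single_of_mem k (by simp [h2, h3]), if_pos rfl]
    · intro k' hk' hne
      simp only [Finset.mem_erase] at hk'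
      exact if_neg fun h => hne (key i j k' h h1 hk'.2.1 hk'.1).2.2
    · intro j' hj' hne
      refine Finset.sum_eq_zero fun k' hk' => ?_
      simp only [Finset.mem_erase] at hk' hj'
      exact if_neg fun h => hne (key i j' k' h hj'.1 hk'.2.1 hk'.1).2.1
    · intro i' _ hne
      refine Finset.sum_eq_zero fun j' hj' => Finset.sum_eq_zero fun k' hk' => ?_
      simp only [Finset.mem_erase] at hk' hj'
      exact if_neg fun h => hne (key i' j' k' h hj'.1 hk'.2.1 hk'.1).1
  · refine (Finset.sum_eq_zero fun i _ => Finset.sum_eq_zero fun j hj =>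
      Finset.sum_eq_zero fun k hk => if_neg fun e => h ?_).symm
    simp only [Finset.mem_erase] at hj hk
    exact ⟨i, j, k, hj.1, hk.2.1, hk.1, e⟩

/-- With two equal exponents each monomial comes from exactly two ordered triples. This is the
source of the factor `2` in part (b). -/
lemma restrictVars_monoSym_two (N : ℕ) :
    2 * restrictVars N (monoSym {2, 2, 1}) = coeToMvPowerSeries.ringHom (augMono N 2) := by
  ext d
  rw [two_mul, map_add, coeff_restrictVars_monoSym, coeToMvPowerSeries.ringHom_apply,
    MvPolynomial.coeff_coe, coeff_augMono]
  simp only [exists_tripleExp_iff (show 2 ≠ 0 by omega)]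
  split_ifs with h
  · obtain ⟨i, j, k, h1, h2, h3, rfl⟩ := h
    have key : ∀ i' j' k', tripleExp 2 i' j' k' = tripleExp 2 i j k →
        j' ≠ i' → k' ≠ i' → k' ≠ j' → (i' = i ∧ j' = j ∧ k' = k) ∨ (i' = j ∧ j' = i ∧ k' = k) := by
      intro i' j' k' h h1' h2' h3'
      have e1 := DFunLike.congr_fun h i
      have e2 := DFunLike.congr_fun h j
      have e3 := DFunLike.congr_fun h k
      simp only [tripleExp, Finsupp.add_apply, Finsupp.single_apply] at e1 e2 e3
      grind
    have inner : ∀ i j k : Fin N, j ≠ i → k ≠ i → k ≠ j → (∀ i' j' k',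
        tripleExp 2 i' j' k' = tripleExp 2 i j k →
        j' ≠ i' → k' ≠ i' → k' ≠ j' → (i' = i ∧ j' = j ∧ k' = k) ∨ (i' = j ∧ j' = i ∧ k' = k)) →
        ∑ j' ∈ Finset.univ.erase i, ∑ k' ∈ (Finset.univ.erase i).erase j',
          (if tripleExp 2 i j' k' = tripleExp 2 i j k then 1 else 0 : ℤ) = 1 := by
      intro i j k h1 h2 h3 key
      rw [Finset.sum_eq_single_of_mem j (by simpa),
        Finset.sum_eq_single_of_mem k (by simp [h2, h3]), if_pos rfl]
      · intro k' hk' hne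
        simp only [Finset.mem_erase] at hk'
        exact if_neg fun h => by
          have := key i j k' h h1 hk'.2.1 hk'.1
          grind
      · intro j' hj' hne
        refine Finset.sum_eq_zero fun k' hk' => ?_
        simp only [Finset.mem_erase] at hk' hj'
        exact if_neg fun h => by
          have := key i j' k' h hj'.1 hk'.2.1 hk'.1
          grind
    have hswap : tripleExp 2 i j k = tripleExp 2 j i k := add_left_comm _ _ _
    rw [Finset.sum_eq_add i j h1.symm, inner i j k h1 h2 h3 key, hswap, inner j i k h1.symm h3 h2]
    · intro i' j' k' h h1' h2' h3'
      exact (key i' j' k' (h.trans hswap.symm) h1' h2' h3').symm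
    · intro i' _ hne
      refine Finset.sum_eq_zero fun j' hj' => Finset.sum_eq_zero fun k' hk' => ?_
      simp only [Finset.mem_erase] at hk' hj'
      exact if_neg fun h => by
        have := key i' j' k' h hj'.1 hk'.2.1 hk'.1
        grind
    · simp
    · simp
  · rw [add_zero]
    refine (Finset.sum_eq_zero fun i _ => Finset.sum_eq_zero fun j hj =>
      Finset.sum_eq_zero fun k hk => if_neg fun e => h ?_).symm
    simp only [Finset.mem_erase] at hj hk
    exact ⟨i, j, k, hj.1, hk.2.1, hk.1, e⟩

lemma coe_psum_combination (N l : ℕ) (hl : l ≠ 0) : coeToMvPowerSeries.ringHom (augMono N l) =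
    restrictVars N (monoSym {l} * monoSym {2} * monoSym {1} - monoSym {l + 2} * monoSym {1}
      - monoSym {l + 1} * monoSym {2} - monoSym {l} * monoSym {3} + 2 * monoSym {l + 3}) := by
  simp only [augMono_eq, map_add, map_sub, map_mul, map_ofNat]
  rw [restrictVars_powerSum N l hl, restrictVars_powerSum N 2 two_ne_zero,
    restrictVars_powerSum N 1 one_ne_zero, restrictVars_powerSum N (l + 2) (by omega),
    restrictVars_powerSum N (l + 1) (by omega), restrictVars_powerSum N 3 (by omega),
    restrictVars_powerSum N (l + 3) (by omega)]

lemma monoSym_eq_powerSum (l : ℕ) (hl : 3 ≤ l) : monoSym {l, 2, 1} =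
    monoSym {l} * monoSym {2} * monoSym {1} - monoSym {l + 2} * monoSym {1}
      - monoSym {l + 1} * monoSym {2} - monoSym {l} * monoSym {3} + 2 * monoSym {l + 3} :=
  symFunc_ext fun N => by
    rw [restrictVars_monoSym N l hl, coe_psum_combination N l (by omega)]

lemma two_mul_monoSym_eq_powerSum : 2 * monoSym {2, 2, 1} =
    monoSym {2} * monoSym {2} * monoSym {1} - monoSym {2 + 2} * monoSym {1}
      - monoSym {2 + 1} * monoSym {2} - monoSym {2} * monoSym {3} + 2 * monoSym {2 + 3} :=
  symFunc_ext fun N => by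
    rw [map_mul, map_ofNat, restrictVars_monoSym_two N, coe_psum_combination N 2 two_ne_zero]

end SymmetricFunctions

/-! ### Images of the power sums under the `G`-homomorphism. -/

section PowerSums

variable {U : Type*} [PartialOrder U] {f : U → ℝ}

lemma isIndepSet_iff_isUnitChain (hf : ∀ u w : U, w < u ↔ f w + 1 ≤ f u) (S : Finset U) :
    (incGraph U).IsIndepSet (S : Set U) ↔ IsUnitChain f S := by
  constructor
  · intro h u hu v hv hne
    rw [← hf, ← hf]
    by_contra hc
    refine h hu hv hne ⟨hne, fun h1 => hc (Or.inl (lt_of_le_of_ne h1 hne)), fun h1 =>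
      hc (Or.inr (lt_of_le_of_ne h1 hne.symm))⟩
  · intro h u hu v hv hne hadj
    have := h u hu v hv hne
    rw [← hf, ← hf] at this
    rcases this with h1 | h1
    · exact hadj.2.1 h1.le
    · exact hadj.2.2 h1.le

variable [Fintype U]

lemma elemG_eq_chainSum (hf : ∀ u w : U, w < u ↔ f w + 1 ≤ f u) (k : ℕ) :
    elemG (incGraph U) k = chainSum f (fun u => (X u : MvPolynomial U ℤ)) k := by
  classical
  rw [elemG, chainSum, ← Finset.sum_filter]
  refine Finset.sum_congr ?_ fun _ _ => rfl
  ext S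
  simp [isIndepSet_iff_isUnitChain hf, Finset.mem_powersetCard]

/-- The image of the power sum `p_k` is the sum of the monomials of the correct sequences. -/
lemma gHom_powerSum (hf : ∀ u w : U, w < u ↔ f w + 1 ≤ f u) (k : ℕ) (hk : k ≠ 0) :
    gHom (incGraph U) (monoSym {k}) = corSum f (fun u => (X u : MvPolynomial U ℤ)) k := by
  have he : ∀ j, gHom (incGraph U) (elemSym j) = chainSum f (fun u => (X u : MvPolynomial U ℤ)) j := by
    intro j
    rcases Nat.eq_zero_or_pos j with rfl | hj
    · rw [elemSym_zero, map_one, chainSum_zero]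
    · rw [gHom_elemSym _ _ hj, elemG_eq_chainSum hf]
  induction k using Nat.strong_induction_on with
  | _ k ih =>
    obtain ⟨n, rfl⟩ := Nat.exists_eq_succ_of_ne_zero hk
    -- Both families satisfy Newton's identities with the same elementary terms. In the term `t = n`
    -- the unknown has coefficient `±1`, so the earlier values determine it.
    have h1 := congrArg (gHom (incGraph U)) (sum_elemSym_mul_powerSum n)
    simp only [map_sum, map_mul, map_pow, map_neg, map_one, map_natCast, he] at h1
    rw [← sum_chainSum_mul_corSum, Finset.sum_range_succ, Finset.sum_range_succ,
      Finset.sum_congr rfl fun t ht => by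
        rw [ih (t + 1) (by have := Finset.mem_range.mp ht; omega) (by omega)]] at h1
    have h2 := add_left_cancel h1
    rw [Nat.sub_self, chainSum_zero, one_mul, one_mul] at h2
    have h3 := congrArg (fun x => (-1 : MvPolynomial U ℤ) ^ n * x) h2
    simpa [← mul_assoc, ← mul_pow] using h3

end PowerSums

/-! ### Expansion of homogeneous symmetric functions in the `m_μ`. -/

section Coefficients

/-- Equidistributed exponents differ by a permutation of the variables. -/
lemma exists_perm_embDomain {d d' : ℕ →₀ ℕ} (h : d.support.val.map d = d'.support.val.map d') :
    ∃ σ : Equiv.Perm ℕ, d.embDomain σ.toEmbedding = d' := by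
  classical
  -- The permutation is glued from bijections between fibres: both fibres over `0` are countably
  -- infinite, and those over a positive value have equal finite size by hypothesis.
  have key : ∀ c, Nonempty ({x // d x = c} ≃ {x // d' x = c}) := by
    intro c
    rcases Nat.eq_zero_or_pos c with rfl | hc
    · have inf : ∀ d : ℕ →₀ ℕ, Infinite {x // d x = 0} := by
        intro d
        have h1 : {x | d x = 0} = (d.support : Set ℕ)ᶜ := by ext; simp
        have h2 : {x | d x = 0}.Infinite := h1 ▸ d.support.finite_toSet.infinite_compl
        exact Set.infinite_coe_iff.mpr h2
      have := inf d
      have := inf d'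
      obtain ⟨i1⟩ := nonempty_denumerable {x // d x = 0}
      obtain ⟨i2⟩ := nonempty_denumerable {x // d' x = 0}
      exact ⟨Denumerable.equiv₂ _ _⟩
    · have cnt : ∀ d : ℕ →₀ ℕ, ∃ s : Finset ℕ, (∀ x, x ∈ s ↔ d x = c) ∧
          s.card = (d.support.val.map d).count c := by
        intro d
        refine ⟨d.support.filter fun x => c = d x, fun x => ?_, ?_⟩
        · simp only [Finset.mem_filter, Finsupp.mem_support_iff]
          omega
        · rw [Multiset.count_map]
          rfl
      obtain ⟨s, hs, hs'⟩ := cnt d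
      obtain ⟨t, ht, ht'⟩ := cnt d'
      rw [h, ← ht'] at hs'
      exact ⟨((Equiv.subtypeEquivRight hs).symm.trans (Finset.equivOfCardEq hs')).trans
        (Equiv.subtypeEquivRight ht)⟩
  refine ⟨Equiv.ofFiberEquiv fun c => (key c).some, ?_⟩
  ext x
  obtain ⟨y, rfl⟩ := (Equiv.ofFiberEquiv fun c => (key c).some).surjective x
  refine (Finsupp.embDomain_apply_self _ d y).trans ?_
  exact (Equiv.ofFiberEquiv_map (fun c => (key c).some) y).symm

lemma coeff_eq_of_map_eq {g : MvPowerSeries ℕ ℤ} (hg : g ∈ SymFunc) {d d' : ℕ →₀ ℕ}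
    (h : d.support.val.map d = d'.support.val.map d') :
    MvPowerSeries.coeff d g = MvPowerSeries.coeff d' g := by
  obtain ⟨σ, rfl⟩ := exists_perm_embDomain h
  rw [← coeff_renameEquiv_perm σ, hg.1 σ]

/-- The partition of the nonzero exponents of a monomial. -/
def expPartition (d : ℕ →₀ ℕ) : d.degree.Partition where
  parts := d.support.val.map d
  parts_pos := by
    intro i hi
    obtain ⟨j, hj, rfl⟩ := Multiset.mem_map.mp hi
    exact Nat.pos_of_ne_zero (Finsupp.mem_support_iff.mp hj)
  parts_sum := rfl

lemma exists_map_support_eq (s : Multiset ℕ) (hs : ∀ k ∈ s, 0 < k) :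
    ∃ d : ℕ →₀ ℕ, d.support.val.map d = s := by
  classical
  induction s using Multiset.induction_on with
  | empty => exact ⟨0, by simp⟩
  | cons a s ih =>
    obtain ⟨d, hd⟩ := ih fun k hk => hs k (Multiset.mem_cons_of_mem hk)
    obtain ⟨j, hj⟩ := Infinite.exists_notMem_finset d.support
    have ha : a ≠ 0 := (hs a (Multiset.mem_cons_self a s)).ne'
    have hj' : d j = 0 := Finsupp.notMem_support_iff.mp hj
    have hsup : (d + Finsupp.single j a).support = insert j d.support := by
      ext x
      simp only [Finsupp.mem_support_iff, Finsupp.add_apply, Finsupp.single_apply,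
        Finset.mem_insert]
      grind
    refine ⟨d + Finsupp.single j a, ?_⟩
    rw [hsup, Finset.insert_val_of_notMem hj, Multiset.map_cons, ← hd]
    congr 1
    · simp [hj']
    · refine Multiset.map_congr rfl fun x hx => ?_
      have : j ≠ x := fun h => hj (h ▸ hx)
      simp [this]

/-- A monomial whose exponents are the parts of a given partition. -/
noncomputable def repExp {n : ℕ} (μ : n.Partition) : ℕ →₀ ℕ :=
  (exists_map_support_eq μ.parts fun _ hk => μ.parts_pos hk).choose

lemma repExp_spec {n : ℕ} (μ : n.Partition) :
    (repExp μ).support.val.map (repExp μ) = μ.parts :=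
  (exists_map_support_eq μ.parts fun _ hk => μ.parts_pos hk).choose_spec

lemma degree_eq_of_map_eq {n : ℕ} {μ : n.Partition} {d : ℕ →₀ ℕ}
    (h : d.support.val.map d = μ.parts) : d.degree = n := by
  have := μ.parts_sum
  rw [← h] at this
  exact this

lemma degree_repExp {n : ℕ} (μ : n.Partition) : (repExp μ).degree = n :=
  degree_eq_of_map_eq (repExp_spec μ)

/-- The expansion of a homogeneous symmetric function in monomial symmetric functions. -/
lemma eq_sum_monoSym {n : ℕ} (g : SymFunc) (hg : HomogSeries n g) :
    g = ∑ μ : n.Partition, MvPowerSeries.coeff (repExp μ) (g : MvPowerSeries ℕ ℤ) •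
      monoSym μ.parts := by
  classical
  refine Subtype.ext ?_
  ext d
  have h1 : MvPowerSeries.coeff d ((∑ μ : n.Partition, MvPowerSeries.coeff (repExp μ)
      (g : MvPowerSeries ℕ ℤ) • monoSym μ.parts : SymFunc) : MvPowerSeries ℕ ℤ) =
      ∑ μ : n.Partition, MvPowerSeries.coeff (repExp μ) (g : MvPowerSeries ℕ ℤ) *
        (if d.support.val.map d = μ.parts then 1 else 0) := by
    rw [AddSubmonoidClass.coe_finsetSum, map_sum]
    refine Finset.sum_congr rfl fun μ _ => ?_
    rw [← coeff_monoSeries]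
    exact map_zsmul _ _ _
  rw [h1]
  by_cases hd : d.degree = n
  · subst hd
    rw [Finset.sum_eq_single (expPartition d), if_pos (by rfl), mul_one]
    · exact coeff_eq_of_map_eq g.2 (repExp_spec (expPartition d)).symm
    · intro μ _ hne
      rw [if_neg, mul_zero]
      exact fun h => hne (Nat.Partition.ext h.symm)
    · simp
  · rw [Finset.sum_eq_zero]
    · by_contra h
      exact hd (hg d h)
    · intro μ _
      rw [if_neg, mul_zero]
      exact fun h => hd (degree_eq_of_map_eq h)

end Coefficients

/-! ### Products of elementary functions and families of sets. -/

section Counting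

open Finset

/-- The number of families of sets of prescribed kinds covering each vertex a prescribed number
of times. -/
lemma coeff_prod_sum_prod {V ι : Type*} [Fintype V] [Fintype ι] [DecidableEq V] [DecidableEq ι]
    (𝒮 : ι → Finset (Finset V))
    (d : V →₀ ℕ) :
    coeff d (∏ j, ∑ S ∈ 𝒮 j, ∏ v ∈ S, (X v : MvPolynomial V ℤ)) =
      ((univ.filter fun A : ι → Finset V => (∀ j, A j ∈ 𝒮 j) ∧
        ∀ v, (univ.filter fun j => v ∈ A j).card = d v).card : ℤ) := by
  have hmon : ∀ A : ι → Finset V, ∏ j, ∏ v ∈ A j, (X v : MvPolynomial V ℤ) =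
      monomial (∑ j, ∑ v ∈ A j, Finsupp.single v 1) 1 := by
    intro A
    rw [monomial_sum_one]
    exact prod_congr rfl fun j _ => by rw [monomial_sum_one]; rfl
  have hval : ∀ A : ι → Finset V, (∑ j, ∑ v ∈ A j, Finsupp.single v 1) = d ↔
      ∀ v, (univ.filter fun j => v ∈ A j).card = d v := by
    intro A
    rw [DFunLike.ext_iff]
    refine forall_congr' fun v => ?_
    have : (∑ j, ∑ v ∈ A j, Finsupp.single v (1 : ℕ)) v = (univ.filter fun j => v ∈ A j).card := by
      rw [card_filter, Finsupp.finsetSum_apply]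
      refine sum_congr rfl fun j _ => ?_
      simp [Finsupp.finsetSum_apply, Finsupp.single_apply]
    rw [this]
  rw [prod_univ_sum, coeff_sum]
  simp only [hmon, coeff_monomial, hval]
  rw [← sum_filter, sum_const, nsmul_eq_mul, mul_one]
  congr 2
  ext A
  simp [Fintype.mem_piFinset]

/-- The product of the elementary symmetric functions of given degrees. -/
noncomputable def elemProd (a : ℕ →₀ ℕ) : SymFunc := a.prod fun _ k => elemSym k

lemma restrictVars_elemProd (N : ℕ) (a : Fin N →₀ ℕ) :
    restrictVars N (elemProd (a.embDomain Fin.valEmbedding)) =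
      coeToMvPowerSeries.ringHom (∏ j, esymm (Fin N) ℤ (a j)) := by
  rw [elemProd, Finsupp.prod_embDomain, Finsupp.prod_fintype _ _ fun _ => elemSym_zero, map_prod,
    map_prod]
  exact prod_congr rfl fun j _ => restrictVars_elemSym N (a j)

lemma exists_embDomain_fin (d : ℕ →₀ ℕ) {N : ℕ} (h : ∀ i ∈ d.support, i < N) :
    ∃ d' : Fin N →₀ ℕ, d'.embDomain Fin.valEmbedding = d := by
  refine ⟨d.comapDomain Fin.val Fin.val_injective.injOn, ?_⟩
  rw [Finsupp.embDomain_eq_mapDomain]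
  exact Finsupp.mapDomain_comapDomain _ Fin.val_injective _ fun i hi => ⟨⟨i, h i hi⟩, rfl⟩

/-- The transition matrix from products of elementary to monomial symmetric functions is
symmetric. -/
lemma coeff_elemProd_symm (a d : ℕ →₀ ℕ) :
    MvPowerSeries.coeff d (elemProd a : MvPowerSeries ℕ ℤ) =
      MvPowerSeries.coeff a (elemProd d : MvPowerSeries ℕ ℤ) := by
  classical
  obtain ⟨N, hN⟩ : ∃ N, ∀ i ∈ a.support ∪ d.support, i < N :=
    ⟨(a.support ∪ d.support).sup id + 1, fun i hi => Nat.lt_succ_of_le (le_sup (f := id) hi)⟩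
  obtain ⟨a, rfl⟩ := exists_embDomain_fin a fun i hi => hN i (mem_union_left _ hi)
  obtain ⟨d, rfl⟩ := exists_embDomain_fin d fun i hi => hN i (mem_union_right _ hi)
  have key : ∀ a d : Fin N →₀ ℕ, MvPowerSeries.coeff (d.embDomain Fin.valEmbedding)
      (elemProd (a.embDomain Fin.valEmbedding) : MvPowerSeries ℕ ℤ) =
      ((univ.filter fun A : Fin N → Finset (Fin N) => (∀ j, A j ∈ powersetCard (a j) univ) ∧
        ∀ v, (univ.filter fun j => v ∈ A j).card = d v).card : ℤ) := by
    intro a d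
    rw [← MvPowerSeries.coeff_killCompl]
    change MvPowerSeries.coeff d (restrictVars N _) = _
    rw [restrictVars_elemProd, coeToMvPowerSeries.ringHom_apply, MvPolynomial.coeff_coe]
    refine (coeff_prod_sum_prod (fun j => powersetCard (a j) univ) d).trans ?_
    congr!
  rw [key, key]
  congr 1
  -- Both sides count 0-1 matrices with prescribed row and column sums; the bijection is
  -- transposition.
  refine card_bij' (fun A _ i => univ.filter fun j => i ∈ A j)
    (fun A _ i => univ.filter fun j => i ∈ A j) ?_ ?_ ?_ ?_
  · intro A hA
    simp only [mem_filter, mem_univ, true_and, mem_powersetCard_univ] at hA ⊢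
    exact ⟨hA.2, by simpa using hA.1⟩
  · intro A hA
    simp only [mem_filter, mem_univ, true_and, mem_powersetCard_univ] at hA ⊢
    exact ⟨hA.2, by simpa using hA.1⟩
  · intro A _
    ext; simp
  · intro A _
    ext; simp

lemma homogSeries_elemProd (a : ℕ →₀ ℕ) : HomogSeries a.degree (elemProd a) := by
  have hone : ∀ k, HomogSeries k (elemSeries k) := by
    classical
    intro k d hd
    rw [coeff_elemSeries] at hd
    by_contra h
    simp [h] at hd
  have : ∀ s : Finset ℕ, HomogSeries (∑ j ∈ s, a j) ((∏ j ∈ s, elemSym (a j) : SymFunc) :) := by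
    intro s
    classical
    induction s using Finset.induction_on with
    | empty =>
      intro d hd
      rw [prod_empty, OneMemClass.coe_one, MvPowerSeries.coeff_one] at hd
      by_contra h
      simp only [sum_empty] at h
      simp [show d ≠ 0 by rintro rfl; simp at h] at hd
    | insert i s hi ih =>
      rw [sum_insert hi, prod_insert hi, MulMemClass.coe_mul]
      exact (hone _).mul ih
  exact this a.support

lemma elemProd_repExp {n : ℕ} (μ : n.Partition) :
    (elemProd (repExp μ) : MvPowerSeries ℕ ℤ) = (μ.parts.map elemSeries).prod := by
  rw [← repExp_spec μ, Multiset.map_map, elemProd, Finsupp.prod]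
  exact map_prod SymFunc.val _ _

end Counting

/-! ### The elementary expansion of the chromatic symmetric function. -/

section Chromatic

open Finset

variable {V : Type*} [Fintype V] (G : SimpleGraph V)

/-- The coefficient of the product of all variables in the image under the `G`-homomorphism. -/
noncomputable def topCoeff : SymFunc →ₗ[ℤ] ℤ :=
  (lcoeff ℤ (Finsupp.equivFunOnFinite.symm fun _ : V => 1)).comp (gHom G).toLinearMap

lemma topCoeff_apply (g : SymFunc) :
    topCoeff G g = coeff (Finsupp.equivFunOnFinite.symm fun _ : V => 1) (gHom G g) := rfl

lemma elemG_zero : elemG G 0 = 1 := by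
  classical
  rw [elemG, sum_eq_single ∅]
  · simp
  · intro S hS hne
    simp only [mem_filter, mem_univ, true_and, card_eq_zero] at hS
    exact absurd hS.1 hne
  · intro h
    simp at h

lemma gHom_elemProd (N : ℕ) (a : Fin N →₀ ℕ) :
    gHom G (elemProd (a.embDomain Fin.valEmbedding)) = ∏ j, elemG G (a j) := by
  rw [elemProd, Finsupp.prod_embDomain, Finsupp.prod_fintype _ _ fun _ => elemSym_zero, map_prod]
  refine prod_congr rfl fun j _ => ?_
  rcases Nat.eq_zero_or_pos (a j) with h | h
  · rw [h, elemSym_zero, map_one, elemG_zero]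
  · exact gHom_elemSym G _ h

/-- The colour classes of a proper colouring form a family of stable sets of sizes `d i` covering
each vertex once. Such families are what the coefficient of the product of all vertices counts. -/
lemma coeff_chromSeries (d : ℕ →₀ ℕ) :
    MvPowerSeries.coeff d (chromSeries G) = topCoeff G (elemProd d) := by
  classical
  obtain ⟨N, hN⟩ : ∃ N, ∀ i ∈ d.support, i < N :=
    ⟨d.support.sup id + 1, fun i hi => Nat.lt_succ_of_le (le_sup (f := id) hi)⟩
  obtain ⟨d, rfl⟩ := exists_embDomain_fin d hN
  rw [topCoeff_apply, gHom_elemProd]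
  simp only [elemG]
  rw [coeff_prod_sum_prod]
  change (Nat.card _ : ℤ) = _
  rw [← Nat.card_eq_finsetCard]
  congr 1
  have hcard : ∀ (c : V → ℕ) i, Nat.card {v // c v = i} = (univ.filter fun v => c v = i).card := by
    intro c i
    rw [Nat.card_eq_fintype_card, Fintype.card_subtype]
  refine Nat.card_congr (Equiv.ofBijective (fun c => ⟨fun j => univ.filter fun v => c.1 v = j, ?_⟩)
    ⟨?_, ?_⟩)
  · obtain ⟨c, hc⟩ := c
    simp only [hcard] at hc
    simp only [mem_filter, mem_univ, true_and]
    refine ⟨fun j => ⟨?_, ?_⟩, fun v => ?_⟩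
    · rw [hc]
      exact Finsupp.embDomain_apply_self Fin.valEmbedding d j
    · intro u hu v hv _ hadj
      simp only [coe_filter, mem_univ, true_and, Set.mem_ofPred_eq] at hu hv
      exact c.valid hadj (hu.trans hv.symm)
    · have hv : c v < N := by
        refine hN _ ?_
        rw [Finsupp.mem_support_iff, ← hc, card_ne_zero]
        exact ⟨v, by simp⟩
      rw [Finsupp.equivFunOnFinite_symm_apply_apply, card_eq_one]
      refine ⟨⟨c v, hv⟩, ?_⟩
      ext j
      simp [Fin.ext_iff, eq_comm]
  · rintro ⟨c, hc⟩ ⟨c', hc'⟩ h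
    simp only [Subtype.mk.injEq, funext_iff] at h
    refine Subtype.ext (DFunLike.ext _ _ fun v => ?_)
    simp only [hcard] at hc
    have hv : c v < N := by
      refine hN _ ?_
      rw [Finsupp.mem_support_iff, ← hc, card_ne_zero]
      exact ⟨v, by simp⟩
    have h1 : v ∈ univ.filter fun u => c u = (⟨c v, hv⟩ : Fin N) := by simp
    rw [h] at h1
    exact (mem_filter.mp h1).2.symm
  · rintro ⟨A, hA⟩
    simp only [mem_filter, mem_univ, true_and, Finsupp.equivFunOnFinite_symm_apply_apply,
      card_eq_one] at hA
    obtain ⟨hA1, hA2⟩ := hA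
    choose c hc using hA2
    have hc' : ∀ v j, v ∈ A j ↔ j = c v := by
      intro v j
      have := congrArg (j ∈ ·) (hc v)
      simpa using this
    have hfil : ∀ j : Fin N, (univ.filter fun v => (c v : ℕ) = j) = A j := by
      intro j
      ext v
      simp [hc', Fin.ext_iff, eq_comm]
    refine ⟨⟨SimpleGraph.Coloring.mk (fun v => (c v : ℕ)) ?_, ?_⟩, ?_⟩
    · intro u v hadj h
      have h' := Fin.ext h
      exact (hA1 (c u)).2 ((hc' u _).mpr rfl) ((hc' v _).mpr h') hadj.ne hadj
    · intro i
      refine (hcard (fun v => (c v : ℕ)) i).trans ?_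
      by_cases hi : i < N
      · rw [hfil ⟨i, hi⟩, (hA1 ⟨i, hi⟩).1]
        exact (Finsupp.embDomain_apply_self Fin.valEmbedding d ⟨i, hi⟩).symm
      · rw [Finsupp.embDomain_of_notMem_range, card_eq_zero, filter_eq_empty_iff]
        · intro v _ h
          exact hi (h ▸ (c v).2)
        · rintro ⟨j, rfl⟩
          exact hi j.2
    · exact Subtype.ext (funext hfil)

lemma homogSeries_chromSeries : HomogSeries (Fintype.card V) (chromSeries G) := by
  classical
  intro d hd
  have hd' : (Nat.card {c : G.Coloring ℕ // ∀ i, Nat.card {v : V // c v = i} = d i} : ℤ) ≠ 0 := hd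
  rw [Nat.cast_ne_zero] at hd'
  obtain ⟨⟨c, hc⟩⟩ := (Nat.card_ne_zero.mp hd').1
  have hc' : ∀ i, (univ.filter fun v => c v = i).card = d i := by
    intro i
    rw [← hc, Nat.card_eq_fintype_card, Fintype.card_subtype]
  rw [← card_univ, card_eq_sum_card_fiberwise (f := c) (t := d.support)]
  · exact sum_congr rfl fun i _ => (hc' i).symm
  · intro v _
    rw [mem_coe, Finsupp.mem_support_iff, ← hc', card_ne_zero]
    exact ⟨v, by simp⟩

/-- The coefficient at `x^d` is `topCoeff` of the product of the `e_{d i}`. Expanding that product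
in the `m_μ` and using the symmetry of the transition matrix makes it the coefficient at `x^d` of
the right-hand side. -/
lemma chromSeries_eq_sum {n : ℕ} (hn : Fintype.card V = n) :
    chromSeries G = ∑ μ : n.Partition,
      topCoeff G (monoSym μ.parts) • (μ.parts.map elemSeries).prod := by
  ext d
  simp only [map_sum, ← elemProd_repExp, map_zsmul]
  by_cases hd : d.degree = n
  · rw [coeff_chromSeries, eq_sum_monoSym (n := n) (elemProd d) (hd ▸ homogSeries_elemProd d), map_sum]
    refine sum_congr rfl fun μ _ => ?_
    rw [coeff_elemProd_symm d, map_zsmul, smul_eq_mul, smul_eq_mul, mul_comm]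
  · rw [sum_eq_zero]
    · by_contra h
      exact hd (hn ▸ homogSeries_chromSeries G d h)
    · intro μ _
      by_contra h
      exact hd ((homogSeries_elemProd _ d (right_ne_zero_of_smul h)).trans (degree_repExp μ))

lemma prod_X_eq_monomial (s : Multiset ℕ) :
    (s.map fun i => (X i : MvPolynomial ℕ ℤ)).prod = monomial (Multiset.toFinsupp s) 1 := by
  induction s using Multiset.induction_on with
  | empty => simp
  | cons a s ih =>
    rw [Multiset.map_cons, Multiset.prod_cons, ih, X, monomial_mul, one_mul, ← Multiset.singleton_add,
      map_add, Multiset.toFinsupp_singleton]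

/-- The products of elementary symmetric functions are linearly independent. -/
lemma eq_zero_of_sum_elemSeries {n : ℕ} (c : n.Partition → ℤ)
    (hc : ∑ μ, c μ • (μ.parts.map elemSeries).prod = 0) (μ : n.Partition) : c μ = 0 := by
  classical
  -- Variable `i` of `elemHom` stands for `e_{i+1}`, whence the shift; it loses nothing because
  -- parts are positive.
  let t : n.Partition → ℕ →₀ ℕ := fun μ => Multiset.toFinsupp (μ.parts.map (· - 1))
  have ht : Function.Injective t := by
    intro μ ν h
    have h1 := congrArg (Multiset.map (· + 1)) (Multiset.toFinsupp.injective h)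
    have h2 : ∀ μ : n.Partition, (μ.parts.map (· - 1)).map (· + 1) = μ.parts := by
      intro μ
      rw [Multiset.map_map]
      refine (Multiset.map_congr rfl fun k hk => ?_).trans (Multiset.map_id _)
      exact Nat.sub_add_cancel (μ.parts_pos hk)
    rw [h2, h2] at h1
    exact Nat.Partition.ext h1
  have he : ∀ μ : n.Partition, ((elemHom (monomial (t μ) 1) : SymFunc) : MvPowerSeries ℕ ℤ) =
      (μ.parts.map elemSeries).prod := by
    intro μ
    change SymFunc.val (elemHom (monomial (t μ) 1)) = _
    rw [← prod_X_eq_monomial, Multiset.map_map, map_multiset_prod, map_multiset_prod,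
      Multiset.map_map, Multiset.map_map]
    congr 1
    refine Multiset.map_congr rfl fun k hk => ?_
    simp only [Function.comp_apply, elemHom, aeval_X]
    rw [Nat.sub_add_cancel (μ.parts_pos hk)]
    rfl
  have h0 : ∑ μ, C (c μ) * monomial (t μ) (1 : ℤ) = 0 := by
    refine elemHom_injective (Subtype.val_injective ?_)
    change SymFunc.val (elemHom _) = SymFunc.val (elemHom 0)
    rw [map_zero, map_zero, ← hc, map_sum, map_sum]
    refine sum_congr rfl fun ν _ => ?_
    rw [zsmul_eq_mul, ← he, map_mul, map_mul, eq_intCast C, map_intCast, map_intCast]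
    rfl
  have h1 := congrArg (coeff (t μ)) h0
  simp only [coeff_sum, coeff_C_mul, coeff_monomial, ht.eq_iff, coeff_zero] at h1
  simpa using h1

lemma chromSeries_coeff_unique {n : ℕ} (hn : Fintype.card V = n) (c : n.Partition → ℤ)
    (hc : chromSeries G = ∑ μ, c μ • (μ.parts.map elemSeries).prod) (μ : n.Partition) :
    c μ = topCoeff G (monoSym μ.parts) := by
  have h := chromSeries_eq_sum G hn
  rw [hc, ← sub_eq_zero, ← sum_sub_distrib] at h
  simp only [← sub_smul] at h
  exact sub_eq_zero.mp (eq_zero_of_sum_elemSeries _ h μ)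

end Chromatic

/-! ### From sequences in the poset to reversed lists of reals. -/

section Bridge

variable {U : Type*} (f : U → ℝ)

/-- The reversed list of the values of a sequence. -/
def revList : ∀ {n : ℕ}, (Fin n → U) → List ℝ
  | 0, _ => []
  | _ + 1, w => f (w (Fin.last _)) :: revList (Fin.init w)

lemma revList_succ {n : ℕ} (w : Fin (n + 1) → U) :
    revList f w = f (w (Fin.last n)) :: revList f (Fin.init w) := rfl

lemma seqSum_eq_sum [Fintype U] {A : Type*} [CommRing A] (m : U → A) (n : ℕ) (F : List ℝ → ℤ) :
    seqSum f m n F = ∑ w : Fin n → U, (∏ i, m (w i)) * (F (revList f w) : A) := by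
  induction n generalizing F with
  | zero => simp [seqSum_zero, revList]
  | succ n ih =>
    rw [← (Fin.snocEquiv fun _ => U).sum_comp, Fintype.sum_prod_type, seqSum_succ]
    refine Finset.sum_congr rfl fun u _ => ?_
    rw [ih, Finset.mul_sum]
    refine Finset.sum_congr rfl fun w _ => ?_
    have h : (Fin.snocEquiv fun _ => U) (u, w) = Fin.snoc (α := fun _ => U) w u := rfl
    simp only [h, revList_succ, Fin.prod_univ_castSucc, Fin.snoc_castSucc, Fin.snoc_last,
      Fin.init_snoc]
    ring

variable [PartialOrder U] {f}

open Classical in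
lemma ab_eq_ite (hf : ∀ u w : U, w < u ↔ f w + 1 ≤ f u) (u w : U) :
    ab (f u) (f w) = if u < w then 1 else 0 := by
  simp only [ab, hf]

lemma aboveAll_iff (hf : ∀ u w : U, w < u ↔ f w + 1 ≤ f u) {n : ℕ} (z : U) (w : Fin (n + 1) → U) :
    AboveAll z w ↔ listMax (revList f w) + 1 ≤ f z := by
  induction n with
  | zero => simp [AboveAll, revList, listMax, hf]
  | succ n ih =>
    rw [revList_succ, revList_succ, listMax_cons, ← revList_succ, ← max_add_add_right, max_le_iff,
      ← ih, ← hf, AboveAll, Fin.forall_fin_succ', and_comm]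
    rfl

lemma isCorrect_succ {n : ℕ} (w : Fin (n + 2) → U) : IsCorrect w ↔ IsCorrect (Fin.init w) ∧
    ¬ w (Fin.last (n + 1)) < Fin.init w (Fin.last n) ∧ ¬ AboveAll (w (Fin.last (n + 1))) (Fin.init w) := by
  constructor
  · rintro ⟨h1, h2⟩
    refine ⟨⟨fun i h => h1 i (by omega), fun j hj => ?_⟩, h1 n (by omega), fun h => ?_⟩
    · obtain ⟨i, hi, h⟩ := h2 j.castSucc hj
      exact ⟨⟨i, lt_trans hi j.2⟩, hi, h⟩
    · obtain ⟨i, hi, h'⟩ := h2 (Fin.last (n + 1)) (by simp)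
      exact h' (h ⟨i, hi⟩)
  · rintro ⟨⟨h1, h2⟩, h3, h4⟩
    refine ⟨fun i h => ?_, fun j hj => ?_⟩
    · rcases Nat.lt_or_ge (i + 1) (n + 1) with h' | h'
      · exact h1 i h'
      · obtain rfl : i = n := by omega
        exact h3
    · induction j using Fin.lastCases with
      | last =>
        rw [AboveAll, not_forall] at h4
        obtain ⟨i, hi⟩ := h4
        exact ⟨i.castSucc, Fin.castSucc_lt_last i, hi⟩
      | cast j =>
        obtain ⟨i, hi, h⟩ := h2 j hj
        exact ⟨i.castSucc, hi, h⟩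

lemma isCorrect_iff (hf : ∀ u w : U, w < u ↔ f w + 1 ≤ f u) {n : ℕ} (w : Fin (n + 1) → U) :
    IsCorrect w ↔ Cor (revList f w) := by
  induction n with
  | zero =>
    refine ⟨fun _ => trivial, fun _ => ⟨fun i h => by omega, fun j hj => by omega⟩⟩
  | succ n ih =>
    rw [isCorrect_succ, ih, aboveAll_iff hf, hf, not_le, not_le, revList_succ, revList_succ]
    rfl

lemma isTheta_of_sim {n θ : ℕ} {w : Fin (n + 2) → U}
    (h : Sim (Fin.init w (Fin.last n)) (w (Fin.last (n + 1)))) : IsTheta w θ ↔ θ = n + 1 := by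
  have : IsTheta w (n + 1) := ⟨⟨by omega, by omega, h⟩, fun i hi => by
    obtain ⟨-, hi, -⟩ := hi
    omega⟩
  exact ⟨fun h' => h'.unique this, fun h' => h' ▸ this⟩

lemma isTheta_of_not_sim {n θ : ℕ} {w : Fin (n + 2) → U}
    (h : ¬ Sim (Fin.init w (Fin.last n)) (w (Fin.last (n + 1)))) :
    IsTheta w θ ↔ IsTheta (Fin.init w) θ := by
  have : {i : ℕ | 1 ≤ i ∧ ∃ h : i < n + 2, Sim (w ⟨i - 1, by omega⟩) (w ⟨i, h⟩)} =
      {i : ℕ | 1 ≤ i ∧ ∃ h : i < n + 1,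
        Sim (Fin.init w ⟨i - 1, by omega⟩) (Fin.init w ⟨i, h⟩)} := by
    ext i
    constructor
    · rintro ⟨h1, h2, h3⟩
      refine ⟨h1, ?_, h3⟩
      by_contra h4
      obtain rfl : i = n + 1 := by omega
      exact h h3
    · rintro ⟨h1, h2, h3⟩
      exact ⟨h1, by omega, h3⟩
  rw [IsTheta, IsTheta, this]

lemma not_isTheta_one {θ : ℕ} (w : Fin 1 → U) : ¬ IsTheta w θ := by
  rintro ⟨⟨h1, h2, -⟩, -⟩
  omega

/-- The first two elements of a correct sequence are always incomparable, so a maximal such position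
exists. -/
lemma exists_isTheta {n : ℕ} {w : Fin (n + 2) → U} (hw : IsCorrect w) : ∃ θ, IsTheta w θ := by
  induction n with
  | zero =>
    rw [isCorrect_succ] at hw
    refine ⟨1, (isTheta_of_sim ⟨fun h => hw.2.2 fun i => ?_, hw.2.1⟩).mpr rfl⟩
    rwa [Fin.fin_one_eq_zero i]
  | succ n ih =>
    by_cases h : Sim (Fin.init w (Fin.last (n + 1))) (w (Fin.last (n + 2)))
    · exact ⟨_, (isTheta_of_sim h).mpr rfl⟩
    · obtain ⟨θ, hθ⟩ := ih ((isCorrect_succ w).mp hw).1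
      exact ⟨θ, (isTheta_of_not_sim h).mpr hθ⟩

/-- `w_θ ≻ p` and `w_{θ+1} ≻ q`. -/
def ThetaAbove {n : ℕ} (w : Fin n → U) (p q : U) : Prop :=
  ∃ θ : ℕ, IsTheta w θ ∧ ∃ h : θ < n, p < w ⟨θ - 1, by omega⟩ ∧ q < w ⟨θ, h⟩

/-- There is `γ` with `θ < γ < n`, `w_γ ∼ z` and `w_γ ≻ q`. -/
def GammaAbove {n : ℕ} (w : Fin n → U) (z q : U) : Prop :=
  ∃ θ : ℕ, IsTheta w θ ∧ ∃ γ : ℕ, θ < γ ∧ ∃ hγ : γ < n,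
      Sim (w ⟨γ - 1, by omega⟩) z ∧ q < w ⟨γ - 1, by omega⟩

/-- There is `γ` with `θ < γ ≤ n`, `w_γ ∼ z` and `w_γ ≻ q`. -/
def GammaAbove' {n : ℕ} (w : Fin n → U) (z q : U) : Prop :=
  ∃ θ : ℕ, IsTheta w θ ∧ ∃ γ : ℕ, θ < γ ∧ ∃ hγ : γ - 1 < n,
      Sim (w ⟨γ - 1, hγ⟩) z ∧ q < w ⟨γ - 1, hγ⟩

lemma sim_iff {n : ℕ} {w : Fin (n + 2) → U} (hw : IsCorrect w) :
    ¬ Sim (Fin.init w (Fin.last n)) (w (Fin.last (n + 1))) ↔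
      Fin.init w (Fin.last n) < w (Fin.last (n + 1)) := by
  rw [isCorrect_succ] at hw
  simp [Sim, hw.2.1]

open Classical in
lemma thetaInd_revList (hf : ∀ u w : U, w < u ↔ f w + 1 ≤ f u) {n : ℕ} {w : Fin (n + 1) → U}
    (hw : IsCorrect w) (p q : U) :
    thetaInd (f p) (f q) (revList f w) = if ThetaAbove w p q then 1 else 0 := by
  induction n with
  | zero =>
    rw [if_neg]
    · rfl
    · rintro ⟨θ, hθ, -⟩
      exact not_isTheta_one w hθ
  | succ n ih =>
    rw [revList_succ, revList_succ, thetaInd_cons, ← revList_succ, ih ((isCorrect_succ w).mp hw).1]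
    simp only [ab_eq_ite hf]
    by_cases h : Sim (Fin.init w (Fin.last n)) (w (Fin.last (n + 1)))
    · have h' := not_iff_not.mpr (sim_iff hw)
      rw [not_not] at h'
      have e : ThetaAbove w p q ↔ p < Fin.init w (Fin.last n) ∧ q < w (Fin.last (n + 1)) := by
        simp only [ThetaAbove, isTheta_of_sim h, exists_eq_left]
        exact ⟨fun ⟨_, h⟩ => h, fun h => ⟨by omega, h⟩⟩
      simp only [e, if_neg (h'.mp h)]
      clear hf ih
      split_ifs <;> simp_all
    · have e : ThetaAbove w p q ↔ ThetaAbove (Fin.init w) p q := by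
        simp only [ThetaAbove, isTheta_of_not_sim h]
        refine exists_congr fun θ => and_congr_right fun hθ => ?_
        obtain ⟨⟨_, h1, _⟩, -⟩ := hθ
        exact ⟨fun ⟨_, h⟩ => ⟨h1, h⟩, fun ⟨_, h⟩ => ⟨by omega, h⟩⟩
      simp only [e, if_pos ((sim_iff hw).mp h)]
      ring

-- The statement for the shorter sequence is taken as a hypothesis, because this step is also used
-- inside the induction that proves it.
open Classical in
lemma gammaInd'_revList' (hf : ∀ u w : U, w < u ↔ f w + 1 ≤ f u) {n : ℕ} {w : Fin (n + 2) → U}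
    (hw : IsCorrect w) (z q : U) (ih : gammaInd (f z) (f q) (revList f (Fin.init w)) =
      if GammaAbove' (Fin.init w) z q then 1 else 0) :
    gammaInd' (f z) (f q) (revList f w) = if GammaAbove w z q then 1 else 0 := by
  rw [revList_succ, revList_succ, gammaInd'_cons, ← revList_succ, ih]
  simp only [ab_eq_ite hf]
  by_cases h : Sim (Fin.init w (Fin.last n)) (w (Fin.last (n + 1)))
  · have h' := not_iff_not.mpr (sim_iff hw)
    rw [not_not] at h'
    rw [if_neg (h'.mp h), zero_mul, if_neg]
    rintro ⟨θ, hθ, γ, h1, h2, -⟩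
    rw [isTheta_of_sim h] at hθ
    omega
  · have e : GammaAbove w z q ↔ GammaAbove' (Fin.init w) z q := by
      simp only [GammaAbove, GammaAbove', isTheta_of_not_sim h]
      refine exists_congr fun θ => and_congr_right fun hθ => exists_congr fun γ =>
        and_congr_right fun hγ => ?_
      exact ⟨fun ⟨h1, h⟩ => ⟨by omega, h⟩, fun ⟨h1, h⟩ => ⟨by omega, h⟩⟩
    simp only [e, if_pos ((sim_iff hw).mp h), one_mul]

open Classical in
lemma gammaInd_revList (hf : ∀ u w : U, w < u ↔ f w + 1 ≤ f u) {n : ℕ} {w : Fin (n + 1) → U}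
    (hw : IsCorrect w) (z q : U) :
    gammaInd (f z) (f q) (revList f w) = if GammaAbove' w z q then 1 else 0 := by
  induction n with
  | zero =>
    rw [if_neg]
    · rfl
    · rintro ⟨θ, hθ, -⟩
      exact not_isTheta_one w hθ
  | succ n ih =>
    have h1 := gammaInd'_revList' hf hw z q (ih ((isCorrect_succ w).mp hw).1)
    have e : GammaAbove' w z q ↔ (Sim (w (Fin.last (n + 1))) z ∧ q < w (Fin.last (n + 1))) ∨
        GammaAbove w z q := by
      constructor
      · rintro ⟨θ, hθ, γ, h2, h3, h4⟩
        rcases Nat.lt_or_ge γ (n + 2) with h5 | h5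
        · exact Or.inr ⟨θ, hθ, γ, h2, h5, h4⟩
        · obtain rfl : γ = n + 2 := by omega
          exact Or.inl h4
      · rintro (h | ⟨θ, hθ, γ, h2, h3, h4⟩)
        · obtain ⟨θ, hθ⟩ := exists_isTheta hw
          obtain ⟨⟨_, h1, _⟩, -⟩ := id hθ
          exact ⟨θ, hθ, n + 2, h1, by omega, h⟩
        · exact ⟨θ, hθ, γ, h2, by omega, h4⟩
    have e2 : gammaInd (f z) (f q) (revList f w) = sm (f (w (Fin.last (n + 1)))) (f z) *
        ab (f q) (f (w (Fin.last (n + 1)))) + (1 - sm (f (w (Fin.last (n + 1)))) (f z) *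
        ab (f q) (f (w (Fin.last (n + 1))))) * gammaInd' (f z) (f q) (revList f w) := rfl
    rw [e2, h1]
    simp only [e, sm, ab_eq_ite hf, Sim]
    clear e2 h1 e ih hf
    split_ifs <;> simp_all

open Classical in
lemma gammaInd'_revList (hf : ∀ u w : U, w < u ↔ f w + 1 ≤ f u) {n : ℕ} {w : Fin (n + 2) → U}
    (hw : IsCorrect w) (z q : U) :
    gammaInd' (f z) (f q) (revList f w) = if GammaAbove w z q then 1 else 0 :=
  gammaInd'_revList' hf hw z q (gammaInd_revList hf ((isCorrect_succ w).mp hw).1 z q)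

end Bridge

/-! ### Indicators of the sets `M`, and the theorem. -/

section Final

variable {U : Type*} [PartialOrder U] {f : U → ℝ}

lemma mem_MSet1_iff {n : ℕ} {w : Fin (n + 1) → U} (hw : IsCorrect w) (z : U) :
    (w, z) ∈ MSet1 U (n + 1) ↔ AboveAll z w ∨ z < w (Fin.last n) :=
  ⟨fun h => h.2.imp_right fun ⟨_, h⟩ => h, fun h => ⟨hw, h.imp_right fun h => ⟨by omega, h⟩⟩⟩

lemma mem_MSet2_iff {n : ℕ} {w : Fin (n + 2) → U} (hw : IsCorrect w) {q : Fin 2 → U}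
    (hq : IsCorrect q) : (w, q) ∈ MSet2 U (n + 2) ↔
      (AboveAll (q 0) (Fin.init w) ∧ w (Fin.last (n + 1)) < q 1) ∨ ThetaAbove w (q 0) (q 1) := by
  have h1 : AboveAll (q 0) (Fin.init w) ↔ ∀ i : Fin (n + 2), (i : ℕ) < n + 2 - 1 → w i < q 0 :=
    ⟨fun h i hi => h ⟨i, hi⟩, fun h i => h i.castSucc i.2⟩
  rw [h1]
  exact ⟨fun h => h.2.2.imp_left fun ⟨h1, _, h2⟩ => ⟨h1, h2⟩,
    fun h => ⟨hw, hq, h.imp_left fun ⟨h1, h2⟩ => ⟨h1, by omega, h2⟩⟩⟩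

lemma exceptional1_iff {n : ℕ} {w : Fin (n + 2) → U} {q : Fin 2 → U} {z : U} :
    Exceptional1 w q z ↔ z < w (Fin.last (n + 1)) ∧ AboveAll z q ∧ GammaAbove w z (q 1) :=
  ⟨fun ⟨_, h⟩ => h, fun h => ⟨by omega, h⟩⟩

lemma exceptional2_iff {n : ℕ} {w : Fin (n + 2) → U} {q : Fin 2 → U} {z : U} :
    Exceptional2 w q z ↔
      z < w (Fin.last (n + 1)) ∧ q 1 < z ∧ Sim z (q 0) ∧ GammaAbove w z (q 0) :=
  ⟨fun ⟨_, h⟩ => h, fun h => ⟨by omega, h⟩⟩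

lemma aboveAll_two (z : U) (q : Fin 2 → U) : AboveAll z q ↔ q 0 < z ∧ q 1 < z := by
  simp [AboveAll, Fin.forall_fin_two]

lemma isCorrect_two (q : Fin 2 → U) : IsCorrect q ↔ Sim (q 0) (q 1) := by
  constructor
  · rintro ⟨h1, h2⟩
    refine ⟨fun h => ?_, h1 0 (by omega)⟩
    obtain ⟨i, hi, h'⟩ := h2 1 (by simp)
    obtain rfl : i = 0 := by
      rw [Fin.lt_def] at hi
      exact Fin.ext (by simpa using hi)
    exact h' h
  · rintro ⟨h1, h2⟩
    refine ⟨fun i hi => ?_, fun j hj => ⟨0, hj, ?_⟩⟩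
    · obtain rfl : i = 0 := by omega
      exact h2
    · obtain rfl : j = 1 := by
        refine Fin.ext ?_
        have := j.2
        simp only [Fin.val_one]
        omega
      exact h1

open Classical in
lemma sm_eq_ite (hf : ∀ u w : U, w < u ↔ f w + 1 ≤ f u) (u w : U) :
    sm (f u) (f w) = if Sim u w then 1 else 0 := by
  rw [sm, ab_eq_ite hf, ab_eq_ite hf, Sim]
  clear hf
  split_ifs <;> simp_all

open Classical in
lemma corInd_eq_ite : ∀ w : List ℝ, corInd w = if Cor w then 1 else 0
  | [] => (if_pos trivial).symm
  | [_] => (if_pos trivial).symm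
  | y :: x :: r => by
    rw [corInd_cons, corInd_eq_ite (x :: r), Cor, ← not_le, ← not_le, ab, ab]
    split_ifs <;> simp_all

open Classical in
lemma corInd_revList (hf : ∀ u w : U, w < u ↔ f w + 1 ≤ f u) {n : ℕ} (w : Fin (n + 1) → U) :
    corInd (revList f w) = if IsCorrect w then 1 else 0 := by
  simp only [isCorrect_iff hf, corInd_eq_ite]

open Classical in
lemma ind21_revList (hf : ∀ u w : U, w < u ↔ f w + 1 ≤ f u) {n : ℕ} {w : Fin (n + 2) → U}
    (hw : IsCorrect w) {q : Fin 2 → U} (hq : IsCorrect q) (z : U) :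
    ind21 (f (q 0)) (f (q 1)) (f z) (revList f w) =
      if (w, q, z) ∈ MSet21 U (n + 2) then 1 else 0 := by
  have hM : ∀ {k : ℕ} (v : Fin (k + 1) → U) (u : U),
      ab (listMax (revList f v)) (f u) = if AboveAll u v then 1 else 0 := by
    intro k v u
    simp only [ab, aboveAll_iff hf]
  have h1 : pairOK (f (q 0)) (f (q 1)) (revList f w) =
      1 - if (w, q) ∈ MSet2 U (n + 2) then 1 else 0 := by
    -- This makes the two alternatives defining `M_{l,2}` exclusive: the other one requires `w_l ≺
    -- q_2`.
    have h2 : ThetaAbove w (q 0) (q 1) → q 1 < w (Fin.last (n + 1)) := by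
      intro h
      have h3 := thetaInd_revList hf hw (q 0) (q 1)
      rw [if_pos h] at h3
      have h4 := (isCorrect_iff hf w).mp hw
      rw [revList_succ, revList_succ] at h3 h4
      rw [hf]
      rcases thetaInd_cases (f (q 0)) (f (q 1)) h4 with h5 | h5
      · omega
      · exact h5.2.2
    have h3 : pairOK (f (q 0)) (f (q 1)) (revList f w) =
      1 - ab (listMax (revList f (Fin.init w))) (f (q 0)) * ab (f (w (Fin.last (n + 1)))) (f (q 1)) -
        thetaInd (f (q 0)) (f (q 1)) (revList f w) := rfl
    rw [h3, hM, thetaInd_revList hf hw, mem_MSet2_iff hw hq, ab_eq_ite hf]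
    have h4 := fun h h' => lt_asymm (h2 h) h'
    clear h3 hM hf h2
    split_ifs <;> simp_all
  have h2 : snocOK (f z) (revList f w) = 1 - if (w, z) ∈ MSet1 U (n + 2) then 1 else 0 := by
    have h3 : snocOK (f z) (revList f w) =
      (1 - ab (f z) (f (w (Fin.last (n + 1))))) * (1 - ab (listMax (revList f w)) (f z)) := rfl
    rw [h3, hM, mem_MSet1_iff hw, ab_eq_ite hf]
    clear h3 hM hf h1
    split_ifs <;> simp_all
  have h3 : tripleC (f (q 0)) (f (q 1)) (f z) = 1 - if (q, z) ∈ MSet1 U 2 then 1 else 0 := by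
    have h4 : (q, z) ∈ MSet1 U 2 ↔ (q 0 < z ∧ q 1 < z) ∨ z < q 1 := by
      rw [mem_MSet1_iff hq, aboveAll_two]
      rfl
    rw [tripleC, ab_eq_ite hf, ab_eq_ite hf, ab_eq_ite hf, h4]
    clear h1 h2 h4 hM hf
    split_ifs <;> simp_all
  have h4 : exc1 (f (q 0)) (f (q 1)) (f z) (revList f w) =
      if Exceptional1 w q z then 1 else 0 := by
    have h5 : exc1 (f (q 0)) (f (q 1)) (f z) (revList f w) =
      ab (f z) (f (w (Fin.last (n + 1)))) * (ab (f (q 0)) (f z) * ab (f (q 1)) (f z)) *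
        gammaInd' (f z) (f (q 1)) (revList f w) := rfl
    rw [h5, gammaInd'_revList hf hw, ab_eq_ite hf, ab_eq_ite hf, ab_eq_ite hf, exceptional1_iff,
      aboveAll_two]
    clear h1 h2 h3 h5 hM hf
    split_ifs <;> simp_all
  have h5 : exc2 (f (q 0)) (f (q 1)) (f z) (revList f w) =
      if Exceptional2 w q z then 1 else 0 := by
    have h6 : exc2 (f (q 0)) (f (q 1)) (f z) (revList f w) =
      ab (f z) (f (w (Fin.last (n + 1)))) * (ab (f (q 1)) (f z) * sm (f z) (f (q 0))) *
        gammaInd' (f z) (f (q 0)) (revList f w) := rfl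
    rw [h6, gammaInd'_revList hf hw, ab_eq_ite hf, ab_eq_ite hf, sm_eq_ite hf, exceptional2_iff]
    clear h1 h2 h3 h4 h6 hM hf
    split_ifs <;> simp_all
  have h6 : (w, q, z) ∈ MSet21 U (n + 2) ↔ ((w, q) ∈ MSet2 U (n + 2) ∧ (w, z) ∈ MSet1 U (n + 2) ∧
      (q, z) ∈ MSet1 U 2) ∨ Exceptional1 w q z ∨ Exceptional2 w q z :=
    ⟨fun h => h.2.2, fun h => ⟨hw, hq, h⟩⟩
  -- The first exceptional family meets the main one exactly where `(w | q)` lies in `M_{l,2}`,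
  -- hence the factor `pairOK` in `ind21`. The second is disjoint from both others, since each of
  -- them requires `(q | z)` to lie in `M_{2,1}`.
  have e1 : Exceptional1 w q z → (w, z) ∈ MSet1 U (n + 2) ∧ (q, z) ∈ MSet1 U 2 := by
    rw [exceptional1_iff, mem_MSet1_iff hw, mem_MSet1_iff hq]
    exact fun h => ⟨Or.inr h.1, Or.inl h.2.1⟩
  have e2 : Exceptional2 w q z → ¬ (q, z) ∈ MSet1 U 2 := by
    rw [exceptional2_iff, mem_MSet1_iff hq, aboveAll_two]
    rintro ⟨-, h1, h2, -⟩ (h3 | h3)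
    · exact h2.2 h3.1
    · exact lt_asymm h1 h3
  rw [ind21, h1, h2, h3, h4, h5, h6]
  clear h1 h2 h3 h4 h5 h6 hM hf
  split_ifs <;> simp_all

variable [Fintype U]

lemma sumMSet21_eq_tripleSum (hf : ∀ u w : U, w < u ↔ f w + 1 ≤ f u) (n : ℕ) :
    sumMSet21 U (n + 2) = tripleSum f (fun u => (X u : MvPolynomial U ℤ)) (n + 2)
      (fun p q z w => sm p q * ind21 p q z w) := by
  classical
  have h1 : ∀ (w : Fin (n + 2) → U) (q : Fin 2 → U) (z : U),
      corInd (revList f w) * (sm (f (q 0)) (f (q 1)) *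
        ind21 (f (q 0)) (f (q 1)) (f z) (revList f w)) =
      if (w, q, z) ∈ MSet21 U (n + 2) then 1 else 0 := by
    intro w q z
    rw [corInd_revList hf, sm_eq_ite hf, ← isCorrect_two]
    by_cases hw : IsCorrect w
    · by_cases hq : IsCorrect q
      · rw [if_pos hw, if_pos hq, ind21_revList hf hw hq, one_mul, one_mul]
      · rw [if_neg hq, if_neg (show (w, q, z) ∉ MSet21 U (n + 2) from fun h => hq h.2.1)]
        ring
    · rw [if_neg hw, if_neg (show (w, q, z) ∉ MSet21 U (n + 2) from fun h => hw h.1)]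
      ring
  have h2 : tripleSum f (fun u => (X u : MvPolynomial U ℤ)) (n + 2)
      (fun p q z w => sm p q * ind21 p q z w) = ∑ q : Fin 2 → U, ∑ z : U, ∑ w : Fin (n + 2) → U,
        if (w, q, z) ∈ MSet21 U (n + 2) then (∏ i, X (w i)) * (∏ i, X (q i)) * X z else 0 := by
    rw [← (finTwoArrowEquiv U).symm.sum_comp, Fintype.sum_prod_type, tripleSum]
    refine Finset.sum_congr rfl fun p _ => Finset.sum_congr rfl fun q _ =>
      Finset.sum_congr rfl fun z _ => ?_
    rw [seqSum_eq_sum, Finset.mul_sum]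
    refine Finset.sum_congr rfl fun w _ => ?_
    have h3 := h1 w ![p, q] z
    simp only [Matrix.cons_val_zero, Matrix.cons_val_one] at h3
    rw [h3]
    simp only [finTwoArrowEquiv_symm_apply, Fin.prod_univ_two, Matrix.cons_val_zero,
      Matrix.cons_val_one]
    split_ifs
    · push_cast
      ring
    · simp
  rw [h2, sumMSet21, Finset.sum_filter, Fintype.sum_prod_type, Finset.sum_comm,
    Fintype.sum_prod_type]

lemma gHom_powerSum_combination (hf : ∀ u w : U, w < u ↔ f w + 1 ≤ f u) (n : ℕ) :
    gHom (incGraph U) (monoSym {n + 2} * monoSym {2} * monoSym {1} - monoSym {n + 2 + 2} * monoSym {1}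
      - monoSym {n + 2 + 1} * monoSym {2} - monoSym {n + 2} * monoSym {3} +
      2 * monoSym {n + 2 + 3}) = sumMSet21 U (n + 2) := by
  simp only [map_add, map_sub, map_mul, map_ofNat]
  rw [gHom_powerSum hf (n + 2) (by omega), gHom_powerSum hf 2 (by omega),
    gHom_powerSum hf 1 (by omega), gHom_powerSum hf (n + 2 + 2) (by omega),
    gHom_powerSum hf (n + 2 + 1) (by omega), gHom_powerSum hf 3 (by omega),
    gHom_powerSum hf (n + 2 + 3) (by omega), sumMSet21_eq_tripleSum hf, tripleSum_ind21]

lemma coeff_sumMSet21_nonneg (l : ℕ) (d : U →₀ ℕ) : 0 ≤ coeff d (sumMSet21 U l) := by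
  classical
  rw [sumMSet21, coeff_sum]
  refine Finset.sum_nonneg fun p _ => ?_
  simp only [X]
  rw [← monomial_sum_one, ← monomial_sum_one, monomial_mul, monomial_mul, coeff_monomial]
  split_ifs <;> simp

end Final

theorem mainTheorem2 (U : Type*) [PartialOrder U] [Fintype U] (hU : IsUnitIntervalOrder U) :
    (∀ l : ℕ, 3 ≤ l → gHom (incGraph U) (monoSym {l, 2, 1}) = sumMSet21 U l) ∧
    2 • gHom (incGraph U) (monoSym {2, 2, 1}) = sumMSet21 U 2 ∧
    (5 ≤ Fintype.card U →
      (∃! c : (Fintype.card U).Partition → ℤ,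
        chromSeries (incGraph U) = ∑ μ, c μ • (μ.parts.map elemSeries).prod) ∧
      ∀ c : (Fintype.card U).Partition → ℤ,
        chromSeries (incGraph U) = ∑ μ, c μ • (μ.parts.map elemSeries).prod →
        ∀ μ : (Fintype.card U).Partition,
          μ.parts = {Fintype.card U - 3, 2, 1} → 0 ≤ c μ) := by
  obtain ⟨-, f, -, hf⟩ := hU
  have ha : ∀ l : ℕ, 3 ≤ l → gHom (incGraph U) (monoSym {l, 2, 1}) = sumMSet21 U l := by
    intro l hl
    obtain ⟨n, rfl⟩ : ∃ n, l = n + 2 := ⟨l - 2, by omega⟩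
    rw [monoSym_eq_powerSum _ hl, gHom_powerSum_combination hf]
  have hb : 2 • gHom (incGraph U) (monoSym {2, 2, 1}) = sumMSet21 U 2 := by
    rw [← gHom_powerSum_combination hf 0, zero_add, ← two_mul_monoSym_eq_powerSum, map_mul, map_ofNat,
      two_nsmul, two_mul]
  refine ⟨ha, hb, fun hn => ⟨⟨_, chromSeries_eq_sum _ rfl, fun c hc =>
    funext fun μ => chromSeries_coeff_unique _ rfl c hc μ⟩, fun c hc μ hμ => ?_⟩⟩
  rw [chromSeries_coeff_unique _ rfl c hc μ, hμ, topCoeff_apply]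
  -- For `n = 5` the first part is `2`, and (b) gives the nonnegativity of twice the coefficient.
  rcases Nat.lt_or_ge 5 (Fintype.card U) with h5 | h5
  · rw [ha _ (by omega)]
    exact coeff_sumMSet21_nonneg _ _
  · rw [show Fintype.card U - 3 = 2 by omega]
    have := coeff_sumMSet21_nonneg 2 (Finsupp.equivFunOnFinite.symm fun _ : U => 1)
    rw [← hb, two_nsmul, coeff_add] at this
    omega
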